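/- An input graph is a finite non-empty simple undirected graph $G=(V,E)$ without isolated vertices; write $n=|V|$, $m=|E|$ and $d=2m/n$ (the average degree). Each vertex is identified by a distinct id, an arbitrary natural number, so ids reveal nothing about $n$. A randomized (adaptive) query algorithm gets no information on $G$ (in particular not $n$) except through an oracle. In the *advanced model* the queries are: $\mathrm{RandVert}()$, a uniformly random vertex; $\mathrm{RandNbr}(x)$, a uniformly random neighbour of $x$; $\mathrm{Degree}(x)$; $\mathrm{Pair}(x,y)$, whether $\{x,y\}\in E$; each at cost $1$; and $\mathrm{Additive}(S)$ for a set $S\subseteq V$, the number of edges with both endpoints in $S$, at cost $|S|$. (A query that mentions a non-vertex is answered "invalid".) In the stronger *full adjacency model* there is in addition the query that returns the whole set of neighbours of a vertex $x$, at cost $1$. The number of queries is the total cost. **Theorem.** (a) There are constants $C$ and $j$ such that for every $\varepsilon\in(0,1)$ there is an algorithm in the advanced model which, on every input graph, with probability $>0.99$ outputs a number $\hat n$ with $|\hat n-n|\le\varepsilon n$ while making at most $C\,\varepsilon^{-2}\sqrt{n/d}\,(\log n)^{j}$ queries; that is, $n$ is $(1\pm\varepsilon)$-approximated in $\widetilde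 O(\varepsilon^{-2}\sqrt{n/d})$ queries. (b) For every constant $c\ge1$ there is $\kappa>0$ such that the following holds for every algorithm in the full adjacency model which, on every input graph, with probability $>2/3$ outputs a number $\hat n$ with $n/c\le\hat n\le cn$. For all integers $n\ge2$ and $m$ with $n/2\le m\le\binom n2$, there is an input graph with exactly $n$ vertices and $m$ edges on which the algorithm makes at least $\kappa\sqrt{n/d}$ queries with probability at least $1/4$, where $d=2m/n$. That is, any constant-factor approximation of $n$ requires $\Omega(\sqrt{n/d})$ queries, for every density. -/

import Mathlib

open scoped ENNReal

/-- An input graph: a finite non-empty simple undirected graph without isolated vertices. Vertices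
are identified with their ids, which are arbitrary distinct natural numbers; as the vertex set is an
arbitrary finite subset of `ℕ`, an id carries no information on the number of vertices. -/
structure InputGraph where
  /-- the vertex set -/
  V : Finset ℕ
  /-- the adjacency relation -/
  graph : SimpleGraph ℕ
  nonempty : V.Nonempty
  mem_of_adj : ∀ x y, graph.Adj x y → x ∈ V
  no_isolated : ∀ x ∈ V, ∃ y, graph.Adj x y

namespace InputGraph

variable (G : InputGraph)

open Classical in
/-- The set of neighbours of `x`. -/
noncomputable def nbrs (x : ℕ) : Finset ℕ := {y ∈ G.V | G.graph.Adj x y}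

theorem nbrs_nonempty {x : ℕ} (hx : x ∈ G.V) : (G.nbrs x).Nonempty := by
  obtain ⟨y, hy⟩ := G.no_isolated x hx
  refine ⟨y, ?_⟩
  simp only [nbrs, Finset.mem_filter]
  exact ⟨G.mem_of_adj y x hy.symm, hy⟩

open Classical in
/-- The set of edges with both endpoints in `S`. -/
noncomputable def edgesIn (S : Finset ℕ) : Finset (Sym2 ℕ) := {e ∈ S.sym2 | e ∈ G.graph.edgeSet}

/-- The number of vertices. -/
def n : ℕ := G.V.card

/-- The number of edges. -/
noncomputable def m : ℕ := (G.edgesIn G.V).card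

/-- The average degree `2m/n`. -/
noncomputable def avgDeg : ℝ := 2 * G.m / G.n

end InputGraph

/-- The oracle queries. -/
inductive Query where
  /-- a uniformly random vertex -/
  | randVert
  /-- a uniformly random neighbour of `x` -/
  | randNbr (x : ℕ)
  /-- the degree of `x` -/
  | degree (x : ℕ)
  /-- whether `x` and `y` are adjacent -/
  | pair (x y : ℕ)
  /-- the number of edges with both endpoints in `S` -/
  | additive (S : Finset ℕ)
  /-- the full adjacency list of `x` -/
  | fullNbrHood (x : ℕ)

/-- An additive query on `S` costs `|S|`; every other query has unit cost. -/
def Query.cost : Query → ℕ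
  | .additive S => S.card
  | _ => 1

/-- The queries of the advanced model: everything except the full adjacency list. -/
def Query.IsAdvanced : Query → Prop
  | .fullNbrHood _ => False
  | _ => True

/-- The possible replies of the oracle. -/
inductive Reply where
  | vertex (x : ℕ)
  | number (k : ℕ)
  | adjacent (b : Bool)
  | vertices (S : Finset ℕ)
  /-- the reply to a query that mentions something that is not a vertex -/
  | invalid

open Classical in
/-- The (random) reply of the oracle for `G`; different replies are independent. -/
noncomputable def InputGraph.reply (G : InputGraph) : Query → PMF Reply
  | .randVert => (PMF.uniformOfFinset G.V G.nonempty).map Reply.vertex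
  | .randNbr x =>
      if hx : x ∈ G.V then (PMF.uniformOfFinset (G.nbrs x) (G.nbrs_nonempty hx)).map Reply.vertex
      else PMF.pure .invalid
  | .degree x => PMF.pure (if x ∈ G.V then .number (G.nbrs x).card else .invalid)
  | .pair x y =>
      PMF.pure (if x ∈ G.V ∧ y ∈ G.V then .adjacent (decide (G.graph.Adj x y)) else .invalid)
  | .additive S => PMF.pure (if S ⊆ G.V then .number (G.edgesIn S).card else .invalid)
  | .fullNbrHood x => PMF.pure (if x ∈ G.V then .vertices (G.nbrs x) else .invalid)

/-- A randomized adaptive query algorithm that knows nothing about the input graph, in particular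
not the number of its vertices. In each step it tosses coins, depending on its internal state (its
memory), and either halts with a real number as output or asks a query; in the latter case the reply
determines the next state. It need not halt. -/
structure Algorithm where
  State : Type
  start : State
  step : State → PMF (ℝ ⊕ (Query × (Reply → State)))

namespace Algorithm

/-- The algorithm runs in the advanced model, that is, it never asks for a full adjacency list.
Without this restriction it runs in the full adjacency model. -/
def IsAdvanced (A : Algorithm) : Prop :=
  ∀ s q f, Sum.inr (q, f) ∈ (A.step s).support → q.IsAdvanced

/-- A configuration of a run: the current state, or the output if the algorithm has halted, and the
total cost of the queries made so far. -/
abbrev Config (A : Algorithm) : Type := (A.State ⊕ ℝ) × ℕ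

/-- One step of a run on `G`. -/
noncomputable def next (A : Algorithm) (G : InputGraph) : A.Config → PMF A.Config
  | (.inr v, k) => PMF.pure (.inr v, k)
  | (.inl s, k) => (A.step s).bind fun a =>
      match a with
      | .inl v => PMF.pure (.inr v, k)
      | .inr (q, f) => (G.reply q).map fun r => (.inl (f r), k + q.cost)

/-- The distribution of the configuration after `t` steps of the run on `G`. -/
noncomputable def config (A : Algorithm) (G : InputGraph) : ℕ → PMF A.Config
  | 0 => PMF.pure (.inl A.start, 0)
  | t + 1 => (config A G t).bind (A.next G)

/-- The probability that the algorithm, run on `G`, halts with an output `v` and a total query cost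
`k` that satisfy `P v k` (as `t` grows, the probability to have done so within `t` steps increases
to it). -/
noncomputable def probHalt (A : Algorithm) (G : InputGraph) (P : ℝ → ℕ → Prop) : ℝ≥0∞ :=
  ⨆ t, (A.config G t).toOuterMeasure {c | ∃ v k, c = (Sum.inr v, k) ∧ P v k}

/-- The probability that the total cost of the queries that the algorithm makes on `G` is at least
`q`, whether or not it halts. -/
noncomputable def probCostGe (A : Algorithm) (G : InputGraph) (q : ℝ) : ℝ≥0∞ :=
  ⨆ t, (A.config G t).toOuterMeasure {c | q ≤ (c.2 : ℝ)}

end Algorithm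

/-!
Upper bound: the levels `i = 0, 1, …` take samples, each a random vertex with a random neighbour of
it, at scale `k = 2 ^ i` until a level dares an answer. Let `Δ` be the largest degree among `k`
samples, and let `w` have this degree. A random vertex is a neighbour of `w` with probability
`Δ / n`, which gives `n` once enough neighbours of `w` are found. Otherwise vertices of degree at
most `Δ` are light: the degrees of the light vertices among the samples estimate `M / n`, where `M`
is the number of adjacent pairs of light vertices, and additive queries count the adjacent pairs
within batches of light samples, which estimates `M / n ^ 2`; the ratio is `n`. Thresholds on the
statistics make wrong answers unlikely at every level, and both estimates become reliable as soon as
`k` is of order `√(n / d)`: by then `Δ` is of order `√m`, or at least half of the edges are light.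

Lower bound: a core with about `√m` vertices, which contains nearly all edges, is hidden among
randomly placed disjoint edges. Unless a query meets the core, the replies are those of a random
matching, whatever the number of edges in the matching is, and `RandVert` meets the core with
probability about `√m / n = O(√(d / n))`.
-/

/-! ### Expectations, probabilities and independent samples -/

section Expectation

variable {α β : Type*}

/-- The expectation of an extended nonnegative function. It plays the role of the integral with
respect to `p.toMeasure`, but needs no measurable structure on `α`. -/
noncomputable def expect (p : PMF α) (f : α → ℝ≥0∞) : ℝ≥0∞ := ∑' a, p a * f a

open Classical in
/-- The probability of an event, given as a predicate. -/
noncomputable def prob (p : PMF α) (E : α → Prop) : ℝ≥0∞ := expect p fun a => if E a then 1 else 0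

theorem expect_pure (a : α) (f : α → ℝ≥0∞) : expect (PMF.pure a) f = f a := by
  rw [expect, tsum_eq_single a fun b hb => by simp [PMF.pure_apply_of_ne _ _ hb]]
  simp

theorem expect_bind (p : PMF α) (q : α → PMF β) (f : β → ℝ≥0∞) :
    expect (p.bind q) f = expect p fun a => expect (q a) f := by
  simp only [expect, PMF.bind_apply, ← ENNReal.tsum_mul_left, ← ENNReal.tsum_mul_right]
  rw [ENNReal.tsum_comm]
  simp only [mul_assoc]

theorem expect_map (p : PMF α) (g : α → β) (f : β → ℝ≥0∞) :
    expect (p.map g) f = expect p fun a => f (g a) := by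
  simp only [← PMF.bind_pure_comp, expect_bind, expect_pure, Function.comp_apply]

theorem expect_mono_support {p : PMF α} {f g : α → ℝ≥0∞} (h : ∀ a ∈ p.support, f a ≤ g a) :
    expect p f ≤ expect p g := by
  refine ENNReal.tsum_le_tsum fun a => ?_
  by_cases ha : a ∈ p.support
  · exact mul_le_mul_right (h a ha) _
  · simp [(PMF.apply_eq_zero_iff p a).2 ha]

theorem expect_mono {p : PMF α} {f g : α → ℝ≥0∞} (h : ∀ a, f a ≤ g a) : expect p f ≤ expect p g :=
  expect_mono_support fun a _ => h a

theorem expect_congr_support {p : PMF α} {f g : α → ℝ≥0∞} (h : ∀ a ∈ p.support, f a = g a) :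
    expect p f = expect p g :=
  le_antisymm (expect_mono_support fun a ha => (h a ha).le)
    (expect_mono_support fun a ha => (h a ha).ge)

theorem expect_add (p : PMF α) (f g : α → ℝ≥0∞) :
    (expect p fun a => f a + g a) = expect p f + expect p g := by
  simp only [expect, mul_add, ENNReal.tsum_add]

theorem expect_mul_left (p : PMF α) (c : ℝ≥0∞) (f : α → ℝ≥0∞) :
    (expect p fun a => c * f a) = c * expect p f := by
  simp only [expect, ← ENNReal.tsum_mul_left, mul_left_comm]

theorem expect_mul_right (p : PMF α) (c : ℝ≥0∞) (f : α → ℝ≥0∞) :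
    (expect p fun a => f a * c) = expect p f * c := by
  simp only [mul_comm _ c, expect_mul_left]

theorem expect_const (p : PMF α) (c : ℝ≥0∞) : (expect p fun _ => c) = c := by
  rw [expect, ENNReal.tsum_mul_right, p.tsum_coe, one_mul]

theorem expect_sum {ι : Type*} (p : PMF α) (s : Finset ι) (f : ι → α → ℝ≥0∞) :
    (expect p fun a => ∑ i ∈ s, f i a) = ∑ i ∈ s, expect p (f i) := by
  simp only [expect, Finset.mul_sum]
  exact Summable.tsum_finsetSum fun _ _ => ENNReal.summable

theorem expect_list_sum (p : PMF α) (l : List β) (f : β → α → ℝ≥0∞) :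
    (expect p fun a => (l.map fun b => f b a).sum) = (l.map fun b => expect p (f b)).sum := by
  induction l with
  | nil => exact expect_const p 0
  | cons b l ih => simp only [List.map_cons, List.sum_cons, expect_add, ih]

theorem expect_le_of_le {p : PMF α} {f : α → ℝ≥0∞} {c : ℝ≥0∞} (h : ∀ a, f a ≤ c) :
    expect p f ≤ c :=
  (expect_mono h).trans_eq (expect_const p c)

theorem expect_comm (p : PMF α) (q : PMF β) (f : α → β → ℝ≥0∞) :
    (expect p fun a => expect q fun b => f a b) = expect q fun b => expect p fun a => f a b := by
  simp only [expect, ← ENNReal.tsum_mul_left]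
  rw [ENNReal.tsum_comm]
  simp only [mul_left_comm]

theorem expect_iSup (p : PMF α) {f : ℕ → α → ℝ≥0∞} (hf : Monotone f) :
    (expect p fun a => ⨆ t, f t a) = ⨆ t, expect p (f t) := by
  let _ : MeasurableSpace α := ⊤
  simp only [expect, ENNReal.mul_iSup, ← MeasureTheory.lintegral_count]
  exact MeasureTheory.lintegral_iSup (fun _ => measurable_from_top)
    fun _ _ hst a => mul_le_mul_right (hf hst a) _

theorem expect_uniformOfFinset (s : Finset α) (hs : s.Nonempty) (f : α → ℝ≥0∞) :
    expect (PMF.uniformOfFinset s hs) f = (s.card : ℝ≥0∞)⁻¹ * ∑ a ∈ s, f a := by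
  rw [expect, Finset.mul_sum,
    tsum_eq_sum (s := s) fun a ha => by simp [PMF.uniformOfFinset_apply_of_notMem hs ha]]
  exact Finset.sum_congr rfl fun a ha => by rw [PMF.uniformOfFinset_apply_of_mem hs ha]

theorem toOuterMeasure_eq_prob (p : PMF α) (E : Set α) :
    p.toOuterMeasure E = prob p fun a => a ∈ E := by
  classical
  rw [PMF.toOuterMeasure_apply, prob, expect]
  exact tsum_congr fun a => by simp [Set.indicator_apply]

theorem prob_eq_expect_ite (p : PMF α) (E : α → Prop) [DecidablePred E] :
    prob p E = expect p fun a => if E a then 1 else 0 := by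
  unfold prob
  congr!

theorem ite_one_zero_mono {P Q : Prop} [Decidable P] [Decidable Q] (h : P → Q) :
    (if P then 1 else 0 : ℝ≥0∞) ≤ if Q then 1 else 0 := by
  split_ifs with hP hQ
  · exact le_rfl
  · exact absurd (h hP) hQ
  · exact zero_le
  · exact le_rfl

theorem prob_mono_support {p : PMF α} {E F : α → Prop} (h : ∀ a ∈ p.support, E a → F a) :
    prob p E ≤ prob p F := by
  classical exact expect_mono_support fun a ha => ite_one_zero_mono (h a ha)

theorem prob_mono {p : PMF α} {E F : α → Prop} (h : ∀ a, E a → F a) : prob p E ≤ prob p F :=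
  prob_mono_support fun a _ => h a

theorem prob_le_one (p : PMF α) (E : α → Prop) : prob p E ≤ 1 :=
  expect_le_of_le fun a => by split_ifs <;> simp

theorem prob_or_le (p : PMF α) (E F : α → Prop) :
    prob p (fun a => E a ∨ F a) ≤ prob p E + prob p F := by
  rw [prob, prob, prob, ← expect_add]
  refine expect_mono fun a => ?_
  by_cases hE : E a <;> by_cases hF : F a <;> simp [hE, hF]

theorem prob_add_prob_not (p : PMF α) (E : α → Prop) :
    prob p E + prob p (fun a => ¬ E a) = 1 := by
  rw [prob, prob, ← expect_add]
  refine Eq.trans ?_ (expect_const p 1)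
  congr 1
  funext a
  by_cases hE : E a <;> simp [hE]

theorem expect_le_prob_add {p : PMF α} {f : α → ℝ≥0∞} {E : α → Prop} {c : ℝ≥0∞}
    (hf : ∀ a ∈ p.support, f a ≤ 1) (hc : ∀ a ∈ p.support, ¬ E a → f a ≤ c) :
    expect p f ≤ prob p E + c := by
  rw [prob, ← expect_const p c, ← expect_add]
  refine expect_mono_support fun a ha => ?_
  by_cases hE : E a
  · simpa [hE] using (hf a ha).trans le_self_add
  · simpa [hE] using hc a ha hE

theorem prob_le_expect_div (p : PMF α) {E : α → Prop} {f : α → ℝ≥0∞} {D : ℝ≥0∞} (hD : D ≠ 0)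
    (hD' : D ≠ ⊤) (h : ∀ a, E a → D ≤ f a) : prob p E ≤ expect p f / D := by
  rw [ENNReal.le_div_iff_mul_le (.inl hD) (.inl hD'), prob, ← expect_mul_right]
  refine expect_mono fun a => ?_
  split_ifs with hE
  · simpa using h a hE
  · simp

/-- The subtraction-free form of `E[(X - μ)²] + 2 μ E[X] = E[X²] + μ²`. -/
theorem expect_sq_sub_add (p : PMF α) (X : α → ℕ) {μ : ℝ} (hμ : 0 ≤ μ) :
    (expect p fun a => ENNReal.ofReal (((X a : ℝ) - μ) ^ 2)) +
        ENNReal.ofReal (2 * μ) * (expect p fun a => X a) =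
      (expect p fun a => (X a : ℝ≥0∞) ^ 2) + ENNReal.ofReal (μ ^ 2) := by
  rw [← expect_mul_left, ← expect_add, ← expect_const p (ENNReal.ofReal (μ ^ 2)), ← expect_add]
  congr 1
  funext a
  rw [← ENNReal.ofReal_natCast, ← ENNReal.ofReal_mul (by positivity),
    ← ENNReal.ofReal_pow (by positivity), ← ENNReal.ofReal_add (by positivity) (by positivity),
    ← ENNReal.ofReal_add (by positivity) (by positivity)]
  congr 1
  ring

theorem expect_sq_sub_le (p : PMF α) (X : α → ℕ) {μ σ : ℝ} (hμ : 0 ≤ μ) (hσ : 0 ≤ σ)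
    (h1 : (expect p fun a => X a) = ENNReal.ofReal μ)
    (h2 : (expect p fun a => (X a : ℝ≥0∞) ^ 2) ≤ ENNReal.ofReal (μ ^ 2 + σ)) :
    (expect p fun a => ENNReal.ofReal (((X a : ℝ) - μ) ^ 2)) ≤ ENNReal.ofReal σ := by
  have h := (expect_sq_sub_add p X hμ).le.trans (add_le_add_left h2 _)
  rw [h1, ← ENNReal.ofReal_mul (by positivity),
    ← ENNReal.ofReal_add (by positivity) (by positivity),
    show μ ^ 2 + σ + μ ^ 2 = σ + 2 * μ * μ by ring, ENNReal.ofReal_add hσ (by positivity)] at h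
  exact (ENNReal.add_le_add_iff_right ENNReal.ofReal_ne_top).1 h

theorem prob_le_of_second_moment (p : PMF α) (X : α → ℕ) {μ σ D c : ℝ} (hμ : 0 ≤ μ) (hσ : 0 ≤ σ)
    (h1 : (expect p fun a => X a) = ENNReal.ofReal μ)
    (h2 : (expect p fun a => (X a : ℝ≥0∞) ^ 2) ≤ ENNReal.ofReal (μ ^ 2 + σ)) (hD : 0 < D)
    (hc : σ ≤ c * D) {E : α → Prop} (hE : ∀ a, E a → D ≤ ((X a : ℝ) - μ) ^ 2) :
    prob p E ≤ ENNReal.ofReal c :=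
  calc prob p E
      ≤ (expect p fun a => ENNReal.ofReal (((X a : ℝ) - μ) ^ 2)) / ENNReal.ofReal D :=
        prob_le_expect_div p (by simpa using hD) ENNReal.ofReal_ne_top
          fun a ha => ENNReal.ofReal_le_ofReal (hE a ha)
    _ ≤ ENNReal.ofReal σ / ENNReal.ofReal D :=
        ENNReal.div_le_div_right (expect_sq_sub_le p X hμ hσ h1 h2) _
    _ ≤ ENNReal.ofReal c := by
        rw [← ENNReal.ofReal_div_of_pos hD]
        exact ENNReal.ofReal_le_ofReal ((div_le_iff₀ hD).2 hc)

/-- `X` is a misleading estimate of `μ`: it reaches the acceptance threshold `τ`, but is off by more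
than a fraction `η` of itself. -/
def Misleading (η τ μ : ℝ) (X : ℕ) : Prop := τ ≤ X ∧ ¬ |(X : ℝ) - μ| ≤ η * X

theorem prob_misleading_le (p : PMF α) (X : α → ℕ) {μ σ τ η K T : ℝ} (hμ : 0 ≤ μ) (hσ : 0 ≤ σ)
    (h1 : (expect p fun a => X a) = ENNReal.ofReal μ)
    (h2 : (expect p fun a => (X a : ℝ≥0∞) ^ 2) ≤ ENNReal.ofReal (μ ^ 2 + σ)) (hτ : 0 < τ)
    (hη : 0 < η) (hη' : η ≤ 1) (hT : 0 < T) (hσ' : σ ≤ K / T * max τ μ ^ 2) :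
    prob p (fun a => Misleading η τ μ (X a)) ≤ ENNReal.ofReal (4 * K / (η ^ 2 * T)) := by
  have : 0 < max τ μ := lt_max_of_lt_left hτ
  refine prob_le_of_second_moment p X hμ hσ h1 h2 (D := (η / 2 * max τ μ) ^ 2) (by positivity) ?_ ?_
  · refine hσ'.trans_eq ?_
    field_simp
    ring
  · rintro a ⟨ha, hb⟩
    rw [← sq_abs ((X a : ℝ) - μ)]
    refine pow_le_pow_left₀ (by positivity) ?_ 2
    rw [not_le] at hb
    rcases le_or_gt μ (2 * X a) with h | h
    · have : max τ μ ≤ 2 * X a := max_le (by linarith) h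
      nlinarith
    · have hmax : max τ μ ≤ μ := max_le (by linarith) le_rfl
      have habs : μ / 2 ≤ |(X a : ℝ) - μ| := by
        rw [abs_sub_comm]
        exact le_trans (by linarith) (le_abs_self _)
      nlinarith

theorem prob_lt_threshold_le (p : PMF α) (X : α → ℕ) {μ σ τ K T : ℝ} (hσ : 0 ≤ σ)
    (h1 : (expect p fun a => X a) = ENNReal.ofReal μ)
    (h2 : (expect p fun a => (X a : ℝ≥0∞) ^ 2) ≤ ENNReal.ofReal (μ ^ 2 + σ)) (hτ : 2 * τ ≤ μ)
    (hμ : 0 < μ) (hσ' : σ ≤ K / T * μ ^ 2) :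
    prob p (fun a => (X a : ℝ) < τ) ≤ ENNReal.ofReal (4 * K / T) := by
  refine prob_le_of_second_moment p X hμ.le hσ h1 h2 (D := μ ^ 2 / 4) (by positivity) ?_ ?_
  · exact hσ'.trans_eq (by ring)
  · intro a ha
    nlinarith

/-- The law of `N` independent samples of `p`. -/
noncomputable def iid (p : PMF α) : ℕ → PMF (List α)
  | 0 => PMF.pure []
  | N + 1 => p.bind fun a => (iid p N).map (a :: ·)

theorem expect_iid_zero (p : PMF α) (F : List α → ℝ≥0∞) : expect (iid p 0) F = F [] :=
  expect_pure _ _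

theorem expect_iid_succ (p : PMF α) (N : ℕ) (F : List α → ℝ≥0∞) :
    expect (iid p (N + 1)) F = expect p fun a => expect (iid p N) fun l => F (a :: l) := by
  simp only [iid, expect_bind, expect_map]

theorem length_and_forall_of_mem_support_iid {p : PMF α} {P : α → Prop}
    (h : ∀ a ∈ p.support, P a) (N : ℕ) :
    ∀ l ∈ (iid p N).support, l.length = N ∧ ∀ a ∈ l, P a := by
  induction N with
  | zero => simp [iid]
  | succ N ih =>
    intro l hl
    simp only [iid, PMF.mem_support_bind_iff, PMF.mem_support_map_iff] at hl
    obtain ⟨a, ha, l', hl', rfl⟩ := hl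
    obtain ⟨hlength, hforall⟩ := ih l' hl'
    exact ⟨congrArg (· + 1) hlength, List.forall_mem_cons.2 ⟨h a ha, hforall⟩⟩

theorem prob_iid_forall (p : PMF α) (P : α → Prop) (N : ℕ) :
    prob (iid p N) (fun l => ∀ a ∈ l, P a) = prob p P ^ N := by
  classical
  induction N with
  | zero => simp [prob, expect_iid_zero]
  | succ N ih =>
    rw [prob, expect_iid_succ, pow_succ', ← ih, prob, prob, ← expect_mul_right]
    congr 1
    funext a
    rw [← expect_mul_left]
    congr 1
    funext l
    by_cases ha : P a <;> simp [ha]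

theorem expect_iid_sum (p : PMF α) (N : ℕ) (f : α → ℝ≥0∞) :
    (expect (iid p N) fun l => (l.map f).sum) = N * expect p f := by
  induction N with
  | zero => simp [expect_iid_zero]
  | succ N ih =>
    simp only [expect_iid_succ, List.map_cons, List.sum_cons, expect_add, expect_const, ih,
      Nat.cast_succ]
    ring

theorem expect_iid_sum_sq_le (p : PMF α) (N : ℕ) (f : α → ℝ≥0∞) :
    (expect (iid p N) fun l => (l.map f).sum ^ 2) ≤
      N * (expect p fun a => f a ^ 2) + (N * expect p f) ^ 2 := by
  induction N with
  | zero => simp [expect_iid_zero]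
  | succ N ih =>
    simp only [expect_iid_succ, List.map_cons, List.sum_cons, add_sq, expect_add, expect_const,
      expect_mul_left, expect_mul_right, expect_iid_sum]
    refine (add_le_add_right ih _).trans ?_
    calc _ = ((N : ℝ≥0∞) + 1) * (expect p fun a => f a ^ 2) +
          (N ^ 2 + 2 * N) * expect p f ^ 2 := by ring
      _ ≤ ((N : ℝ≥0∞) + 1) * (expect p fun a => f a ^ 2) +
          (N ^ 2 + 2 * N) * expect p f ^ 2 + expect p f ^ 2 := le_self_add
      _ = _ := by push_cast; ring

theorem expect_iid_sum_pairs (p : PMF α) (q : PMF β) (k : ℕ) (h : α → β → ℝ≥0∞) :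
    (expect (iid p k) fun l => expect (iid q k) fun l' =>
      (l.map fun a => (l'.map fun b => h a b).sum).sum) =
      k ^ 2 * expect p fun a => expect q fun b => h a b := by
  have inner (l : List α) : (expect (iid q k) fun l' =>
      (l.map fun a => (l'.map fun b => h a b).sum).sum) =
      (l.map fun a => k * expect q (h a)).sum := by
    rw [expect_list_sum]
    simp only [expect_iid_sum]
  simp only [inner, expect_iid_sum, expect_mul_left]
  ring

theorem list_sum_comm {M : Type*} [AddCommMonoid M] (l : List α) (l' : List β) (h : α → β → M) :
    (l.map fun a => (l'.map fun b => h a b).sum).sum =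
      (l'.map fun b => (l.map fun a => h a b).sum).sum :=
  Multiset.sum_map_sum_map (l : Multiset α) (l' : Multiset β) (f := h)

theorem expect_sq_le {p : PMF α} {f : α → ℝ≥0∞} {r : ℝ≥0∞} (hf : ∀ a, f a ≤ r) :
    (expect p fun a => f a ^ 2) ≤ r * expect p f := by
  rw [← expect_mul_left]
  exact expect_mono fun a => (sq (f a)).trans_le (mul_le_mul_left (hf a) _)

/-- Averaging over the second sample first reduces the claim to the second moments of the column
sums and of the sum of the row means. -/
theorem expect_iid_sum_pairs_sq_le (p : PMF α) (q : PMF β) (k : ℕ) {h : α → β → ℝ≥0∞} {r : ℝ≥0∞}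
    (hh : ∀ a b, h a b ^ 2 ≤ h a b) (hrow : ∀ a, expect q (h a) ≤ r)
    (hcol : ∀ b, (expect p fun a => h a b) ≤ r) :
    (expect (iid p k) fun l => expect (iid q k) fun l' =>
      (l.map fun a => (l'.map fun b => h a b).sum).sum ^ 2) ≤
      (k ^ 2 + 2 * k ^ 3 * r) * (expect p fun a => expect q fun b => h a b) +
      (k ^ 2 * expect p fun a => expect q fun b => h a b) ^ 2 := by
  set μ := expect p fun a => expect q fun b => h a b
  have hμ' : (expect q fun b => expect p fun a => h a b) = μ := (expect_comm p q h).symm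
  have columns (b : β) : (expect (iid p k) fun l => (l.map fun a => h a b).sum ^ 2) ≤
      k * (expect p fun a => h a b) + k ^ 2 * (expect p fun a => h a b) ^ 2 := by
    refine (expect_iid_sum_sq_le p k fun a => h a b).trans ?_
    rw [mul_pow]
    gcongr
    exact expect_mono fun a => hh a b
  have rowMeans : (expect (iid p k) fun l => (l.map fun a => expect q (h a)).sum ^ 2) ≤
      k * (r * μ) + (k * μ) ^ 2 := by
    refine (expect_iid_sum_sq_le p k fun a => expect q (h a)).trans ?_
    gcongr
    exact expect_sq_le hrow
  calc _ ≤ expect (iid p k) fun l => k * (expect q fun b => (l.map fun a => h a b).sum ^ 2) +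
        k ^ 2 * (l.map fun a => expect q (h a)).sum ^ 2 := by
        refine expect_mono fun l => ?_
        simp only [list_sum_comm l]
        refine (expect_iid_sum_sq_le q k fun b => (l.map fun a => h a b).sum).trans_eq ?_
        rw [expect_list_sum, mul_pow]
    _ = k * (expect q fun b => expect (iid p k) fun l => (l.map fun a => h a b).sum ^ 2) +
        k ^ 2 * expect (iid p k) fun l => (l.map fun a => expect q (h a)).sum ^ 2 := by
        rw [expect_add, expect_mul_left, expect_mul_left, expect_comm]
    _ ≤ k * (k * μ + k ^ 2 * (r * μ)) + k ^ 2 * (k * (r * μ) + (k * μ) ^ 2) := by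
        gcongr
        refine (expect_mono columns).trans ?_
        rw [expect_add, expect_mul_left, expect_mul_left, hμ']
        gcongr
        exact (expect_sq_le hcol).trans_eq (by rw [hμ'])
    _ = _ := by ring

theorem expect_iid_sum_natCast {p : PMF α} {f : α → ℕ} {x : ℝ}
    (hx : (expect p fun a => (f a : ℝ≥0∞)) = ENNReal.ofReal x) (N : ℕ) :
    (expect (iid p N) fun l => ((l.map f).sum : ℝ≥0∞)) = ENNReal.ofReal (N * x) := by
  simp only [Nat.cast_list_sum, List.map_map, Function.comp_def]
  rw [expect_iid_sum p N fun a => (f a : ℝ≥0∞), hx, ENNReal.ofReal_mul (by positivity),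
    ENNReal.ofReal_natCast]

theorem expect_iid_sum_natCast_sq_le {p : PMF α} {f : α → ℕ} {x y : ℝ} (hx0 : 0 ≤ x) (hy0 : 0 ≤ y)
    (hx : (expect p fun a => (f a : ℝ≥0∞)) = ENNReal.ofReal x)
    (hy : (expect p fun a => (f a : ℝ≥0∞) ^ 2) ≤ ENNReal.ofReal y) (N : ℕ) :
    (expect (iid p N) fun l => ((l.map f).sum : ℝ≥0∞) ^ 2) ≤
      ENNReal.ofReal ((N * x) ^ 2 + N * y) := by
  simp only [Nat.cast_list_sum, List.map_map, Function.comp_def]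
  refine (expect_iid_sum_sq_le p N fun a => (f a : ℝ≥0∞)).trans ?_
  rw [hx, add_comm, ENNReal.ofReal_add (by positivity) (by positivity),
    ENNReal.ofReal_pow (by positivity), ENNReal.ofReal_mul (by positivity),
    ENNReal.ofReal_mul (by positivity), ENNReal.ofReal_natCast]
  gcongr

theorem prob_misleading_iid_sum_le {p : PMF α} {f : α → ℕ} {x y η τ K T : ℝ} (hx0 : 0 ≤ x)
    (hy0 : 0 ≤ y) (hx : (expect p fun a => (f a : ℝ≥0∞)) = ENNReal.ofReal x)
    (hy : (expect p fun a => (f a : ℝ≥0∞) ^ 2) ≤ ENNReal.ofReal y) {N : ℕ} (hτ : 0 < τ)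
    (hη : 0 < η) (hη' : η ≤ 1) (hT : 0 < T) (hvar : N * y ≤ K / T * max τ (N * x) ^ 2) :
    prob (iid p N) (fun l => Misleading η τ (N * x) (l.map f).sum) ≤
      ENNReal.ofReal (4 * K / (η ^ 2 * T)) :=
  prob_misleading_le _ _ (by positivity) (by positivity) (expect_iid_sum_natCast hx N)
    (expect_iid_sum_natCast_sq_le hx0 hy0 hx hy N) hτ hη hη' hT hvar

theorem prob_iid_sum_lt_le {p : PMF α} {f : α → ℕ} {x y τ K T : ℝ} (hx0 : 0 ≤ x)
    (hy0 : 0 ≤ y) (hx : (expect p fun a => (f a : ℝ≥0∞)) = ENNReal.ofReal x)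
    (hy : (expect p fun a => (f a : ℝ≥0∞) ^ 2) ≤ ENNReal.ofReal y) {N : ℕ} (hτ : 0 < τ)
    (hτ' : 2 * τ ≤ N * x) (hvar : N * y ≤ K / T * (N * x) ^ 2) :
    prob (iid p N) (fun l => ((l.map f).sum : ℝ) < τ) ≤ ENNReal.ofReal (4 * K / T) :=
  prob_lt_threshold_le _ _ (by positivity) (expect_iid_sum_natCast hx N)
    (expect_iid_sum_natCast_sq_le hx0 hy0 hx hy N) hτ' (by linarith) hvar

end Expectation

/-! ### Runs of algorithms -/

namespace Algorithm

variable (A : Algorithm) (G : InputGraph)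

/-- The expectation of `φ` after `t` steps of the run that starts in the given configuration. -/
noncomputable def value (φ : A.Config → ℝ≥0∞) : ℕ → A.Config → ℝ≥0∞
  | 0 => φ
  | t + 1 => fun c => expect (A.next G c) (value φ t)

theorem expect_config_value (φ : A.Config → ℝ≥0∞) (t s : ℕ) :
    expect (A.config G t) (A.value G φ s) = A.value G φ (s + t) (.inl A.start, 0) := by
  induction t generalizing s with
  | zero => exact expect_pure _ _
  | succ t ih => rw [config, expect_bind, ← Nat.succ_add_eq_add_succ, ← ih (s + 1), value]

theorem expect_config (φ : A.Config → ℝ≥0∞) (t : ℕ) :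
    expect (A.config G t) φ = A.value G φ t (.inl A.start, 0) := by
  rw [← Nat.zero_add t, ← expect_config_value, Nat.zero_add]
  rfl

theorem value_inr (φ : A.Config → ℝ≥0∞) (t : ℕ) (v : ℝ) (k : ℕ) :
    A.value G φ t (.inr v, k) = φ (.inr v, k) := by
  induction t with
  | zero => rfl
  | succ t ih => simp [value, next, expect_pure, ih]

theorem value_succ_inl (φ : A.Config → ℝ≥0∞) (t : ℕ) (s : A.State) (k : ℕ) :
    A.value G φ (t + 1) (.inl s, k) = expect (A.step s) fun a =>
      match a with
      | .inl v => A.value G φ t (.inr v, k)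
      | .inr (q, f) => expect (G.reply q) fun r => A.value G φ t (.inl (f r), k + q.cost) := by
  change expect (A.next G (.inl s, k)) (A.value G φ t) = _
  rw [next.eq_def, expect_bind]
  congr 1
  funext a
  rcases a with v | ⟨q, f⟩
  · exact expect_pure _ _
  · exact expect_map _ _ _

theorem value_mono {φ ψ : A.Config → ℝ≥0∞} (h : ∀ c, φ c ≤ ψ c) (t : ℕ) (c : A.Config) :
    A.value G φ t c ≤ A.value G ψ t c := by
  induction t generalizing c with
  | zero => exact h c
  | succ t ih => exact expect_mono ih

theorem value_monotone {φ : A.Config → ℝ≥0∞} (h : ∀ c, φ c ≤ expect (A.next G c) φ) :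
    Monotone (A.value G φ) := by
  refine monotone_nat_of_le_succ fun t => ?_
  induction t with
  | zero => exact h
  | succ t ih => exact fun c => expect_mono fun c' => ih c'

open Classical in
/-- The indicator function of the event that the algorithm has halted with an output and a total
cost that satisfy `P`. -/
noncomputable def haltedInd (P : ℝ → ℕ → Prop) : A.Config → ℝ≥0∞
  | (.inl _, _) => 0
  | (.inr v, k) => if P v k then 1 else 0

theorem haltedInd_le_expect (P : ℝ → ℕ → Prop) (c : A.Config) :
    A.haltedInd P c ≤ expect (A.next G c) (A.haltedInd P) := by
  rcases c with ⟨s | v, k⟩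
  · exact zero_le
  · exact (expect_pure _ _).ge

/-- The probability that the run that starts in the given configuration eventually halts with an
output and a total cost that satisfy `P`. -/
noncomputable def eventually (P : ℝ → ℕ → Prop) (c : A.Config) : ℝ≥0∞ :=
  ⨆ t, A.value G (A.haltedInd P) t c

theorem probHalt_eq_eventually (P : ℝ → ℕ → Prop) :
    A.probHalt G P = A.eventually G P (.inl A.start, 0) := by
  classical
  refine iSup_congr fun t => ?_
  rw [toOuterMeasure_eq_prob, prob, ← expect_config]
  congr 1
  funext c
  rcases c with ⟨s | v, k⟩
  · simp [haltedInd]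
  · have : (∃ v' k', ((.inr v, k) : A.Config) = (.inr v', k') ∧ P v' k') ↔ P v k :=
      ⟨by rintro ⟨v', k', ⟨⟩, h⟩; exact h, fun h => ⟨v, k, rfl, h⟩⟩
    exact if_congr this rfl rfl

open Classical in
theorem eventually_inr (P : ℝ → ℕ → Prop) (v : ℝ) (k : ℕ) :
    A.eventually G P (.inr v, k) = if P v k then 1 else 0 := by
  simp only [eventually, value_inr, haltedInd, ciSup_const]

theorem eventually_inl (P : ℝ → ℕ → Prop) (s : A.State) (k : ℕ) :
    A.eventually G P (.inl s, k) = expect (A.step s) fun a =>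
      match a with
      | .inl v => A.eventually G P (.inr v, k)
      | .inr (q, f) => expect (G.reply q) fun r => A.eventually G P (.inl (f r), k + q.cost) := by
  have hmono := A.value_monotone G (A.haltedInd_le_expect G P)
  have hshift : A.eventually G P (.inl s, k) =
      ⨆ t, A.value G (A.haltedInd P) (t + 1) (.inl s, k) :=
    (Monotone.iSup_nat_add (fun _ _ h => hmono h _) 1).symm
  simp only [hshift, value_succ_inl]
  rw [← expect_iSup]
  · congr 1
    funext a
    rcases a with v | ⟨q, f⟩
    · rfl
    · simp only [eventually]
      rw [expect_iSup]
      exact fun _ _ h _ => hmono h _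
  · rintro t t' h (v | ⟨q, f⟩)
    · exact hmono h _
    · exact expect_mono fun r => hmono h _

end Algorithm

/-! ### Query programs -/

/-- A deterministic query program that halts with a value in `α`. Its randomness is that of the
replies of the oracle. -/
inductive Prog (α : Type) where
  | ret (a : α)
  | query (q : Query) (f : Reply → Prog α)

namespace Prog

variable {α β : Type}

/-- Sequential composition: the program run second may depend on the result of the first. -/
def bind : Prog α → (α → Prog β) → Prog β
  | ret a, g => g a
  | query q f, g => query q fun r => (f r).bind g

/-- The list of the results of `N` runs of a program. -/
def replicate (p : Prog α) : ℕ → Prog (List α)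
  | 0 => ret []
  | N + 1 => p.bind fun a => (p.replicate N).bind fun l => ret (a :: l)

/-- The sum of the results of the programs of a list. -/
def sum : List (Prog ℕ) → Prog ℕ
  | [] => ret 0
  | p :: l => p.bind fun a => (sum l).bind fun b => ret (a + b)

/-- Every query that the program may ask satisfies `P`, whatever the replies. -/
def AllQueries (P : Query → Prop) : Prog α → Prop
  | ret _ => True
  | query q f => P q ∧ ∀ r, (f r).AllQueries P

section AllQueries

variable {P : Query → Prop}

theorem AllQueries.bind {p : Prog α} {g : α → Prog β} (hp : p.AllQueries P)
    (hg : ∀ a, (g a).AllQueries P) : (p.bind g).AllQueries P := by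
  induction p with
  | ret a => exact hg a
  | query q f ih => exact ⟨hp.1, fun r => ih r (hp.2 r)⟩

theorem AllQueries.replicate {p : Prog α} (hp : p.AllQueries P) (N : ℕ) :
    (p.replicate N).AllQueries P := by
  induction N with
  | zero => trivial
  | succ N ih => exact hp.bind fun _ => ih.bind fun _ => trivial

theorem AllQueries.sum {l : List (Prog ℕ)} (hl : ∀ p ∈ l, p.AllQueries P) :
    (Prog.sum l).AllQueries P := by
  induction l with
  | nil => trivial
  | cons p l ih =>
    rw [List.forall_mem_cons] at hl
    exact hl.1.bind fun _ => (ih hl.2).bind fun _ => trivial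

end AllQueries

variable (G : InputGraph)

/-- The joint distribution of the result and the total cost. -/
noncomputable def run : Prog α → PMF (α × ℕ)
  | ret a => PMF.pure (a, 0)
  | query q f => (G.reply q).bind fun r => ((f r).run).map fun x => (x.1, x.2 + q.cost)

/-- The distribution of the result. -/
noncomputable def law (p : Prog α) : PMF α := (p.run G).map Prod.fst

/-- The expected total cost. -/
noncomputable def meanCost (p : Prog α) : ℝ≥0∞ := expect (p.run G) fun x => x.2

theorem run_bind (p : Prog α) (g : α → Prog β) :
    (p.bind g).run G = (p.run G).bind fun x => ((g x.1).run G).map fun y => (y.1, y.2 + x.2) := by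
  induction p with
  | ret a =>
    simp only [bind, run, PMF.pure_bind, add_zero, Prod.mk.eta]
    exact (PMF.map_id _).symm
  | query q f ih =>
    simp only [bind, run, ih, PMF.bind_bind, PMF.map_bind, PMF.bind_map, PMF.map_comp,
      Function.comp_def, add_assoc]

theorem expect_law (p : Prog α) (f : α → ℝ≥0∞) :
    expect (p.law G) f = expect (p.run G) fun x => f x.1 := by
  rw [law, expect_map]

@[simp]
theorem law_ret (a : α) : (ret a).law G = PMF.pure a := by
  simp only [law, run, PMF.pure_map]

@[simp]
theorem meanCost_ret (a : α) : (ret a).meanCost G = 0 := by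
  simp only [meanCost, run, expect_pure, Nat.cast_zero]

theorem law_bind (p : Prog α) (g : α → Prog β) :
    (p.bind g).law G = (p.law G).bind fun a => (g a).law G := by
  simp only [law, run_bind, PMF.map_bind, PMF.map_comp, PMF.bind_map, Function.comp_def]

theorem meanCost_bind (p : Prog α) (g : α → Prog β) :
    (p.bind g).meanCost G = p.meanCost G + expect (p.law G) fun a => (g a).meanCost G := by
  simp only [meanCost, law, run_bind, expect_bind, expect_map, Nat.cast_add, expect_add,
    expect_const, add_comm]

theorem law_query (q : Query) (f : Reply → Prog α) :
    (query q f).law G = (G.reply q).bind fun r => (f r).law G := by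
  simp only [law, run, PMF.map_bind, PMF.map_comp, Function.comp_def]

theorem meanCost_query (q : Query) (f : Reply → Prog α) :
    (query q f).meanCost G = q.cost + expect (G.reply q) fun r => (f r).meanCost G := by
  simp only [meanCost, run, expect_bind, expect_map, Nat.cast_add, expect_add, expect_const,
    add_comm]

theorem law_replicate (p : Prog α) (N : ℕ) : (p.replicate N).law G = iid (p.law G) N := by
  induction N with
  | zero => exact law_ret G []
  | succ N ih =>
    simp only [replicate, law_bind, law_ret, ih, iid, ← PMF.bind_pure_comp, Function.comp_def]

theorem meanCost_replicate (p : Prog α) (N : ℕ) :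
    (p.replicate N).meanCost G = N * p.meanCost G := by
  induction N with
  | zero => simp [replicate]
  | succ N ih =>
    simp only [replicate, meanCost_bind, ih, meanCost_ret, expect_const, Nat.cast_succ]
    ring

/-- On `G` the program returns `a` at total cost `c`, whatever the random replies. -/
def Returns (p : Prog α) (a : α) (c : ℕ) : Prop := p.run G = PMF.pure (a, c)

namespace Returns

variable {G}

theorem law {p : Prog α} {a : α} {c : ℕ} (h : p.Returns G a c) : p.law G = PMF.pure a := by
  rw [Prog.law, show p.run G = _ from h, PMF.pure_map]

theorem meanCost {p : Prog α} {a : α} {c : ℕ} (h : p.Returns G a c) : p.meanCost G = c := by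
  rw [Prog.meanCost, show p.run G = _ from h, expect_pure]

theorem ret (a : α) : (ret a).Returns G a 0 := rfl

theorem bind {p : Prog α} {g : α → Prog β} {a : α} {b : β} {c d : ℕ}
    (h : p.Returns G a c) (h' : (g a).Returns G b d) : (p.bind g).Returns G b (c + d) := by
  rw [Returns, run_bind, show p.run G = _ from h, PMF.pure_bind, show (g a).run G = _ from h',
    PMF.pure_map, add_comm]

theorem query {q : Query} {f : Reply → Prog α} {r : Reply} {a : α} {c : ℕ}
    (h : G.reply q = PMF.pure r) (h' : (f r).Returns G a c) :
    (query q f).Returns G a (q.cost + c) := by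
  rw [Returns, run, h, PMF.pure_bind, show (f r).run G = _ from h', PMF.pure_map, add_comm]

theorem sum_map {ι : Type} {l : List ι} {p : ι → Prog ℕ} {val cost : ι → ℕ}
    (h : ∀ i ∈ l, (p i).Returns G (val i) (cost i)) :
    (Prog.sum (l.map p)).Returns G (l.map val).sum (l.map cost).sum := by
  induction l with
  | nil => exact ret 0
  | cons i l ih =>
    rw [List.forall_mem_cons] at h
    exact h.1.bind ((ih h.2).bind (g := fun b => .ret (val i + b)) (ret _))

end Returns

end Prog

/-! ### Searching through a sequence of programs -/

/-- A query program of the advanced model that returns a number or gives up. -/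
abbrev AdvancedProg : Type := {p : Prog (Option ℝ) // p.AllQueries Query.IsAdvanced}

/-- The answer is a number that is not `good`; giving up is not wrong. -/
def Wrong (good : ℝ → Prop) (o : Option ℝ) : Prop := ∃ v ∈ o, ¬ good v

theorem not_wrong_none (good : ℝ → Prop) : ¬ Wrong good none := by simp [Wrong]

theorem wrong_some {good : ℝ → Prop} {v : ℝ} : Wrong good (some v) ↔ ¬ good v := by simp [Wrong]

theorem Prog.one_le_expect_run_add (p : Prog (Option ℝ)) (G : InputGraph) (good : ℝ → Prop)
    {B : ℝ≥0∞} (hB : B ≠ 0) (hB' : B ≠ ⊤) {k : ℕ} {W : Option ℝ × ℕ → ℝ≥0∞}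
    {z : Option ℝ → ℝ≥0∞}
    (hsome : ∀ v c, good v → ((k + c : ℕ) : ℝ≥0∞) ≤ B → 1 ≤ W (some v, c))
    (hnone : ∀ c, 1 ≤ W (none, c) + ((k + c + 1 : ℕ) : ℝ≥0∞) / B + z none) :
    1 ≤ expect (p.run G) W + k / B +
      (prob (p.law G) (Wrong good) + (p.meanCost G + 1) / B) + expect (p.law G) z := by
  classical
  have pointwise (x : Option ℝ × ℕ) :
      1 ≤ W x + k / B + ((if Wrong good x.1 then 1 else 0) + (x.2 * B⁻¹ + 1 / B)) + z x.1 := by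
    rcases x with ⟨_ | v, c⟩
    · refine (hnone c).trans_eq ?_
      simp only [not_wrong_none, if_false, Nat.cast_add, Nat.cast_one, ENNReal.add_div,
        ← div_eq_mul_inv]
      ring
    · by_cases hv : good v
      · by_cases hc : ((k + c : ℕ) : ℝ≥0∞) ≤ B
        · exact (hsome v c hv hc).trans (by simp only [add_assoc]; exact le_self_add)
        · have hover : 1 ≤ ((k + c : ℕ) : ℝ≥0∞) / B := by
            rw [ENNReal.le_div_iff_mul_le (.inl hB) (.inl hB'), one_mul]
            exact (not_le.1 hc).le
          calc (1 : ℝ≥0∞) ≤ k / B + c * B⁻¹ := by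
                rwa [Nat.cast_add, ENNReal.add_div, div_eq_mul_inv (c : ℝ≥0∞)] at hover
            _ ≤ k / B + c * B⁻¹ + (W (some v, c) + (if Wrong good (some v) then 1 else 0) +
                1 / B + z (some v)) := le_self_add
            _ = _ := by ring
      · simp only [wrong_some, hv, not_false_eq_true, if_true]
        exact le_self_add.trans (le_add_self.trans le_self_add)
  calc (1 : ℝ≥0∞) = expect (p.run G) fun _ => 1 := (expect_const _ _).symm
    _ ≤ _ := expect_mono pointwise
    _ = _ := by
      simp only [expect_add, expect_const, expect_mul_right]
      rw [prob, Prog.expect_law, Prog.expect_law, ← Prog.meanCost, ENNReal.add_div,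
        div_eq_mul_inv (Prog.meanCost _ _)]

/-- The algorithm that runs the given programs one after the other until one of them returns a
number. A dummy query separates consecutive programs, as every step of an algorithm that does not
halt asks a query. -/
noncomputable def searchAlgorithm (lev : ℕ → AdvancedProg) : Algorithm where
  State := ℕ × AdvancedProg
  start := (0, lev 0)
  step
    | (_, ⟨.ret (some v), _⟩) => PMF.pure (.inl v)
    | (i, ⟨.ret none, _⟩) => PMF.pure (.inr (.randVert, fun _ => (i + 1, lev (i + 1))))
    | (i, ⟨.query q f, h⟩) => PMF.pure (.inr (q, fun r => (i, ⟨f r, h.2 r⟩)))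

namespace searchAlgorithm

variable (lev : ℕ → AdvancedProg) (G : InputGraph) (P : ℝ → ℕ → Prop)

theorem isAdvanced : (searchAlgorithm lev).IsAdvanced := by
  rintro ⟨i, ⟨(_ | v) | ⟨q, f⟩, h⟩⟩ q' f' hq
  · cases (PMF.mem_support_pure_iff _ _).1 hq
    trivial
  · cases (PMF.mem_support_pure_iff _ _).1 hq
  · cases (PMF.mem_support_pure_iff _ _).1 hq
    exact h.1

/-- The probability that the search succeeds once the program `p` is run as the `i`-th one, at
total cost `k` so far. -/
noncomputable def successProb (i k : ℕ) (p : AdvancedProg) : ℝ≥0∞ :=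
  (searchAlgorithm lev).eventually G P (.inl (show (searchAlgorithm lev).State from (i, p)), k)

open Classical in
/-- The probability that the search succeeds once the `i`-th program, started at total cost `k`, has
ended with the given result and the given cost of its own. -/
noncomputable def successProbAfter (i k : ℕ) : Option ℝ × ℕ → ℝ≥0∞
  | (some v, c) => if P v (k + c) then 1 else 0
  | (none, c) => successProb lev G P (i + 1) (k + c + 1) (lev (i + 1))

theorem probHalt_eq : (searchAlgorithm lev).probHalt G P = successProb lev G P 0 0 (lev 0) :=
  Algorithm.probHalt_eq_eventually _ _ _

theorem successProb_eq (i k : ℕ) (p : AdvancedProg) :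
    successProb lev G P i k p = expect (p.1.run G) (successProbAfter lev G P i k) := by
  classical
  obtain ⟨p, h⟩ := p
  induction p generalizing k with
  | ret a =>
    refine (Algorithm.eventually_inl _ _ _ _ _).trans ?_
    rw [Prog.run, expect_pure]
    rcases a with _ | v
    · exact (expect_pure _ _).trans (expect_const _ _)
    · exact (expect_pure _ _).trans (Algorithm.eventually_inr _ _ _ _ _)
  | query q f ih =>
    refine (Algorithm.eventually_inl _ _ _ _ _).trans ((expect_pure _ _).trans ?_)
    simp only [Prog.run, expect_bind, expect_map]
    congr 1
    funext r
    refine (ih r _ (h.2 r)).trans ?_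
    congr 1
    funext ⟨o, c⟩
    cases o <;> simp only [successProbAfter, add_assoc, add_comm c]

variable {P}

theorem one_le_successProb {good : ℝ → Prop} {B : ℝ≥0∞} (hB : B ≠ 0) (hB' : B ≠ ⊤)
    (hP : ∀ v (c : ℕ), good v → (c : ℝ≥0∞) ≤ B → P v c) (N i k : ℕ) :
    1 ≤ successProb lev G P i k (lev i) + k / B +
      ∑ j ∈ Finset.range (N + 1), (prob ((lev (i + j)).1.law G) (Wrong good) +
        ((lev (i + j)).1.meanCost G + 1) / B) +
      prob ((lev (i + N)).1.law G) (· = none) := by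
  classical
  have hsome (i k : ℕ) (v : ℝ) (c : ℕ) (hv : good v) (hc : ((k + c : ℕ) : ℝ≥0∞) ≤ B) :
      1 ≤ successProbAfter lev G P i k (some v, c) := by
    simp only [successProbAfter, hP v _ hv hc, if_true, le_refl]
  induction N generalizing i k with
  | zero =>
    rw [Finset.sum_range_one, add_zero, successProb_eq, prob.eq_def _ (· = none)]
    refine (lev i).1.one_le_expect_run_add G good hB hB' (hsome i k) fun c => ?_
    simpa only [if_true] using le_add_self
  | succ N ih =>
    have hrest (c : ℕ) := ih (i + 1) (k + c + 1)
    simp only [add_assoc _ (Finset.sum _ _), add_right_comm i 1] at hrest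
    have h := (lev i).1.one_le_expect_run_add G good hB hB' (hsome i k) (z := fun _ => _) hrest
    rw [← successProb_eq, expect_const] at h
    rw [Finset.sum_range_succ', add_zero]
    refine h.trans_eq ?_
    simp only [add_assoc]
    ring

end searchAlgorithm

/-! ### Counting adjacent pairs with additive queries -/

namespace InputGraph

variable (G : InputGraph)

open Classical in
/-- The indicator function of adjacency. -/
noncomputable def adjInd (x y : ℕ) : ℕ := if G.graph.Adj x y then 1 else 0

theorem adjInd_comm (x y : ℕ) : G.adjInd x y = G.adjInd y x := by
  classical
  simp only [adjInd, G.graph.adj_comm x y]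

/-- The number of adjacent pairs in `S ×ˢ T`. -/
noncomputable def crossCount (S T : Finset ℕ) : ℕ := ∑ x ∈ S, ∑ y ∈ T, G.adjInd x y

theorem crossCount_comm (S T : Finset ℕ) : G.crossCount S T = G.crossCount T S := by
  rw [crossCount, crossCount, Finset.sum_comm]
  simp only [G.adjInd_comm]

variable {S S' : Finset ℕ}

theorem crossCount_union_left (h : Disjoint S S') (T : Finset ℕ) :
    G.crossCount (S ∪ S') T = G.crossCount S T + G.crossCount S' T := Finset.sum_union h

theorem crossCount_union_right (h : Disjoint S S') (T : Finset ℕ) :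
    G.crossCount T (S ∪ S') = G.crossCount T S + G.crossCount T S' := by
  simp only [G.crossCount_comm T, G.crossCount_union_left h]

theorem crossCount_self (S : Finset ℕ) : G.crossCount S S = 2 * (G.edgesIn S).card := by
  classical
  have hcard : G.crossCount S S = ((S ×ˢ S).filter fun p => G.graph.Adj p.1 p.2).card := by
    rw [Finset.card_filter, Finset.sum_product]
    simp only [crossCount, adjInd]
  have hmaps : Set.MapsTo (fun p : ℕ × ℕ => s(p.1, p.2))
      ((S ×ˢ S).filter fun p => G.graph.Adj p.1 p.2 : Finset (ℕ × ℕ)) (G.edgesIn S) := by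
    intro p hp
    simpa [edgesIn] using hp
  rw [hcard, Finset.card_eq_sum_card_fiberwise hmaps, mul_comm, ← smul_eq_mul, ← Finset.sum_const]
  refine Finset.sum_congr rfl fun e he => ?_
  induction e using Sym2.ind with
  | h x y =>
    simp only [edgesIn, Finset.mem_filter, Finset.mk_mem_sym2_iff, SimpleGraph.mem_edgeSet] at he
    have hfiber : ({p ∈ (S ×ˢ S).filter fun p => G.graph.Adj p.1 p.2 | s(p.1, p.2) = s(x, y)} :
        Finset (ℕ × ℕ)) = {(x, y), (y, x)} := by
      ext ⟨a, b⟩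
      simp only [Finset.mem_filter, Finset.mem_product, Sym2.eq_iff, Finset.mem_insert,
        Finset.mem_singleton, Prod.mk.injEq, and_iff_right_iff_imp]
      rintro (⟨rfl, rfl⟩ | ⟨rfl, rfl⟩)
      · exact he
      · exact ⟨he.1.symm, he.2.symm⟩
    rw [hfiber, Finset.card_pair fun h => he.2.ne (Prod.mk.inj h).1]

theorem card_edgesIn_union (h : Disjoint S S') :
    (G.edgesIn (S ∪ S')).card =
      (G.edgesIn S).card + (G.edgesIn S').card + G.crossCount S S' := by
  have hunion := G.crossCount_self (S ∪ S')
  rw [G.crossCount_union_left h, G.crossCount_union_right h, G.crossCount_union_right h,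
    G.crossCount_self, G.crossCount_self, G.crossCount_comm S' S] at hunion
  lia

theorem crossCount_add_card_edgesIn_sdiff (S T : Finset ℕ) :
    G.crossCount S T + (G.edgesIn (S \ T)).card + (G.edgesIn (T \ S)).card =
      (G.edgesIn (S ∪ T)).card + (G.edgesIn (S ∩ T)).card := by
  have hS : Disjoint (S \ T) (S ∩ T) := Finset.disjoint_sdiff_inter S T
  have hT : Disjoint (S ∩ T) (T \ S) :=
    Finset.disjoint_sdiff.mono_left Finset.inter_subset_left
  have hedges : (G.edgesIn S).card = _ :=
    (congrArg (fun U => (G.edgesIn U).card) (Finset.sdiff_union_inter S T).symm).trans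
      (G.card_edgesIn_union hS)
  have hedges' : (G.edgesIn (S ∪ T)).card = _ :=
    (congrArg (fun U => (G.edgesIn U).card) Finset.union_sdiff_self_eq_union.symm).trans
      (G.card_edgesIn_union Finset.disjoint_sdiff)
  have hright : G.crossCount S T = G.crossCount S (S ∩ T) + G.crossCount S (T \ S) := by
    rw [← G.crossCount_union_right hT, Finset.inter_comm, Finset.union_comm,
      Finset.sdiff_union_inter]
  have hleft : G.crossCount S (S ∩ T) = _ :=
    (congrArg (G.crossCount · (S ∩ T)) (Finset.sdiff_union_inter S T).symm).trans
      (G.crossCount_union_left hS _)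
  have hinter := G.crossCount_self (S ∩ T)
  lia

end InputGraph

/-- The entries of a list that occur again later on. -/
def repeats : List ℕ → List ℕ
  | [] => []
  | x :: l => if x ∈ l then x :: repeats l else repeats l

/-- The entries of a list, with their multiplicities, distributed over sets. An additive query does
not count a vertex twice, so repeated entries need queries of their own. -/
def blocks (l : List ℕ) : List (Finset ℕ) := l.toFinset :: (repeats l).map fun x => {x}

theorem mem_of_mem_repeats {l : List ℕ} {x : ℕ} (hx : x ∈ repeats l) : x ∈ l := by
  induction l with
  | nil => exact hx
  | cons y l ih =>
    rw [repeats] at hx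
    split_ifs at hx
    · exact List.mem_cons.2 ((List.mem_cons.1 hx).imp_right ih)
    · exact List.mem_cons_of_mem y (ih hx)

theorem mem_of_mem_blocks {l : List ℕ} {S : Finset ℕ} (hS : S ∈ blocks l) {x : ℕ} (hx : x ∈ S) :
    x ∈ l := by
  rcases List.mem_cons.1 hS with rfl | hS
  · exact List.mem_toFinset.1 hx
  · obtain ⟨y, hy, rfl⟩ := List.mem_map.1 hS
    rw [Finset.mem_singleton.1 hx]
    exact mem_of_mem_repeats hy

theorem length_blocks (l : List ℕ) : (blocks l).length = 1 + (repeats l).length := by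
  simp [blocks, add_comm]

theorem sum_blocks (l : List ℕ) (f : ℕ → ℕ) :
    ((blocks l).map fun S => ∑ x ∈ S, f x).sum = (l.map f).sum := by
  have h : ((repeats l).map f).sum + ∑ x ∈ l.toFinset, f x = (l.map f).sum := by
    induction l with
    | nil => simp [repeats]
    | cons x l ih =>
      rw [repeats, List.toFinset_cons]
      split_ifs with hx
      · rw [Finset.insert_eq_of_mem (by simpa using hx)]
        simp only [List.map_cons, List.sum_cons, ← ih, add_assoc]
      · rw [Finset.sum_insert (by simpa using hx)]
        simp only [List.map_cons, List.sum_cons, ← ih, add_left_comm]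
  simp only [blocks, List.map_cons, List.sum_cons, List.map_map, Function.comp_def,
    Finset.sum_singleton]
  rw [← h, add_comm]

theorem sum_card_blocks (l : List ℕ) : ((blocks l).map Finset.card).sum = l.length := by
  simpa using sum_blocks l fun _ => 1

theorem list_sum_map_product {α β : Type*} (l : List α) (l' : List β) (f : α → β → ℕ) :
    ((l.product l').map fun p => f p.1 p.2).sum =
      (l.map fun a => (l'.map fun b => f a b).sum).sum := by
  induction l with
  | nil => simp [List.product]
  | cons a l ih =>
    simp only [List.product, List.flatMap_cons, List.map_append, List.sum_append, List.map_map,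
      Function.comp_def, List.map_cons, List.sum_cons] at ih ⊢
    rw [ih]

theorem list_sum_map_finset_sum {α β : Type*} (l : List α) (S : Finset β) (f : β → α → ℕ) :
    (l.map fun a => ∑ x ∈ S, f x a).sum = ∑ x ∈ S, (l.map (f x)).sum := by
  induction l with
  | nil => simp
  | cons a l ih => simp only [List.map_cons, List.sum_cons, ih, Finset.sum_add_distrib]

theorem sum_card_union_le (S : Finset ℕ) (L : List (Finset ℕ)) :
    (L.map fun T => (S ∪ T).card).sum ≤ L.length * S.card + (L.map Finset.card).sum := by
  induction L with
  | nil => simp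
  | cons T L ih =>
    have := Finset.card_union_le S T
    simp only [List.map_cons, List.sum_cons, List.length_cons]
    linarith

theorem sum_sum_card_union_le (L L' : List (Finset ℕ)) :
    (L.map fun S => (L'.map fun T => (S ∪ T).card).sum).sum ≤
      L'.length * (L.map Finset.card).sum + L.length * (L'.map Finset.card).sum := by
  induction L with
  | nil => simp
  | cons S L ih =>
    have := sum_card_union_le S L'
    simp only [List.map_cons, List.sum_cons, List.length_cons]
    linarith

namespace Prog

/-- Ask a query whose reply is a vertex. -/
def askVertex (q : Query) : Prog ℕ :=
  .query q fun
    | .vertex x => .ret x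
    | _ => .ret 0

/-- Ask a query whose reply is a number. -/
def askNumber (q : Query) : Prog ℕ :=
  .query q fun
    | .number k => .ret k
    | _ => .ret 0

/-- Ask whether two vertices are adjacent, with reply `1` or `0`. -/
def askPair (x y : ℕ) : Prog ℕ :=
  .query (.pair x y) fun
    | .adjacent true => .ret 1
    | _ => .ret 0

/-- The number of adjacent pairs in `S ×ˢ T`, found by additive queries. -/
def cross (S T : Finset ℕ) : Prog ℕ :=
  (askNumber (.additive (S ∪ T))).bind fun a => (askNumber (.additive (S ∩ T))).bind fun b =>
    (askNumber (.additive (S \ T))).bind fun c => (askNumber (.additive (T \ S))).bind fun d =>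
      .ret (a + b - c - d)

/-- The number of adjacent pairs with entries from two lists, counted with multiplicity. -/
def crossLists (l l' : List ℕ) : Prog ℕ :=
  Prog.sum (((blocks l).product (blocks l')).map fun p => cross p.1 p.2)

/-- The number of entries of the list that are adjacent to `w`. -/
def countAdj (w : ℕ) (l : List ℕ) : Prog ℕ := Prog.sum (l.map fun x => askPair w x)

theorem allQueries_askVertex {q : Query} (hq : q.IsAdvanced) :
    (askVertex q).AllQueries Query.IsAdvanced :=
  ⟨hq, fun r => by cases r <;> trivial⟩

theorem allQueries_askNumber {q : Query} (hq : q.IsAdvanced) :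
    (askNumber q).AllQueries Query.IsAdvanced :=
  ⟨hq, fun r => by cases r <;> trivial⟩

theorem allQueries_askPair (x y : ℕ) : (askPair x y).AllQueries Query.IsAdvanced := by
  refine ⟨trivial, fun r => ?_⟩
  rcases r with _ | _ | (_ | _) | _ | _ <;> trivial

theorem allQueries_cross (S T : Finset ℕ) : (cross S T).AllQueries Query.IsAdvanced :=
  have h (S : Finset ℕ) := allQueries_askNumber (q := .additive S) trivial
  (h _).bind fun _ => (h _).bind fun _ => (h _).bind fun _ => (h _).bind fun _ => trivial

theorem allQueries_crossLists (l l' : List ℕ) :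
    (crossLists l l').AllQueries Query.IsAdvanced :=
  AllQueries.sum (List.forall_mem_map.2 fun _ _ => allQueries_cross _ _)

theorem allQueries_countAdj (w : ℕ) (l : List ℕ) :
    (countAdj w l).AllQueries Query.IsAdvanced :=
  AllQueries.sum (List.forall_mem_map.2 fun x _ => allQueries_askPair w x)

variable {G : InputGraph}

theorem returns_additive {S : Finset ℕ} (hS : S ⊆ G.V) :
    (askNumber (.additive S)).Returns G (G.edgesIn S).card S.card := by
  have h : G.reply (.additive S) = PMF.pure (.number (G.edgesIn S).card) := by
    simp [InputGraph.reply, hS]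
  exact Returns.query (c := 0) h rfl

theorem returns_degree {x : ℕ} (hx : x ∈ G.V) :
    (askNumber (.degree x)).Returns G (G.nbrs x).card 1 := by
  have h : G.reply (.degree x) = PMF.pure (.number (G.nbrs x).card) := by
    simp [InputGraph.reply, hx]
  exact Returns.query (c := 0) h rfl

theorem returns_askPair {x y : ℕ} (hx : x ∈ G.V) (hy : y ∈ G.V) :
    (askPair x y).Returns G (G.adjInd x y) 1 := by
  classical
  have h : G.reply (.pair x y) = PMF.pure (.adjacent (decide (G.graph.Adj x y))) := by
    simp [InputGraph.reply, hx, hy]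
  refine Returns.query (c := 0) h ?_
  by_cases hxy : G.graph.Adj x y <;> simp only [InputGraph.adjInd, hxy, decide_true, decide_false,
    if_true, if_false] <;> rfl

theorem returns_cross {S T : Finset ℕ} (hS : S ⊆ G.V) (hT : T ⊆ G.V) :
    (cross S T).Returns G (G.crossCount S T) (2 * (S ∪ T).card) := by
  have h := (returns_additive (Finset.union_subset hS hT)).bind
    (g := fun a => (askNumber (.additive (S ∩ T))).bind fun b =>
    (askNumber (.additive (S \ T))).bind fun c => (askNumber (.additive (T \ S))).bind fun d =>
      .ret (a + b - c - d))
    ((returns_additive (S := S ∩ T) (Finset.inter_subset_left.trans hS)).bind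
      ((returns_additive (S := S \ T) (Finset.sdiff_subset.trans hS)).bind
        ((returns_additive (S := T \ S) (Finset.sdiff_subset.trans hT)).bind (Returns.ret _))))
  have hcount := G.crossCount_add_card_edgesIn_sdiff S T
  have hcard : (S ∪ T).card = (S ∩ T).card + (S \ T).card + (T \ S).card := by
    rw [Finset.card_inter_add_card_sdiff, ← Finset.union_sdiff_self_eq_union,
      Finset.card_union_of_disjoint Finset.disjoint_sdiff]
  have hval : (G.edgesIn (S ∪ T)).card + (G.edgesIn (S ∩ T)).card - (G.edgesIn (S \ T)).card -
      (G.edgesIn (T \ S)).card = G.crossCount S T := by lia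
  have hcost : (S ∪ T).card + ((S ∩ T).card + ((S \ T).card + ((T \ S).card + 0))) =
      2 * (S ∪ T).card := by lia
  rw [hval, hcost] at h
  exact h

theorem exists_returns_crossLists {l l' : List ℕ} (hl : ∀ x ∈ l, x ∈ G.V)
    (hl' : ∀ x ∈ l', x ∈ G.V) :
    ∃ c, (crossLists l l').Returns G (l.map fun x => (l'.map fun y => G.adjInd x y).sum).sum c ∧
      c ≤ 2 * ((1 + (repeats l').length) * l.length + (1 + (repeats l).length) * l'.length) := by
  have h := Returns.sum_map (G := G) (l := (blocks l).product (blocks l'))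
    (p := fun p => cross p.1 p.2) (val := fun p => G.crossCount p.1 p.2)
    (cost := fun p => 2 * (p.1 ∪ p.2).card) (by
      rintro ⟨S, T⟩ hp
      rw [List.pair_mem_product] at hp
      exact returns_cross (fun x hx => hl x (mem_of_mem_blocks hp.1 hx))
        (fun x hx => hl' x (mem_of_mem_blocks hp.2 hx)))
  rw [list_sum_map_product (blocks l) (blocks l') fun S T => G.crossCount S T,
    List.sum_map_mul_left,
    list_sum_map_product (blocks l) (blocks l') fun S T => (S ∪ T).card] at h
  refine ⟨_, ?_, Nat.mul_le_mul_left 2 ((sum_sum_card_union_le (blocks l) (blocks l')).trans_eq ?_)⟩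
  · simp only [InputGraph.crossCount, list_sum_map_finset_sum, sum_blocks] at h
    exact h
  · simp only [sum_card_blocks, length_blocks]

theorem returns_countAdj {w : ℕ} {l : List ℕ} (hw : w ∈ G.V) (hl : ∀ x ∈ l, x ∈ G.V) :
    (countAdj w l).Returns G (l.map (G.adjInd w)).sum l.length := by
  have h := Returns.sum_map (G := G) (l := l) (p := fun x => askPair w x)
    (val := G.adjInd w) (cost := fun _ => 1) fun x hx => returns_askPair hw (hl x hx)
  simpa [countAdj] using h

end Prog

/-! ### Samples and the search levels -/

/-- A random vertex `v`, a random neighbour `w` of it, and their degrees. -/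
structure Sample where
  v : ℕ
  w : ℕ
  dv : ℕ
  dw : ℕ

namespace InputGraph

variable (G : InputGraph)

/-- The degree of a vertex. -/
noncomputable def deg (x : ℕ) : ℕ := (G.nbrs x).card

theorem mem_nbrs {x y : ℕ} : y ∈ G.nbrs x ↔ G.graph.Adj x y := by
  simp only [nbrs, Finset.mem_filter, and_iff_right_iff_imp]
  exact fun h => G.mem_of_adj y x h.symm

theorem mem_of_mem_nbrs {x y : ℕ} (h : y ∈ G.nbrs x) : y ∈ G.V :=
  G.mem_of_adj y x (G.mem_nbrs.1 h).symm

theorem deg_pos {x : ℕ} (hx : x ∈ G.V) : 0 < G.deg x := Finset.card_pos.2 (G.nbrs_nonempty hx)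

theorem n_pos : 0 < G.n := Finset.card_pos.2 G.nonempty

theorem sum_adjInd_mul (x : ℕ) (f : ℕ → ℝ≥0∞) :
    ∑ y ∈ G.V, G.adjInd x y * f y = ∑ y ∈ G.nbrs x, f y := by
  classical
  simp only [nbrs, Finset.sum_filter, adjInd, Nat.cast_ite, Nat.cast_one, Nat.cast_zero, ite_mul,
    one_mul, zero_mul]

theorem sum_adjInd (x : ℕ) : ∑ y ∈ G.V, G.adjInd x y = G.deg x := by
  classical
  simp only [deg, nbrs, Finset.card_filter, adjInd]

/-- The indicator function of the adjacent pairs of vertices of degree at most `Δ`. -/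
noncomputable def lightInd (Δ x y : ℕ) : ℕ :=
  if G.deg x ≤ Δ ∧ G.deg y ≤ Δ then G.adjInd x y else 0

/-- The number of adjacent pairs of vertices of degree at most `Δ`. -/
noncomputable def lightPairs (Δ : ℕ) : ℕ := ∑ x ∈ G.V, ∑ y ∈ G.V, G.lightInd Δ x y

theorem lightInd_comm (Δ x y : ℕ) : G.lightInd Δ x y = G.lightInd Δ y x := by
  simp only [lightInd, G.adjInd_comm x y, and_comm]

theorem lightInd_sq (Δ x y : ℕ) : G.lightInd Δ x y ^ 2 = G.lightInd Δ x y := by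
  rw [lightInd, adjInd]
  split_ifs <;> simp

theorem sum_lightInd_le (Δ x : ℕ) : ∑ y ∈ G.V, G.lightInd Δ x y ≤ Δ := by
  by_cases hx : G.deg x ≤ Δ
  · refine le_trans (Finset.sum_le_sum fun y _ => ?_) ((G.sum_adjInd x).trans_le hx)
    rw [lightInd]
    split_ifs <;> simp
  · simp [lightInd, hx]

/-- The data of the sample agree with `G`. -/
def Valid (r : Sample) : Prop :=
  r.v ∈ G.V ∧ r.w ∈ G.V ∧ r.dv = G.deg r.v ∧ r.dw = G.deg r.w

end InputGraph

namespace Sample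

/-- The degree of `v`, set to `0` unless both degrees are at most `Δ`. -/
def weight (Δ : ℕ) (r : Sample) : ℕ := if r.dv ≤ Δ ∧ r.dw ≤ Δ then r.dv else 0

/-- The vertices `v` of degree at most `Δ` among the samples. -/
def lights (Δ : ℕ) (l : List Sample) : List ℕ := (l.filter fun r => r.dv ≤ Δ).map Sample.v

/-- A vertex of largest degree among the samples, and its degree. -/
def best : List Sample → ℕ × ℕ
  | [] => (0, 0)
  | r :: l =>
    if (best l).2 < max r.dv r.dw then if r.dw ≤ r.dv then (r.v, r.dv) else (r.w, r.dw)
    else best l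

theorem le_best {l : List Sample} : ∀ r ∈ l, r.dv ≤ (best l).2 ∧ r.dw ≤ (best l).2 := by
  induction l with
  | nil => simp
  | cons s l ih =>
    intro r hr
    rw [best]
    rcases List.mem_cons.1 hr with rfl | hr
    · split_ifs <;> constructor <;> lia
    · have := ih r hr
      split_ifs <;> constructor <;> lia

theorem best_valid {G : InputGraph} {l : List Sample} (hl : ∀ r ∈ l, G.Valid r) (h : l ≠ []) :
    (best l).1 ∈ G.V ∧ (best l).2 = G.deg (best l).1 := by
  obtain ⟨s, l, rfl⟩ := List.exists_cons_of_ne_nil h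
  clear h
  induction l generalizing s with
  | nil =>
    obtain ⟨hv, hw, hdv, hdw⟩ := hl s (by simp)
    rw [best]
    split_ifs with hbest
    · exact ⟨hv, hdv⟩
    · exact ⟨hw, hdw⟩
    · exact absurd (lt_max_of_lt_left (hdv ▸ G.deg_pos hv)) hbest
  | cons r l ih =>
    obtain ⟨hv, hw, hdv, hdw⟩ := hl s (by simp)
    rw [best]
    split_ifs
    · exact ⟨hv, hdv⟩
    · exact ⟨hw, hdw⟩
    · exact ih r fun t ht => hl t (List.mem_cons_of_mem s ht)

end Sample

namespace Prog

open Sample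

/-- Draw a sample. -/
def draw : Prog Sample :=
  (askVertex .randVert).bind fun v => (askVertex (.randNbr v)).bind fun w =>
    (askNumber (.degree v)).bind fun dv => (askNumber (.degree w)).bind fun dw =>
      .ret ⟨v, w, dv, dw⟩

/-- The number of adjacent pairs between the light vertices of two lists of `k` samples. -/
def batch (k Δ : ℕ) : Prog ℕ :=
  (draw.replicate k).bind fun l => (draw.replicate k).bind fun l' =>
    crossLists (lights Δ l) (lights Δ l')

/-- The answer to the statistics `Y`, `A`, `B`, if they are large enough. -/
noncomputable def answer (k q Δ Y A B : ℕ) : Option ℝ :=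
  if q ≤ Y then some (q * k * Δ / Y)
  else if q * Δ ≤ A ∧ q ≤ B then some (k * A / B) else none

/-- The statistics for a vertex `w` of degree `Δ`: the number `Y` of neighbours of `w` among `q * k`
samples, the total weight `A` of these samples, and the number `B` of adjacent pairs of light
vertices found in `q` batches. -/
noncomputable def stage (k q w Δ : ℕ) : Prog (Option ℝ) :=
  (draw.replicate (q * k)).bind fun l => (countAdj w (l.map Sample.v)).bind fun Y =>
    ((batch k Δ).replicate q).bind fun b =>
      .ret (answer k q Δ Y (l.map (weight Δ)).sum b.sum)

/-- One level of the search: the threshold `Δ` between light and heavy vertices is the largest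
degree among `k` samples. -/
noncomputable def level (k q : ℕ) : Prog (Option ℝ) :=
  (draw.replicate k).bind fun l => stage k q (best l).1 (best l).2

theorem allQueries_draw : draw.AllQueries Query.IsAdvanced :=
  (allQueries_askVertex (q := .randVert) trivial).bind fun v =>
    (allQueries_askVertex (q := .randNbr v) trivial).bind fun w =>
      (allQueries_askNumber (q := .degree v) trivial).bind fun _ =>
        (allQueries_askNumber (q := .degree w) trivial).bind fun _ => trivial

theorem allQueries_batch (k Δ : ℕ) : (batch k Δ).AllQueries Query.IsAdvanced :=
  (allQueries_draw.replicate k).bind fun _ => (allQueries_draw.replicate k).bind fun _ =>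
    allQueries_crossLists _ _

theorem allQueries_level (k q : ℕ) : (level k q).AllQueries Query.IsAdvanced :=
  (allQueries_draw.replicate k).bind fun _ => (allQueries_draw.replicate _).bind fun _ =>
    (allQueries_countAdj _ _).bind fun _ => ((allQueries_batch k _).replicate q).bind fun _ =>
      trivial

variable (G : InputGraph)

theorem law_randVert : (askVertex .randVert).law G = PMF.uniformOfFinset G.V G.nonempty := by
  rw [askVertex, law_query, InputGraph.reply, PMF.bind_map]
  simp only [Function.comp_def, law_ret]
  exact PMF.bind_pure _

theorem law_randNbr {x : ℕ} (hx : x ∈ G.V) :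
    (askVertex (.randNbr x)).law G = PMF.uniformOfFinset (G.nbrs x) (G.nbrs_nonempty hx) := by
  rw [askVertex, law_query, InputGraph.reply, dif_pos hx, PMF.bind_map]
  simp only [Function.comp_def, law_ret]
  exact PMF.bind_pure _

theorem meanCost_askVertex (q : Query) : (askVertex q).meanCost G = q.cost := by
  rw [askVertex, meanCost_query, expect_congr_support (g := fun _ => 0), expect_const, add_zero]
  intro r _
  cases r <;> exact meanCost_ret G _

theorem returns_degrees {v w : ℕ} (hv : v ∈ G.V) (hw : w ∈ G.V) :
    ((askNumber (.degree v)).bind fun dv => (askNumber (.degree w)).bind fun dw =>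
      .ret (⟨v, w, dv, dw⟩ : Sample)).Returns G ⟨v, w, G.deg v, G.deg w⟩ 2 :=
  Returns.bind (c := 1) (d := 1) (returns_degree hv)
    (Returns.bind (c := 1) (d := 0) (returns_degree hw) (Returns.ret _))

theorem law_draw_eq_bind : draw.law G =
    (PMF.uniformOfFinset G.V G.nonempty).bind fun v => ((askVertex (.randNbr v)).law G).bind
      fun w => ((askNumber (.degree v)).bind fun dv => (askNumber (.degree w)).bind fun dw =>
        .ret (⟨v, w, dv, dw⟩ : Sample)).law G := by
  simp only [draw, law_bind, law_randVert]

theorem expect_draw (F : Sample → ℝ≥0∞) :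
    expect (draw.law G) F = (G.n : ℝ≥0∞)⁻¹ * ∑ v ∈ G.V, (G.deg v : ℝ≥0∞)⁻¹ *
      ∑ w ∈ G.nbrs v, F ⟨v, w, G.deg v, G.deg w⟩ := by
  rw [law_draw_eq_bind, expect_bind, expect_uniformOfFinset]
  congr 1
  refine Finset.sum_congr rfl fun v hv => ?_
  rw [law_randNbr G hv, expect_bind, expect_uniformOfFinset]
  congr 1
  refine Finset.sum_congr rfl fun w hw => ?_
  rw [(returns_degrees G hv (G.mem_of_mem_nbrs hw)).law, expect_pure]

theorem expect_draw_vertex (F : ℕ → ℝ≥0∞) :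
    (expect (draw.law G) fun r => F r.v) = (G.n : ℝ≥0∞)⁻¹ * ∑ v ∈ G.V, F v := by
  rw [expect_draw]
  congr 1
  refine Finset.sum_congr rfl fun v hv => ?_
  have hdeg : (G.deg v : ℝ≥0∞) ≠ 0 := Nat.cast_ne_zero.2 (G.deg_pos hv).ne'
  have hsum : ∑ _w ∈ G.nbrs v, F v = G.deg v * F v := by
    rw [Finset.sum_const, nsmul_eq_mul, InputGraph.deg]
  rw [hsum, ← mul_assoc, ENNReal.inv_mul_cancel hdeg (ENNReal.natCast_ne_top _), one_mul]

theorem valid_of_mem_support_draw : ∀ r ∈ (draw.law G).support, G.Valid r := by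
  intro r hr
  rw [law_draw_eq_bind, PMF.mem_support_bind_iff] at hr
  obtain ⟨v, hv, hr⟩ := hr
  rw [PMF.mem_support_uniformOfFinset_iff] at hv
  rw [law_randNbr G hv, PMF.mem_support_bind_iff] at hr
  obtain ⟨w, hw, hr⟩ := hr
  have hw : w ∈ G.V := G.mem_of_mem_nbrs ((PMF.mem_support_uniformOfFinset_iff _ _).1 hw)
  rw [(returns_degrees G hv hw).law, PMF.mem_support_pure_iff] at hr
  subst hr
  exact ⟨hv, hw, rfl, rfl⟩

theorem valid_of_mem_support_iid_draw (N : ℕ) :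
    ∀ l ∈ (iid (draw.law G) N).support, l.length = N ∧ ∀ r ∈ l, G.Valid r :=
  length_and_forall_of_mem_support_iid (valid_of_mem_support_draw G) N

theorem meanCost_draw : draw.meanCost G = 4 := by
  have hdegrees {v : ℕ} (hv : v ∈ (PMF.uniformOfFinset G.V G.nonempty).support) :
      ((askVertex (.randNbr v)).bind fun w =>
        (askNumber (.degree v)).bind fun dv => (askNumber (.degree w)).bind fun dw =>
          .ret (⟨v, w, dv, dw⟩ : Sample)).meanCost G = 3 := by
    rw [PMF.mem_support_uniformOfFinset_iff] at hv
    rw [meanCost_bind, meanCost_askVertex, law_randNbr G hv,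
      expect_congr_support (g := fun _ => 2), expect_const]
    · norm_num [Query.cost]
    · intro w hw
      rw [PMF.mem_support_uniformOfFinset_iff] at hw
      exact_mod_cast (returns_degrees G hv (G.mem_of_mem_nbrs hw)).meanCost
  rw [draw, meanCost_bind, meanCost_askVertex, law_randVert,
    expect_congr_support fun v hv => hdegrees hv, expect_const]
  norm_num [Query.cost]

end Prog

namespace Sample

theorem length_lights_le (Δ : ℕ) (l : List Sample) : (lights Δ l).length ≤ l.length := by
  rw [lights, List.length_map]
  exact List.length_filter_le _ _

theorem lights_cons (Δ : ℕ) (r : Sample) (l : List Sample) :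
    lights Δ (r :: l) = if r.dv ≤ Δ then r.v :: lights Δ l else lights Δ l := by
  by_cases h : r.dv ≤ Δ <;> simp [lights, h]

theorem sum_map_lights (Δ : ℕ) (l : List Sample) (f : ℕ → ℕ) :
    ((lights Δ l).map f).sum = (l.map fun r => if r.dv ≤ Δ then f r.v else 0).sum := by
  induction l with
  | nil => rfl
  | cons r l ih => by_cases h : r.dv ≤ Δ <;> simp [lights_cons, h, ih]

theorem length_repeats_lights_cons_le (Δ : ℕ) (r : Sample) (l : List Sample) :
    (repeats (lights Δ (r :: l))).length ≤
      (repeats (lights Δ l)).length + if r.v ∈ lights Δ l then 1 else 0 := by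
  rw [lights_cons]
  split_ifs <;> simp [repeats, *]

theorem mem_of_mem_lights {G : InputGraph} {l : List Sample} (hl : ∀ r ∈ l, G.Valid r) (Δ : ℕ) :
    ∀ x ∈ lights Δ l, x ∈ G.V := by
  intro x hx
  obtain ⟨r, hr, rfl⟩ := List.mem_map.1 hx
  exact (hl r (List.mem_filter.1 hr).1).1

theorem sum_lights {G : InputGraph} {l l' : List Sample} (hl : ∀ r ∈ l, G.Valid r)
    (hl' : ∀ r ∈ l', G.Valid r) (Δ : ℕ) :
    ((lights Δ l).map fun x => ((lights Δ l').map fun y => G.adjInd x y).sum).sum =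
      (l.map fun r => (l'.map fun s => G.lightInd Δ r.v s.v).sum).sum := by
  rw [sum_map_lights]
  refine congrArg List.sum (List.map_congr_left fun r hr => ?_)
  rw [(hl r hr).2.2.1, sum_map_lights]
  split_ifs with hdeg
  · refine congrArg List.sum (List.map_congr_left fun s hs => ?_)
    simp only [(hl' s hs).2.2.1, InputGraph.lightInd, hdeg, true_and]
  · simp [InputGraph.lightInd, hdeg]

end Sample

namespace Prog

open Sample

variable (G : InputGraph)

theorem expect_weight (Δ : ℕ) :
    (expect (draw.law G) fun r => (r.weight Δ : ℝ≥0∞)) = (G.n : ℝ≥0∞)⁻¹ * G.lightPairs Δ := by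
  rw [expect_draw, InputGraph.lightPairs, Nat.cast_sum]
  congr 1
  refine Finset.sum_congr rfl fun v hv => ?_
  have hdeg : (G.deg v : ℝ≥0∞) ≠ 0 := Nat.cast_ne_zero.2 (G.deg_pos hv).ne'
  rw [Nat.cast_sum, ← G.sum_adjInd_mul, Finset.mul_sum]
  refine Finset.sum_congr rfl fun w _ => ?_
  rw [weight, InputGraph.lightInd]
  split_ifs
  · rw [mul_comm, mul_assoc, ENNReal.mul_inv_cancel hdeg (ENNReal.natCast_ne_top _), mul_one]
  · simp

theorem expect_weight_sq_le (Δ : ℕ) :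
    (expect (draw.law G) fun r => (r.weight Δ : ℝ≥0∞) ^ 2) ≤
      Δ * ((G.n : ℝ≥0∞)⁻¹ * G.lightPairs Δ) := by
  rw [← expect_weight]
  refine expect_sq_le fun r => ?_
  rw [weight]
  split_ifs with h
  · exact_mod_cast h.1
  · simp

theorem expect_adjInd (w : ℕ) :
    (expect (draw.law G) fun r => (G.adjInd w r.v : ℝ≥0∞)) = (G.n : ℝ≥0∞)⁻¹ * G.deg w := by
  rw [expect_draw_vertex G fun x => (G.adjInd w x : ℝ≥0∞), ← G.sum_adjInd, Nat.cast_sum]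

theorem expect_lightInd_le (Δ x : ℕ) :
    (expect (draw.law G) fun r => (G.lightInd Δ x r.v : ℝ≥0∞)) ≤ (G.n : ℝ≥0∞)⁻¹ * Δ := by
  rw [expect_draw_vertex G fun y => (G.lightInd Δ x y : ℝ≥0∞), ← Nat.cast_sum]
  gcongr
  exact G.sum_lightInd_le Δ x

theorem expect_expect_lightInd (Δ : ℕ) :
    (expect (draw.law G) fun r => expect (draw.law G) fun s => (G.lightInd Δ r.v s.v : ℝ≥0∞)) =
      (G.n : ℝ≥0∞)⁻¹ * ((G.n : ℝ≥0∞)⁻¹ * G.lightPairs Δ) := by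
  simp only [fun x => expect_draw_vertex G fun y => (G.lightInd Δ x y : ℝ≥0∞)]
  rw [expect_mul_left, expect_draw_vertex G fun x => ∑ y ∈ G.V, (G.lightInd Δ x y : ℝ≥0∞),
    InputGraph.lightPairs]
  push_cast
  rfl

theorem expect_batch (k Δ : ℕ) (F : ℝ≥0∞ → ℝ≥0∞) :
    (expect ((batch k Δ).law G) fun b => F b) = expect (iid (draw.law G) k) fun l =>
      expect (iid (draw.law G) k) fun l' =>
        F (l.map fun r => (l'.map fun s => (G.lightInd Δ r.v s.v : ℝ≥0∞)).sum).sum := by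
  rw [batch, law_bind, law_replicate, expect_bind]
  refine expect_congr_support fun l hl => ?_
  rw [law_bind, law_replicate, expect_bind]
  refine expect_congr_support fun l' hl' => ?_
  have hl := (valid_of_mem_support_iid_draw G k l hl).2
  have hl' := (valid_of_mem_support_iid_draw G k l' hl').2
  obtain ⟨c, hc, -⟩ := exists_returns_crossLists (mem_of_mem_lights hl Δ)
    (mem_of_mem_lights hl' Δ)
  rw [hc.law, expect_pure, sum_lights hl hl']
  simp only [Nat.cast_list_sum, List.map_map, Function.comp_def]

theorem expect_batch_cast (k Δ : ℕ) :
    (expect ((batch k Δ).law G) fun b => (b : ℝ≥0∞)) =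
      k ^ 2 * ((G.n : ℝ≥0∞)⁻¹ * ((G.n : ℝ≥0∞)⁻¹ * G.lightPairs Δ)) := by
  rw [← expect_expect_lightInd]
  exact (expect_batch G k Δ id).trans (expect_iid_sum_pairs _ _ k _)

theorem expect_batch_sq_le (k Δ : ℕ) :
    (expect ((batch k Δ).law G) fun b => (b : ℝ≥0∞) ^ 2) ≤
      (k ^ 2 + 2 * k ^ 3 * ((G.n : ℝ≥0∞)⁻¹ * Δ)) *
        ((G.n : ℝ≥0∞)⁻¹ * ((G.n : ℝ≥0∞)⁻¹ * G.lightPairs Δ)) +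
      (k ^ 2 * ((G.n : ℝ≥0∞)⁻¹ * ((G.n : ℝ≥0∞)⁻¹ * G.lightPairs Δ))) ^ 2 := by
  rw [expect_batch G k Δ (· ^ 2), ← expect_expect_lightInd]
  refine expect_iid_sum_pairs_sq_le _ _ k (fun r s => ?_)
    (fun r => expect_lightInd_le G Δ r.v) (fun s => ?_)
  · exact_mod_cast (G.lightInd_sq Δ r.v s.v).le
  · simp only [G.lightInd_comm Δ _ s.v]
    exact expect_lightInd_le G Δ s.v

theorem prob_draw_vertex_mem_le (l : List ℕ) :
    prob (draw.law G) (fun r => r.v ∈ l) ≤ (G.n : ℝ≥0∞)⁻¹ * l.length := by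
  rw [prob_eq_expect_ite, expect_draw_vertex G fun x => if x ∈ l then 1 else 0, Finset.sum_boole]
  gcongr
  refine (Finset.card_le_card fun x hx => ?_).trans (List.toFinset_card_le l)
  exact List.mem_toFinset.2 (Finset.mem_filter.1 hx).2

theorem expect_repeats_lights_le (k Δ : ℕ) :
    (expect (iid (draw.law G) k) fun l => ((repeats (lights Δ l)).length : ℝ≥0∞)) ≤
      k ^ 2 * (G.n : ℝ≥0∞)⁻¹ := by
  induction k with
  | zero => simp [expect_iid_zero, lights, repeats]
  | succ k ih =>
    have newRepeat (l : List Sample) (hl : l ∈ (iid (draw.law G) k).support) :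
        (expect (draw.law G) fun r => ((repeats (lights Δ (r :: l))).length : ℝ≥0∞)) ≤
          (repeats (lights Δ l)).length + (G.n : ℝ≥0∞)⁻¹ * k := by
      have hlength : (lights Δ l).length ≤ k :=
        (length_lights_le Δ l).trans_eq (valid_of_mem_support_iid_draw G k l hl).1
      calc _ ≤ expect (draw.law G) fun r => ((repeats (lights Δ l)).length : ℝ≥0∞) +
            if r.v ∈ lights Δ l then 1 else 0 :=
            expect_mono fun r => by exact_mod_cast length_repeats_lights_cons_le Δ r l
        _ = (repeats (lights Δ l)).length + prob (draw.law G) (fun r => r.v ∈ lights Δ l) := by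
            rw [expect_add, expect_const, prob_eq_expect_ite]
        _ ≤ _ := by
            gcongr
            refine (prob_draw_vertex_mem_le G _).trans ?_
            gcongr
    rw [expect_iid_succ, expect_comm]
    calc _ ≤ k ^ 2 * (G.n : ℝ≥0∞)⁻¹ + (G.n : ℝ≥0∞)⁻¹ * k := by
          refine (expect_mono_support newRepeat).trans ?_
          rw [expect_add, expect_const]
          gcongr
      _ ≤ k ^ 2 * (G.n : ℝ≥0∞)⁻¹ + (G.n : ℝ≥0∞)⁻¹ * k + (k + 1) * (G.n : ℝ≥0∞)⁻¹ := le_self_add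
      _ = _ := by push_cast; ring

theorem meanCost_crossLists_lights_le {k : ℕ} {l l' : List Sample}
    (hl : l ∈ (iid (draw.law G) k).support) (hl' : l' ∈ (iid (draw.law G) k).support) (Δ : ℕ) :
    (crossLists (lights Δ l) (lights Δ l')).meanCost G ≤
      4 * k + 2 * k * (repeats (lights Δ l)).length + 2 * k * (repeats (lights Δ l')).length := by
  obtain ⟨hlen, hl⟩ := valid_of_mem_support_iid_draw G k l hl
  obtain ⟨hlen', hl'⟩ := valid_of_mem_support_iid_draw G k l' hl'
  obtain ⟨c, hc, hle⟩ := exists_returns_crossLists (mem_of_mem_lights hl Δ)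
    (mem_of_mem_lights hl' Δ)
  have hk := (length_lights_le Δ l).trans_eq hlen
  have hk' := (length_lights_le Δ l').trans_eq hlen'
  have hc' : c ≤ 4 * k + 2 * k * (repeats (lights Δ l)).length +
      2 * k * (repeats (lights Δ l')).length := by nlinarith
  rw [hc.meanCost]
  exact_mod_cast hc'

theorem meanCost_batch_le (k Δ : ℕ) :
    (batch k Δ).meanCost G ≤ 12 * k + 4 * k * (k ^ 2 * (G.n : ℝ≥0∞)⁻¹) := by
  have secondHalf (l : List Sample) (hl : l ∈ (iid (draw.law G) k).support) :
      ((draw.replicate k).bind fun l' => crossLists (lights Δ l) (lights Δ l')).meanCost G ≤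
        8 * k + 2 * k * (repeats (lights Δ l)).length + 2 * k * (k ^ 2 * (G.n : ℝ≥0∞)⁻¹) := by
    rw [meanCost_bind, meanCost_replicate, meanCost_draw, law_replicate]
    calc _ ≤ (k : ℝ≥0∞) * 4 + expect (iid (draw.law G) k) fun l' =>
          4 * k + 2 * k * (repeats (lights Δ l)).length +
            2 * k * ((repeats (lights Δ l')).length : ℝ≥0∞) := by
          gcongr
          exact expect_mono_support fun l' hl' => meanCost_crossLists_lights_le G hl hl' Δ
      _ ≤ (k : ℝ≥0∞) * 4 + (4 * k + 2 * k * (repeats (lights Δ l)).length +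
            2 * k * (k ^ 2 * (G.n : ℝ≥0∞)⁻¹)) := by
          rw [expect_add, expect_const, expect_mul_left]
          gcongr
          exact expect_repeats_lights_le G k Δ
      _ = _ := by ring
  rw [batch, meanCost_bind, meanCost_replicate, meanCost_draw, law_replicate]
  calc _ ≤ (k : ℝ≥0∞) * 4 + expect (iid (draw.law G) k) fun l =>
        8 * k + 2 * k * ((repeats (lights Δ l)).length : ℝ≥0∞) +
          2 * k * (k ^ 2 * (G.n : ℝ≥0∞)⁻¹) := by
        gcongr
        exact expect_mono_support secondHalf
    _ ≤ (k : ℝ≥0∞) * 4 + (8 * k + 2 * k * (k ^ 2 * (G.n : ℝ≥0∞)⁻¹) +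
          2 * k * (k ^ 2 * (G.n : ℝ≥0∞)⁻¹)) := by
        simp only [expect_add, expect_const, expect_mul_left]
        gcongr
        exact expect_repeats_lights_le G k Δ
    _ = _ := by ring

end Prog

namespace InputGraph

variable (G : InputGraph)

theorem ofReal_div_n (x : ℝ) :
    ENNReal.ofReal (x / G.n) = (G.n : ℝ≥0∞)⁻¹ * ENNReal.ofReal x := by
  have hn : (0 : ℝ) < G.n := by exact_mod_cast G.n_pos
  rw [div_eq_inv_mul, ENNReal.ofReal_mul (by positivity), ENNReal.ofReal_inv_of_pos hn,
    ENNReal.ofReal_natCast]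

/-- The expected number of light adjacent pairs that start in a random vertex. -/
noncomputable def lightMean (Δ : ℕ) : ℝ := G.lightPairs Δ / G.n

theorem lightMean_nonneg (Δ : ℕ) : 0 ≤ G.lightMean Δ := by
  unfold lightMean
  positivity

theorem ofReal_lightMean (Δ : ℕ) :
    ENNReal.ofReal (G.lightMean Δ) = (G.n : ℝ≥0∞)⁻¹ * G.lightPairs Δ := by
  rw [lightMean, ofReal_div_n, ENNReal.ofReal_natCast]

end InputGraph

theorem abs_scale_sub_le {N η ε Y μ : ℝ} (hN : 0 ≤ N) (hη : η ≤ ε) (hY : 0 < Y)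
    (h : |Y - μ| ≤ η * Y) : |N * μ / Y - N| ≤ ε * N := by
  have hdiff : N * μ / Y - N = -(N / Y) * (Y - μ) := by
    field_simp
    ring
  rw [hdiff, abs_mul, abs_neg, abs_of_nonneg (by positivity)]
  calc N / Y * |Y - μ| ≤ N / Y * (η * Y) := by gcongr
    _ = η * N := by field_simp
    _ ≤ ε * N := by gcongr

theorem abs_ratio_sub_le {N k ε A B α β : ℝ} (hN : 0 ≤ N) (hε : 0 < ε) (hε' : ε ≤ 1) (hk : 0 ≤ k)
    (hA : |A - α| ≤ ε / 4 * A) (hB : 0 < B) (hB' : |B - β| ≤ ε / 4 * B) (h : k * α = N * β) :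
    |k * A / B - N| ≤ ε * N := by
  rw [abs_le] at hA hB'
  have hdiff : k * A / B - N = (k * A - N * B) / B := by field_simp
  rw [hdiff, abs_div, abs_of_pos hB, div_le_iff₀ hB, abs_le]
  have hNB : 0 ≤ N * B := by positivity
  have hupper : (1 - ε / 4) * (k * A) ≤ (1 + ε / 4) * (N * B) := by
    calc (1 - ε / 4) * (k * A) = k * ((1 - ε / 4) * A) := by ring
      _ ≤ k * α := by gcongr; linarith
      _ = N * β := h
      _ ≤ N * ((1 + ε / 4) * B) := by gcongr; linarith
      _ = _ := by ring
  have hlower : (1 - ε / 4) * (N * B) ≤ (1 + ε / 4) * (k * A) := by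
    calc (1 - ε / 4) * (N * B) = N * ((1 - ε / 4) * B) := by ring
      _ ≤ N * β := by gcongr; linarith
      _ = k * α := h.symm
      _ ≤ k * ((1 + ε / 4) * A) := by gcongr; linarith
      _ = _ := by ring
  constructor
  · have h1 : (1 - ε) * (1 + ε / 4) ≤ 1 - ε / 4 := by nlinarith
    have h2 : (1 + ε / 4) * ((1 - ε) * (N * B)) ≤ (1 + ε / 4) * (k * A) := by nlinarith
    linarith [le_of_mul_le_mul_left h2 (by linarith)]
  · have h1 : 1 + ε / 4 ≤ (1 + ε) * (1 - ε / 4) := by nlinarith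
    have h2 : (1 - ε / 4) * (k * A) ≤ (1 - ε / 4) * ((1 + ε) * (N * B)) := by nlinarith
    linarith [le_of_mul_le_mul_left h2 (by linarith)]

theorem misleading_of_wrong_answer {N a ε : ℝ} {k q Δ Y A B : ℕ} (hN : 0 < N) (hε : 0 < ε)
    (hε' : ε < 1) (hq : 0 < q) (hΔ : 0 < Δ)
    (h : Wrong (fun v => |v - N| ≤ ε * N) (Prog.answer k q Δ Y A B)) :
    (Misleading (ε / 4) q ((q * k : ℕ) * (Δ / N)) Y ∨
      Misleading (ε / 4) (q * Δ) ((q * k : ℕ) * a) A) ∨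
    (q * Δ : ℝ) ≤ 2 * ((q * k : ℕ) * a) ∧ Misleading (ε / 4) q (q * (k ^ 2 * (a / N))) B := by
  have hq' : (0 : ℝ) < q := by exact_mod_cast hq
  have hqΔ : (0 : ℝ) < q * Δ := by positivity
  contrapose! h
  simp only [Misleading, not_and, not_not] at h
  obtain ⟨⟨hY, hA⟩, hB⟩ := h
  rw [Prog.answer]
  split_ifs with hqY hqAB
  · rw [wrong_some, not_not]
    have hqY : (q : ℝ) ≤ Y := by exact_mod_cast hqY
    have hscale : N * (((q * k : ℕ) : ℝ) * (Δ / N)) = q * k * Δ := by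
      push_cast
      field_simp
    exact hscale ▸ abs_scale_sub_le hN.le (by linarith) (by linarith) (hY hqY)
  · rw [wrong_some, not_not]
    have hqA : (q * Δ : ℝ) ≤ A := by exact_mod_cast hqAB.1
    have hqB : (q : ℝ) ≤ B := by exact_mod_cast hqAB.2
    have hlarge : (q * Δ : ℝ) ≤ 2 * ((q * k : ℕ) * a) := by
      have := (abs_le.1 (hA hqA)).2
      nlinarith
    refine abs_ratio_sub_le hN.le hε hε'.le (by positivity) (hA hqA) (by linarith)
      (hB hlarge hqB) ?_
    push_cast
    field_simp
  · exact not_wrong_none _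

theorem small_of_answer_eq_none {k q Δ Y A B : ℕ} (h : Prog.answer k q Δ Y A B = none) :
    (Y : ℝ) < q ∧ ((A : ℝ) < q * Δ ∨ (B : ℝ) < q) := by
  rw [Prog.answer] at h
  split_ifs at h with hY hAB
  refine ⟨by exact_mod_cast not_le.1 hY, ?_⟩
  rw [not_and_or, not_le, not_le] at hAB
  exact_mod_cast hAB

theorem mul_le_max_sq {x y : ℝ} (hx : 0 ≤ x) (hy : 0 ≤ y) : x * y ≤ max x y ^ 2 := by
  rw [sq]
  exact mul_le_mul (le_max_left _ _) (le_max_right _ _) hy (hx.trans (le_max_left _ _))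

theorem variance_batches_le {N a q k Δ M : ℝ} (hN : 0 < N) (ha : 0 ≤ a) (hq : 0 < q)
    (hk : 0 ≤ k) (hA : q * Δ ≤ 2 * (q * k * a))
    (h1 : q * (q * (k ^ 2 * (a / N))) ≤ M) (h2 : (q * (k ^ 2 * (a / N))) ^ 2 ≤ M) :
    q * ((k ^ 2 + 2 * k ^ 3 * (Δ / N)) * (a / N) + (k ^ 2 * (a / N)) ^ 2) ≤ 6 / q * M := by
  have hΔ : Δ ≤ 2 * k * a := le_of_mul_le_mul_left (by linarith) hq
  rw [div_mul_eq_mul_div, le_div_iff₀ hq]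
  calc q * ((k ^ 2 + 2 * k ^ 3 * (Δ / N)) * (a / N) + (k ^ 2 * (a / N)) ^ 2) * q
      = q * (q * (k ^ 2 * (a / N))) + 2 * (q ^ 2 * k ^ 3 * (a / N) * (1 / N)) * Δ +
        (q * (k ^ 2 * (a / N))) ^ 2 := by field_simp
    _ ≤ q * (q * (k ^ 2 * (a / N))) + 2 * (q ^ 2 * k ^ 3 * (a / N) * (1 / N)) * (2 * k * a) +
        (q * (k ^ 2 * (a / N))) ^ 2 := by gcongr
    _ = q * (q * (k ^ 2 * (a / N))) + 5 * (q * (k ^ 2 * (a / N))) ^ 2 := by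
        field_simp
        ring
    _ ≤ 6 * M := by linarith

namespace Prog

open Sample

variable (G : InputGraph)

theorem expect_adjInd_eq_ofReal (w : ℕ) :
    (expect (draw.law G) fun r => (G.adjInd w r.v : ℝ≥0∞)) = ENNReal.ofReal (G.deg w / G.n) := by
  rw [expect_adjInd, G.ofReal_div_n, ENNReal.ofReal_natCast]

theorem expect_adjInd_sq_eq_ofReal (w : ℕ) :
    (expect (draw.law G) fun r => (G.adjInd w r.v : ℝ≥0∞) ^ 2) =
      ENNReal.ofReal (G.deg w / G.n) := by
  rw [← expect_adjInd_eq_ofReal]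
  congr 1
  funext r
  rw [InputGraph.adjInd]
  split_ifs <;> simp

theorem expect_weight_eq_ofReal (Δ : ℕ) :
    (expect (draw.law G) fun r => (r.weight Δ : ℝ≥0∞)) = ENNReal.ofReal (G.lightMean Δ) := by
  rw [expect_weight, G.ofReal_lightMean]

theorem expect_weight_sq_le_ofReal (Δ : ℕ) :
    (expect (draw.law G) fun r => (r.weight Δ : ℝ≥0∞) ^ 2) ≤
      ENNReal.ofReal (Δ * G.lightMean Δ) := by
  rw [ENNReal.ofReal_mul (by positivity), G.ofReal_lightMean, ENNReal.ofReal_natCast]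
  exact expect_weight_sq_le G Δ

theorem expect_batch_eq_ofReal (k Δ : ℕ) :
    (expect ((batch k Δ).law G) fun b => (b : ℝ≥0∞)) =
      ENNReal.ofReal (k ^ 2 * (G.lightMean Δ / G.n)) := by
  rw [expect_batch_cast, ENNReal.ofReal_mul (by positivity), G.ofReal_div_n, G.ofReal_lightMean,
    ENNReal.ofReal_pow (by positivity), ENNReal.ofReal_natCast]

theorem expect_batch_sq_le_ofReal (k Δ : ℕ) :
    (expect ((batch k Δ).law G) fun b => (b : ℝ≥0∞) ^ 2) ≤
      ENNReal.ofReal ((k ^ 2 + 2 * k ^ 3 * (Δ / G.n)) * (G.lightMean Δ / G.n) +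
        (k ^ 2 * (G.lightMean Δ / G.n)) ^ 2) := by
  have := G.lightMean_nonneg Δ
  refine (expect_batch_sq_le G k Δ).trans_eq ?_
  rw [ENNReal.ofReal_add (by positivity) (by positivity), ENNReal.ofReal_mul (by positivity),
    ENNReal.ofReal_pow (by positivity), ENNReal.ofReal_mul (by positivity),
    ENNReal.ofReal_add (by positivity) (by positivity), ENNReal.ofReal_mul (by positivity),
    ENNReal.ofReal_mul (by positivity), ENNReal.ofReal_pow (by positivity),
    ENNReal.ofReal_pow (by positivity), G.ofReal_div_n, G.ofReal_div_n, G.ofReal_lightMean,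
    ENNReal.ofReal_natCast, ENNReal.ofReal_natCast, ENNReal.ofReal_ofNat]

variable {k q : ℕ} {ε : ℝ}

theorem prob_misleading_neighbours_le (hε : 0 < ε) (hε' : ε < 1) (hq : 0 < q) (k w : ℕ) :
    prob (iid (draw.law G) (q * k)) (fun l => Misleading (ε / 4) q
      ((q * k : ℕ) * (G.deg w / G.n)) (l.map fun r => G.adjInd w r.v).sum) ≤
      ENNReal.ofReal (4 * 1 / ((ε / 4) ^ 2 * q)) := by
  have hq' : (0 : ℝ) < q := by exact_mod_cast hq
  refine prob_misleading_iid_sum_le (by positivity) (by positivity) (expect_adjInd_eq_ofReal G w)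
    (expect_adjInd_sq_eq_ofReal G w).le hq' (by positivity) (by linarith) hq' ?_
  rw [div_mul_eq_mul_div, le_div_iff₀ hq', one_mul, mul_comm]
  exact mul_le_max_sq hq'.le (by positivity)

theorem prob_misleading_weight_le (hε : 0 < ε) (hε' : ε < 1) (hq : 0 < q) (k : ℕ) {Δ : ℕ}
    (hΔ : 0 < Δ) :
    prob (iid (draw.law G) (q * k)) (fun l => Misleading (ε / 4) (q * Δ)
      ((q * k : ℕ) * G.lightMean Δ) (l.map (weight Δ)).sum) ≤
      ENNReal.ofReal (4 * 1 / ((ε / 4) ^ 2 * q)) := by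
  have hq' : (0 : ℝ) < q := by exact_mod_cast hq
  have ha := G.lightMean_nonneg Δ
  refine prob_misleading_iid_sum_le ha (by positivity) (expect_weight_eq_ofReal G Δ)
    (expect_weight_sq_le_ofReal G Δ) (by positivity) (by positivity) (by linarith) hq' ?_
  rw [div_mul_eq_mul_div, le_div_iff₀ hq', one_mul]
  refine le_of_eq_of_le ?_ (mul_le_max_sq (by positivity) (by positivity))
  ring

theorem prob_misleading_batches_le (hε : 0 < ε) (hε' : ε < 1) (hq : 0 < q) (k Δ : ℕ) :
    prob (iid ((batch k Δ).law G) q) (fun b => (q * Δ : ℝ) ≤ 2 * ((q * k : ℕ) * G.lightMean Δ) ∧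
      Misleading (ε / 4) q (q * (k ^ 2 * (G.lightMean Δ / G.n))) b.sum) ≤
      ENNReal.ofReal (4 * 6 / ((ε / 4) ^ 2 * q)) := by
  have hq' : (0 : ℝ) < q := by exact_mod_cast hq
  have hN : (0 : ℝ) < G.n := by exact_mod_cast G.n_pos
  have ha := G.lightMean_nonneg Δ
  by_cases hlarge : (q * Δ : ℝ) ≤ 2 * ((q * k : ℕ) * G.lightMean Δ)
  · have h := prob_misleading_iid_sum_le (f := id) (K := 6) (N := q) (by positivity) (by positivity)
      (expect_batch_eq_ofReal G k Δ) (expect_batch_sq_le_ofReal G k Δ) hq' (η := ε / 4)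
      (by positivity) (by linarith) hq' (by
        push_cast at hlarge
        refine variance_batches_le hN ha hq' (by positivity) hlarge
          (mul_le_max_sq (by positivity) (by positivity)) ?_
        gcongr
        exact le_max_right _ _)
    simpa only [hlarge, true_and, List.map_id] using h
  · simp only [hlarge, false_and, prob, if_false, expect_const, zero_le]

theorem prob_few_neighbours_le {w : ℕ} (hq : 0 < q) (h : 2 * (G.n : ℝ) ≤ k * G.deg w) :
    prob (iid (draw.law G) (q * k))
      (fun l => ((l.map fun r => G.adjInd w r.v).sum : ℝ) < q) ≤ ENNReal.ofReal (4 * 1 / q) := by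
  have hq' : (0 : ℝ) < q := by exact_mod_cast hq
  have hN : (0 : ℝ) < G.n := by exact_mod_cast G.n_pos
  have hmean : 2 * (q : ℝ) ≤ (q * k : ℕ) * (G.deg w / G.n) := by
    rw [← mul_div_assoc, le_div_iff₀ hN]
    push_cast
    nlinarith
  refine prob_iid_sum_lt_le (by positivity) (by positivity) (expect_adjInd_eq_ofReal G w)
    (expect_adjInd_sq_eq_ofReal G w).le hq' hmean ?_
  rw [div_mul_eq_mul_div, le_div_iff₀ hq']
  nlinarith

theorem prob_small_weight_le {Δ : ℕ} (hq : 0 < q) (hΔ : 0 < Δ)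
    (h : 2 * (Δ : ℝ) ≤ k * G.lightMean Δ) :
    prob (iid (draw.law G) (q * k)) (fun l => ((l.map (weight Δ)).sum : ℝ) < q * Δ) ≤
      ENNReal.ofReal (4 * 1 / q) := by
  have hq' : (0 : ℝ) < q := by exact_mod_cast hq
  have hqΔ : (0 : ℝ) < q * Δ := by positivity
  have ha := G.lightMean_nonneg Δ
  have hmean : 2 * (q * Δ : ℝ) ≤ (q * k : ℕ) * G.lightMean Δ := by
    push_cast
    nlinarith
  refine prob_iid_sum_lt_le ha (by positivity) (expect_weight_eq_ofReal G Δ)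
    (expect_weight_sq_le_ofReal G Δ) hqΔ hmean ?_
  rw [div_mul_eq_mul_div, le_div_iff₀ hq', one_mul]
  nlinarith

theorem prob_small_batches_le {Δ : ℕ} (hq : 0 < q) (h : 2 * (Δ : ℝ) ≤ k * G.lightMean Δ)
    (h' : 2 * (G.n : ℝ) ≤ k ^ 2 * G.lightMean Δ) :
    prob (iid ((batch k Δ).law G) q) (fun b => (b.sum : ℝ) < q) ≤ ENNReal.ofReal (4 * 6 / q) := by
  have hq' : (0 : ℝ) < q := by exact_mod_cast hq
  have hN : (0 : ℝ) < G.n := by exact_mod_cast G.n_pos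
  have ha := G.lightMean_nonneg Δ
  have hmean : 2 * (q : ℝ) ≤ q * (k ^ 2 * (G.lightMean Δ / G.n)) := by
    rw [← mul_div_assoc, ← mul_div_assoc, le_div_iff₀ hN]
    nlinarith
  have h := prob_iid_sum_lt_le (f := id) (K := 6) (T := q) (N := q) (by positivity) (by positivity)
    (expect_batch_eq_ofReal G k Δ) (expect_batch_sq_le_ofReal G k Δ) hq' hmean (by
      refine variance_batches_le hN ha hq' (by positivity) (by nlinarith) ?_ le_rfl
      rw [sq (_ * _)]
      exact mul_le_mul_of_nonneg_right (by linarith) (by positivity))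
  simpa only [List.map_id] using h

variable {G} {w : ℕ}

theorem expect_stage {Δ : ℕ} (hw : w ∈ G.V) (F : Option ℝ → ℝ≥0∞) :
    expect ((stage k q w Δ).law G) F = expect (iid (draw.law G) (q * k)) fun l =>
      expect (iid ((batch k Δ).law G) q) fun b =>
        F (answer k q Δ (l.map fun r => G.adjInd w r.v).sum (l.map (weight Δ)).sum b.sum) := by
  rw [stage, law_bind, law_replicate, expect_bind]
  refine expect_congr_support fun l hl => ?_
  have hl := (valid_of_mem_support_iid_draw G _ l hl).2
  rw [law_bind, (returns_countAdj hw fun x hx => ?_).law, PMF.pure_bind, law_bind, law_replicate,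
    expect_bind]
  · simp only [law_ret, expect_pure, List.map_map, Function.comp_def]
  · obtain ⟨r, hr, rfl⟩ := List.mem_map.1 hx
    exact (hl r hr).1

theorem prob_stage_le {Δ : ℕ} (hw : w ∈ G.V) {E : Option ℝ → Prop} {P : List Sample → Prop}
    {Q : List ℕ → Prop} (h : ∀ l b, E (answer k q Δ (l.map fun r => G.adjInd w r.v).sum
      (l.map (weight Δ)).sum b.sum) → P l ∨ Q b) :
    prob ((stage k q w Δ).law G) E ≤
      prob (iid (draw.law G) (q * k)) P + prob (iid ((batch k Δ).law G) q) Q := by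
  classical
  simp only [prob_eq_expect_ite]
  rw [expect_stage hw]
  calc _ ≤ expect (iid (draw.law G) (q * k)) fun l => expect (iid ((batch k Δ).law G) q) fun b =>
        ((if P l then 1 else 0) + if Q b then 1 else 0 : ℝ≥0∞) := by
        refine expect_mono fun l => expect_mono fun b => ?_
        split_ifs with hE hP hQ hQ
        · exact le_self_add
        · exact le_self_add
        · exact le_add_self
        · exact absurd (h l b hE) (not_or.2 ⟨hP, hQ⟩)
        all_goals exact zero_le
    _ = _ := by simp only [expect_add, expect_const]

theorem prob_wrong_stage_le (hε : 0 < ε) (hε' : ε < 1) (hq : 0 < q) (hw : w ∈ G.V) :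
    prob ((stage k q w (G.deg w)).law G) (Wrong fun v => |v - G.n| ≤ ε * G.n) ≤
      ENNReal.ofReal (512 / (ε ^ 2 * q)) := by
  have hN : (0 : ℝ) < G.n := by exact_mod_cast G.n_pos
  have hΔ := G.deg_pos hw
  calc _ ≤ ENNReal.ofReal (4 * 1 / ((ε / 4) ^ 2 * q)) +
        ENNReal.ofReal (4 * 1 / ((ε / 4) ^ 2 * q)) + ENNReal.ofReal (4 * 6 / ((ε / 4) ^ 2 * q)) :=
        (prob_stage_le hw fun _ _ => misleading_of_wrong_answer hN hε hε' hq hΔ).trans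
          (add_le_add ((prob_or_le _ _ _).trans
            (add_le_add (prob_misleading_neighbours_le G hε hε' hq k w)
              (prob_misleading_weight_le G hε hε' hq k hΔ)))
            (prob_misleading_batches_le G hε hε' hq k _))
    _ = _ := by
        rw [← ENNReal.ofReal_add (by positivity) (by positivity),
          ← ENNReal.ofReal_add (by positivity) (by positivity)]
        congr 1
        field_simp
        norm_num

theorem prob_stage_eq_none_le (hq : 0 < q) (hw : w ∈ G.V) (h : 2 * (G.n : ℝ) ≤ k * G.deg w ∨
      2 * (G.deg w : ℝ) ≤ k * G.lightMean (G.deg w) ∧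
        2 * (G.n : ℝ) ≤ k ^ 2 * G.lightMean (G.deg w)) :
    prob ((stage k q w (G.deg w)).law G) (· = none) ≤ ENNReal.ofReal (28 / q) := by
  rcases h with h | ⟨h, h'⟩
  · calc _ ≤ prob (iid (draw.law G) (q * k))
          (fun l => ((l.map fun r => G.adjInd w r.v).sum : ℝ) < q) +
          prob (iid ((batch k (G.deg w)).law G) q) (fun _ => False) :=
          prob_stage_le hw fun _ _ hnone => .inl (small_of_answer_eq_none hnone).1
      _ ≤ ENNReal.ofReal (4 * 1 / q) + 0 :=
          add_le_add (prob_few_neighbours_le G hq h) (by simp [prob, expect_const])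
      _ ≤ _ := by
          rw [add_zero]
          gcongr
          norm_num
  · calc _ ≤ ENNReal.ofReal (4 * 1 / q) + ENNReal.ofReal (4 * 6 / q) :=
          (prob_stage_le hw fun _ _ hnone => (small_of_answer_eq_none hnone).2).trans
            (add_le_add (prob_small_weight_le G hq (G.deg_pos hw) h)
              (prob_small_batches_le G hq h h'))
      _ = _ := by
          rw [← ENNReal.ofReal_add (by positivity) (by positivity), ← add_div]
          norm_num

end Prog

/-! ### Vertices of large degree are seen early -/

namespace InputGraph

variable (G : InputGraph)

/-- The set of vertices of degree more than `t`. -/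
noncomputable def heavy (t : ℕ) : Finset ℕ := G.V.filter fun x => t < G.deg x

/-- The set of vertices of degree at most `t`. -/
noncomputable def light (t : ℕ) : Finset ℕ := G.V.filter fun x => ¬ t < G.deg x

theorem sum_heavy_add_sum_light {M : Type*} [AddCommMonoid M] (t : ℕ) (f : ℕ → M) :
    ∑ x ∈ G.heavy t, f x + ∑ x ∈ G.light t, f x = ∑ x ∈ G.V, f x :=
  Finset.sum_filter_add_sum_filter_not _ _ _

theorem lightPairs_eq_crossCount (t : ℕ) :
    G.lightPairs t = G.crossCount (G.light t) (G.light t) := by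
  simp only [lightPairs, crossCount, light, Finset.sum_filter, lightInd, not_lt]
  refine Finset.sum_congr rfl fun x _ => ?_
  by_cases h : G.deg x ≤ t <;> simp [h]

theorem crossCount_le_card_mul_card (S T : Finset ℕ) : G.crossCount S T ≤ S.card * T.card := by
  rw [crossCount, ← smul_eq_mul, ← Finset.sum_const]
  refine Finset.sum_le_sum fun x _ => ?_
  rw [Finset.card_eq_sum_ones]
  refine Finset.sum_le_sum fun y _ => ?_
  rw [adjInd]
  split_ifs <;> simp

theorem two_mul_m_eq_sum_deg : 2 * G.m = ∑ x ∈ G.V, G.deg x := by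
  rw [m, ← crossCount_self, crossCount]
  simp only [sum_adjInd]

theorem two_mul_m_eq_lightPairs_add (t : ℕ) : 2 * G.m = G.lightPairs t +
    2 * G.crossCount (G.light t) (G.heavy t) + G.crossCount (G.heavy t) (G.heavy t) := by
  have hsplit : G.crossCount G.V G.V = G.crossCount (G.heavy t) (G.heavy t) +
      G.crossCount (G.heavy t) (G.light t) + (G.crossCount (G.light t) (G.heavy t) +
      G.crossCount (G.light t) (G.light t)) := by
    simp only [crossCount, ← G.sum_heavy_add_sum_light t, Finset.sum_add_distrib]
  rw [m, ← crossCount_self, hsplit, lightPairs_eq_crossCount,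
    G.crossCount_comm (G.heavy t) (G.light t)]
  ring

theorem two_mul_m_le_n_sq : 2 * G.m ≤ G.n ^ 2 := by
  rw [m, ← crossCount_self, sq]
  exact G.crossCount_le_card_mul_card _ _

theorem n_le_two_mul_m : G.n ≤ 2 * G.m := by
  rw [two_mul_m_eq_sum_deg, n, Finset.card_eq_sum_ones]
  exact Finset.sum_le_sum fun x hx => G.deg_pos hx

theorem m_pos : 0 < G.m := Nat.pos_of_mul_pos_left (G.n_pos.trans_le G.n_le_two_mul_m)

theorem two_le_n : 2 ≤ G.n := by
  obtain ⟨x, hx⟩ := G.nonempty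
  obtain ⟨y, hxy⟩ := G.no_isolated x hx
  exact Finset.one_lt_card.2 ⟨x, hx, y, G.mem_of_adj y x hxy.symm, hxy.ne⟩

theorem sqrt_n_div_avgDeg : √(G.n / G.avgDeg) = G.n / √(2 * G.m) := by
  rw [avgDeg, div_div_eq_mul_div, ← sq, Real.sqrt_div (by positivity),
    Real.sqrt_sq (by positivity)]

theorem sqrt_two_mul_m_pos : 0 < √(2 * (G.m : ℝ)) := by
  have hm : (0 : ℝ) < G.m := by exact_mod_cast G.m_pos
  exact Real.sqrt_pos.2 (by positivity)

theorem lightPairs_mono {s t : ℕ} (h : s ≤ t) : G.lightPairs s ≤ G.lightPairs t := by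
  refine Finset.sum_le_sum fun x _ => Finset.sum_le_sum fun y _ => ?_
  rw [lightInd, lightInd]
  split_ifs with hs ht
  · exact le_rfl
  · exact absurd ⟨hs.1.trans h, hs.2.trans h⟩ ht
  · exact Nat.zero_le _
  · exact le_rfl

theorem lightPairs_zero : G.lightPairs 0 = 0 := by
  refine Finset.sum_eq_zero fun x hx => Finset.sum_eq_zero fun y _ => ?_
  rw [lightInd, if_neg fun h => (G.deg_pos hx).not_ge h.1]

/-- The sum over all vertices of the fraction of its neighbours that witness a degree above `t`:
`G.n` times the probability that a sample contains a vertex of degree above `t`. -/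
noncomputable def witnessSum (t : ℕ) : ℝ :=
  ∑ v ∈ G.V, (G.deg v : ℝ)⁻¹ * ∑ w ∈ G.nbrs v, if t < G.deg v ∨ t < G.deg w then 1 else 0

theorem card_heavy_le_witnessSum (t : ℕ) : ((G.heavy t).card : ℝ) ≤ G.witnessSum t := by
  rw [witnessSum, ← G.sum_heavy_add_sum_light t, Finset.card_eq_sum_ones, Nat.cast_sum]
  refine le_add_of_le_of_nonneg (Finset.sum_le_sum fun v hv => ?_) (by positivity)
  obtain ⟨hv, hdeg⟩ := Finset.mem_filter.1 hv
  have hpos : ((G.nbrs v).card : ℝ) ≠ 0 := Nat.cast_ne_zero.2 (G.deg_pos hv).ne'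
  simp only [hdeg, true_or, if_true, Finset.sum_const, nsmul_eq_mul, mul_one]
  rw [deg, inv_mul_cancel₀ hpos, Nat.cast_one]

theorem crossCount_le_witnessSum {t : ℕ} {u : ℝ} (ht : t ≤ u) :
    (G.crossCount (G.light t) (G.heavy t) : ℝ) ≤ u * G.witnessSum t := by
  rw [witnessSum, ← G.sum_heavy_add_sum_light t, mul_add, crossCount, Nat.cast_sum,
    Finset.mul_sum (G.light t)]
  have hu : 0 ≤ u := le_trans (by positivity) ht
  refine le_add_of_nonneg_of_le (by positivity) (Finset.sum_le_sum fun v hv => ?_)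
  obtain ⟨hv, hdeg⟩ := Finset.mem_filter.1 hv
  have hpos : (0 : ℝ) < G.deg v := by exact_mod_cast G.deg_pos hv
  have hle : (G.deg v : ℝ) ≤ u := le_trans (by exact_mod_cast not_lt.1 hdeg) ht
  have heavyNbrs : ((∑ y ∈ G.heavy t, G.adjInd v y : ℕ) : ℝ) =
      ∑ w ∈ G.nbrs v, if t < G.deg v ∨ t < G.deg w then 1 else 0 := by
    classical
    simp only [hdeg, false_or, heavy, nbrs, Finset.sum_filter, Nat.cast_sum, adjInd]
    refine Finset.sum_congr rfl fun y _ => ?_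
    split_ifs <;> simp
  rw [heavyNbrs, ← mul_assoc]
  refine le_mul_of_one_le_left (by positivity) ?_
  rwa [← div_eq_mul_inv, one_le_div hpos]

theorem sqrt_le_witnessSum {t : ℕ} (ht : (t : ℝ) ≤ √(2 * G.m)) (h : G.lightPairs t < G.m) :
    √(2 * G.m) / 8 ≤ G.witnessSum t := by
  have hsplit : (2 * G.m : ℝ) = G.lightPairs t + 2 * G.crossCount (G.light t) (G.heavy t) +
      G.crossCount (G.heavy t) (G.heavy t) := by exact_mod_cast G.two_mul_m_eq_lightPairs_add t
  have hlight : (G.lightPairs t : ℝ) < G.m := by exact_mod_cast h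
  have hmixed := G.crossCount_le_witnessSum ht
  have hheavy : (G.crossCount (G.heavy t) (G.heavy t) : ℝ) ≤ G.witnessSum t * G.witnessSum t :=
    calc _ ≤ ((G.heavy t).card : ℝ) * (G.heavy t).card := by
          exact_mod_cast G.crossCount_le_card_mul_card _ _
      _ ≤ _ := mul_self_le_mul_self (by positivity) (G.card_heavy_le_witnessSum t)
  have hsq : √(2 * G.m) * √(2 * G.m) = 2 * G.m := Real.mul_self_sqrt (by positivity)
  have hpos := G.sqrt_two_mul_m_pos
  have hnonneg : 0 ≤ G.witnessSum t := le_trans (by positivity) (G.card_heavy_le_witnessSum t)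
  by_contra! hlt
  nlinarith [hnonneg]

/-- The degree `Δ` is a useful threshold between light and heavy vertices: it is at least the square
root of twice the number of edges, or at least half of the edges join vertices of degree at most
`Δ`. -/
def Adequate (Δ : ℕ) : Prop := √(2 * G.m) ≤ Δ ∨ G.m ≤ G.lightPairs Δ

theorem exists_adequate_of_lt :
    ∃ t : ℕ, (∀ Δ, t < Δ → G.Adequate Δ) ∧ √(2 * G.m) / 8 ≤ G.witnessSum t := by
  classical
  have hex : ∃ Δ : ℕ, G.Adequate Δ := (exists_nat_ge (√(2 * G.m))).imp fun Δ h => .inl h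
  have hzero : ¬ G.Adequate 0 := by
    rw [Adequate, lightPairs_zero, Nat.cast_zero, not_or, not_le, not_le]
    exact ⟨G.sqrt_two_mul_m_pos, G.m_pos⟩
  obtain ⟨t, ht⟩ := Nat.exists_eq_succ_of_ne_zero ((Nat.find_pos hex).2 hzero).ne'
  refine ⟨t, fun Δ hΔ => ?_, ?_⟩
  · have hle : Nat.find hex ≤ Δ := by lia
    exact (Nat.find_spec hex).imp (fun h => h.trans (by exact_mod_cast hle))
      fun h => h.trans (G.lightPairs_mono hle)
  · have hnot : ¬ G.Adequate t := Nat.find_min hex (by lia)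
    rw [Adequate, not_or, not_le, not_le] at hnot
    exact G.sqrt_le_witnessSum hnot.1.le hnot.2

theorem le_lightMean_of_adequate {k Δ : ℕ} (hk : 4 * (G.n : ℝ) ≤ k * √(2 * G.m))
    (h : G.Adequate Δ) : 2 * (G.n : ℝ) ≤ k * Δ ∨
      2 * (Δ : ℝ) ≤ k * G.lightMean Δ ∧ 2 * (G.n : ℝ) ≤ k ^ 2 * G.lightMean Δ := by
  have hN : (0 : ℝ) < G.n := by exact_mod_cast G.n_pos
  set u := √(2 * G.m) with hu
  have hpos : 0 < u := G.sqrt_two_mul_m_pos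
  rcases le_or_gt u Δ with hΔ | hΔ
  · left
    calc 2 * (G.n : ℝ) ≤ k * u := by linarith
      _ ≤ _ := by gcongr
  · right
    have hlight : (G.m : ℝ) ≤ G.lightPairs Δ := by exact_mod_cast h.resolve_left hΔ.not_ge
    have hmean : u * u / (2 * G.n) ≤ G.lightMean Δ := by
      rw [hu, Real.mul_self_sqrt (by positivity), lightMean, mul_div_mul_left _ _ two_ne_zero]
      gcongr
    constructor
    · calc 2 * (Δ : ℝ) ≤ 2 * u := by linarith
        _ ≤ k * (u * u / (2 * G.n)) := by
          rw [← mul_div_assoc, le_div_iff₀ (by positivity)]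
          nlinarith
        _ ≤ _ := by gcongr
    · calc 2 * (G.n : ℝ) ≤ k ^ 2 * (u * u / (2 * G.n)) := by
            rw [← mul_div_assoc, le_div_iff₀ (by positivity)]
            have : (2 * (G.n : ℝ)) ^ 2 ≤ (k * u) ^ 2 :=
              pow_le_pow_left₀ (by positivity) (by linarith) 2
            nlinarith
        _ ≤ _ := by gcongr

end InputGraph

namespace Prog

open Sample

variable (G : InputGraph)

theorem prob_draw_witness (t : ℕ) :
    (prob (draw.law G) fun r => t < r.dv ∨ t < r.dw) = ENNReal.ofReal (G.witnessSum t / G.n) := by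
  rw [prob_eq_expect_ite, expect_draw, G.ofReal_div_n, InputGraph.witnessSum,
    ENNReal.ofReal_sum_of_nonneg fun _ _ => by positivity]
  congr 1
  refine Finset.sum_congr rfl fun v hv => ?_
  have hpos : (0 : ℝ) < G.deg v := by exact_mod_cast G.deg_pos hv
  rw [ENNReal.ofReal_mul (by positivity), ENNReal.ofReal_inv_of_pos hpos, ENNReal.ofReal_natCast,
    ENNReal.ofReal_sum_of_nonneg fun _ _ => by positivity]
  congr 1
  refine Finset.sum_congr rfl fun w _ => ?_
  split_ifs <;> simp

theorem prob_not_adequate_le {k : ℕ} (hk : 8000 * (G.n : ℝ) ≤ k * √(2 * G.m)) :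
    (prob (iid (draw.law G) k) fun l => ¬ G.Adequate (best l).2) ≤ ENNReal.ofReal (1 / 1000) := by
  obtain ⟨t, ht, hw⟩ := G.exists_adequate_of_lt
  have hN : (0 : ℝ) < G.n := by exact_mod_cast G.n_pos
  set x := G.witnessSum t / G.n with hx
  have hx0 : 0 ≤ x := div_nonneg (le_trans (by positivity) hw) hN.le
  have hkx : 1000 ≤ k * x := by
    rw [hx, ← mul_div_assoc, le_div_iff₀ hN]
    nlinarith
  calc _ ≤ prob (iid (draw.law G) k) fun l => ∀ r ∈ l, ¬ (t < r.dv ∨ t < r.dw) := by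
        refine prob_mono fun l hl r hr h => hl (ht _ ?_)
        exact h.elim (fun h => h.trans_le (le_best r hr).1) fun h => h.trans_le (le_best r hr).2
    _ = (1 - ENNReal.ofReal x) ^ k := by
        rw [prob_iid_forall, ← prob_draw_witness]
        congr 1
        exact ENNReal.eq_sub_of_add_eq' ENNReal.one_ne_top
          (by rw [add_comm, prob_add_prob_not])
    _ ≤ ENNReal.ofReal (Real.exp (-x)) ^ k := by
        gcongr
        rw [← ENNReal.ofReal_one, ← ENNReal.ofReal_sub _ hx0]
        exact ENNReal.ofReal_le_ofReal (Real.one_sub_le_exp_neg x)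
    _ = ENNReal.ofReal (Real.exp (-(k * x))) := by
        rw [← ENNReal.ofReal_pow (Real.exp_pos _).le, ← Real.exp_nat_mul, mul_neg]
    _ ≤ _ := by
        refine ENNReal.ofReal_le_ofReal ?_
        rw [Real.exp_neg, one_div]
        refine inv_anti₀ (by norm_num) ?_
        linarith [Real.add_one_le_exp (k * x)]

theorem prob_level_le {k q : ℕ} (hk : 0 < k) {E : Option ℝ → Prop} (P : ℕ → Prop) {c : ℝ≥0∞}
    (h : ∀ w ∈ G.V, P (G.deg w) → prob ((stage k q w (G.deg w)).law G) E ≤ c) :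
    prob ((level k q).law G) E ≤ (prob (iid (draw.law G) k) fun l => ¬ P (best l).2) + c := by
  rw [level, law_bind, law_replicate, prob, expect_bind]
  refine expect_le_prob_add (fun l _ => prob_le_one _ _) fun l hl hP => ?_
  obtain ⟨hlen, hvalid⟩ := valid_of_mem_support_iid_draw G k l hl
  obtain ⟨hmem, hdeg⟩ := best_valid hvalid (List.ne_nil_of_length_pos (hlen ▸ hk))
  rw [not_not, hdeg] at hP
  rw [hdeg]
  exact h _ hmem hP

theorem prob_wrong_level_le {k q : ℕ} {ε : ℝ} (hε : 0 < ε) (hε' : ε < 1) (hk : 0 < k)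
    (hq : 0 < q) :
    prob ((level k q).law G) (Wrong fun v => |v - G.n| ≤ ε * G.n) ≤
      ENNReal.ofReal (512 / (ε ^ 2 * q)) := by
  refine (prob_level_le G hk (fun _ => True)
    fun w hw _ => prob_wrong_stage_le hε hε' hq hw).trans_eq ?_
  simp [prob, expect_const]

theorem prob_level_eq_none_le {k q : ℕ} (hk : 8000 * (G.n : ℝ) ≤ k * √(2 * G.m)) (hq : 0 < q) :
    prob ((level k q).law G) (· = none) ≤ ENNReal.ofReal (1 / 1000) + ENNReal.ofReal (28 / q) := by
  have hN : (0 : ℝ) < G.n := by exact_mod_cast G.n_pos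
  have hk0 : 0 < k := by
    refine Nat.pos_of_ne_zero fun h => ?_
    rw [h, Nat.cast_zero, zero_mul] at hk
    linarith
  exact (prob_level_le G hk0 G.Adequate fun w hw hE => prob_stage_eq_none_le hq hw
    (G.le_lightMean_of_adequate (by linarith) hE)).trans
      (add_le_add_left (prob_not_adequate_le G hk) _)

theorem meanCost_stage_le {k q w : ℕ} (hw : w ∈ G.V) (Δ : ℕ) :
    (stage k q w Δ).meanCost G ≤ q * k * (17 + 4 * (k ^ 2 * (G.n : ℝ≥0∞)⁻¹)) := by
  rw [stage, meanCost_bind, meanCost_replicate, meanCost_draw, law_replicate]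
  calc _ ≤ ((q * k : ℕ) : ℝ≥0∞) * 4 + expect (iid (draw.law G) (q * k)) fun l =>
        (q * k : ℕ) + q * (12 * k + 4 * k * (k ^ 2 * (G.n : ℝ≥0∞)⁻¹)) := by
        gcongr
        refine expect_mono_support fun l hl => ?_
        obtain ⟨hlen, hvalid⟩ := valid_of_mem_support_iid_draw G _ l hl
        have hcount := returns_countAdj (l := l.map Sample.v) hw fun x hx => by
          obtain ⟨r, hr, rfl⟩ := List.mem_map.1 hx
          exact (hvalid r hr).1
        rw [meanCost_bind, hcount.meanCost, hcount.law, expect_pure, List.length_map, hlen,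
          meanCost_bind, meanCost_replicate]
        simp only [meanCost_ret, expect_const, add_zero]
        gcongr
        exact meanCost_batch_le G k Δ
    _ = _ := by
        rw [expect_const]
        push_cast
        ring

theorem meanCost_level_le {k q : ℕ} (hk : 0 < k) (hq : 0 < q) :
    (level k q).meanCost G ≤ q * k * (21 + 4 * (k ^ 2 * (G.n : ℝ≥0∞)⁻¹)) := by
  rw [level, meanCost_bind, meanCost_replicate, meanCost_draw, law_replicate]
  calc _ ≤ (k : ℝ≥0∞) * 4 + expect (iid (draw.law G) k) fun l =>
        q * k * (17 + 4 * (k ^ 2 * (G.n : ℝ≥0∞)⁻¹)) := by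
        gcongr
        refine expect_mono_support fun l hl => ?_
        obtain ⟨hlen, hvalid⟩ := valid_of_mem_support_iid_draw G _ l hl
        exact meanCost_stage_le G
          (best_valid hvalid (List.ne_nil_of_length_pos (hlen ▸ hk))).1 _
    _ ≤ q * k * 4 + q * k * (17 + 4 * (k ^ 2 * (G.n : ℝ≥0∞)⁻¹)) := by
        rw [expect_const]
        gcongr
        exact le_mul_of_one_le_left zero_le (by exact_mod_cast hq)
    _ = _ := by ring

end Prog

/-! ### The upper bound -/

/-- The number of repetitions in the `i`-th level: of order `ε⁻² i²`, so that the probabilities of a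
wrong answer in the individual levels have a small sum. -/
noncomputable def repetitions (ε : ℝ) (i : ℕ) : ℕ := 512000 * ⌈ε⁻¹ ^ 2⌉₊ * ((i + 1) * (i + 2))

theorem repetitions_pos {ε : ℝ} (hε : 0 < ε) (i : ℕ) : 0 < repetitions ε i := by
  have : 0 < ⌈ε⁻¹ ^ 2⌉₊ := Nat.ceil_pos.2 (by positivity)
  unfold repetitions
  positivity

theorem repetitions_mono (ε : ℝ) : Monotone (repetitions ε) := by
  intro i j h
  unfold repetitions
  gcongr

theorem le_sq_mul_repetitions {ε : ℝ} (hε : ε ≠ 0) (i : ℕ) :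
    512000 * ((i + 1) * (i + 2)) ≤ ε ^ 2 * repetitions ε i := by
  have hceil : ε⁻¹ ^ 2 ≤ ⌈ε⁻¹ ^ 2⌉₊ := Nat.le_ceil _
  have hcancel : ε ^ 2 * ε⁻¹ ^ 2 = 1 := by field_simp
  unfold repetitions
  push_cast
  calc _ = 512000 * (((i : ℝ) + 1) * (i + 2)) * (ε ^ 2 * ε⁻¹ ^ 2) := by rw [hcancel, mul_one]
    _ ≤ 512000 * (((i : ℝ) + 1) * (i + 2)) * (ε ^ 2 * ⌈ε⁻¹ ^ 2⌉₊) := by gcongr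
    _ = _ := by ring

theorem le_repetitions {ε : ℝ} (hε : 0 < ε) (i : ℕ) : 512000 ≤ repetitions ε i := by
  have : 0 < ⌈ε⁻¹ ^ 2⌉₊ := Nat.ceil_pos.2 (by positivity)
  rw [repetitions, mul_assoc]
  exact Nat.le_mul_of_pos_right _ (by positivity)

theorem repetitions_le {ε : ℝ} (hε : 0 < ε) (hε' : ε < 1) (i : ℕ) :
    (repetitions ε i : ℝ) ≤ 1024000 * ε⁻¹ ^ 2 * ((i + 1) * (i + 2)) := by
  have hone : 1 ≤ ε⁻¹ ^ 2 := one_le_pow₀ ((one_le_inv₀ hε).2 hε'.le)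
  have hceil : (⌈ε⁻¹ ^ 2⌉₊ : ℝ) ≤ 2 * ε⁻¹ ^ 2 := by
    linarith [Nat.ceil_lt_add_one (zero_le_one.trans hone)]
  unfold repetitions
  push_cast
  calc _ ≤ 512000 * (2 * ε⁻¹ ^ 2) * (((i : ℝ) + 1) * (i + 2)) := by gcongr
    _ = _ := by ring

theorem sum_repetitions_mul_two_pow_le (ε : ℝ) (i : ℕ) :
    ∑ j ∈ Finset.range (i + 1), (repetitions ε j : ℝ) * 2 ^ j ≤ 2 * (repetitions ε i * 2 ^ i) := by
  have hgeom : ∑ j ∈ Finset.range (i + 1), (2 : ℝ) ^ j ≤ 2 * 2 ^ i := by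
    rw [geom_sum_eq (by norm_num), pow_succ]
    linarith
  calc _ ≤ ∑ j ∈ Finset.range (i + 1), (repetitions ε i : ℝ) * 2 ^ j := by
        refine Finset.sum_le_sum fun j hj => ?_
        gcongr
        exact_mod_cast repetitions_mono ε (Finset.mem_range_succ_iff.1 hj)
    _ = repetitions ε i * ∑ j ∈ Finset.range (i + 1), (2 : ℝ) ^ j := by rw [Finset.mul_sum]
    _ ≤ repetitions ε i * (2 * 2 ^ i) := by gcongr
    _ = _ := by ring

theorem sum_one_div_succ_mul_succ_succ (N : ℕ) :
    ∑ i ∈ Finset.range N, 1 / (((i : ℝ) + 1) * (i + 2)) = 1 - 1 / (N + 1) := by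
  induction N with
  | zero => simp
  | succ N ih =>
    rw [Finset.sum_range_succ, ih]
    push_cast
    field_simp
    ring

theorem exists_two_pow_le_two_mul {x : ℝ} (hx : 1 ≤ x) : ∃ i : ℕ, x ≤ 2 ^ i ∧ 2 ^ i ≤ 2 * x := by
  obtain ⟨i, hle, hlt⟩ := exists_nat_pow_near hx one_lt_two
  exact ⟨i + 1, hlt.le, by rw [pow_succ]; linarith⟩

theorem add_two_le_log {n i : ℕ} (hn : 2 ≤ n) (h : (2 : ℝ) ^ i ≤ 16000 * n) :
    (i : ℝ) + 2 ≤ 25 * Real.log n := by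
  have hn' : (2 : ℝ) ≤ n := by exact_mod_cast hn
  have hlog : Real.log 2 ≤ Real.log n := Real.log_le_log (by norm_num) hn'
  have hi : i * Real.log 2 ≤ 14 * Real.log 2 + Real.log n := by
    rw [← Real.log_pow, show (14 : ℝ) = (14 : ℕ) by norm_num, ← Real.log_pow,
      ← Real.log_mul (by norm_num) (by positivity)]
    refine Real.log_le_log (by positivity) (h.trans ?_)
    gcongr
    norm_num
  nlinarith [Real.log_two_gt_d9]

namespace InputGraph

variable (G : InputGraph)

theorem one_le_n_div_sqrt : 1 ≤ G.n / √(2 * G.m) := by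
  rw [one_le_div G.sqrt_two_mul_m_pos, Real.sqrt_le_iff]
  exact ⟨by positivity, by exact_mod_cast G.two_mul_m_le_n_sq⟩

theorem n_div_sqrt_le : G.n / √(2 * G.m) ≤ (G.n : ℝ) := by
  refine div_le_self (by positivity) ?_
  rw [Real.one_le_sqrt]
  exact_mod_cast G.n_pos.trans_le G.n_le_two_mul_m

theorem n_div_sqrt_sq_le : (G.n / √(2 * G.m)) ^ 2 ≤ (G.n : ℝ) := by
  have hpos : (0 : ℝ) < 2 * G.m := by exact_mod_cast G.n_pos.trans_le G.n_le_two_mul_m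
  have hle : (G.n : ℝ) ≤ 2 * G.m := by exact_mod_cast G.n_le_two_mul_m
  rw [div_pow, Real.sq_sqrt hpos.le, div_le_iff₀ hpos, sq]
  gcongr

end InputGraph

/-- The levels of the doubling search. -/
noncomputable def searchLevels (ε : ℝ) (i : ℕ) : AdvancedProg :=
  ⟨Prog.level (2 ^ i) (repetitions ε i), Prog.allQueries_level _ _⟩

theorem sum_prob_wrong_searchLevels_le (G : InputGraph) {ε : ℝ} (hε : 0 < ε) (hε' : ε < 1)
    (N : ℕ) :
    ∑ i ∈ Finset.range N, prob ((searchLevels ε i).1.law G) (Wrong fun v => |v - G.n| ≤ ε * G.n) ≤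
      ENNReal.ofReal (1 / 1000) := by
  calc _ ≤ ∑ i ∈ Finset.range N,
        ENNReal.ofReal (1 / 1000 * (1 / (((i : ℝ) + 1) * (i + 2)))) := by
        refine Finset.sum_le_sum fun i _ =>
          (Prog.prob_wrong_level_le G hε hε' (by positivity) (repetitions_pos hε i)).trans
            (ENNReal.ofReal_le_ofReal ?_)
        have hpos : (0 : ℝ) < repetitions ε i := by exact_mod_cast repetitions_pos hε i
        rw [← mul_div_assoc, mul_one, div_div, div_le_div_iff₀ (by positivity) (by positivity)]
        linarith [le_sq_mul_repetitions hε.ne' i]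
    _ ≤ _ := by
        rw [← ENNReal.ofReal_sum_of_nonneg fun _ _ => by positivity, ← Finset.mul_sum,
          sum_one_div_succ_mul_succ_succ]
        refine ENNReal.ofReal_le_ofReal ?_
        have : (0 : ℝ) ≤ 1 / (N + 1) := by positivity
        linarith

theorem prob_searchLevels_eq_none_le {G : InputGraph} {ε : ℝ} (hε : 0 < ε) {i : ℕ}
    (hi : 8000 * (G.n / √(2 * G.m)) ≤ (2 : ℝ) ^ i) :
    prob ((searchLevels ε i).1.law G) (· = none) ≤ ENNReal.ofReal (2 / 1000) := by
  rw [← mul_div_assoc, div_le_iff₀ G.sqrt_two_mul_m_pos] at hi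
  have hpos : (0 : ℝ) < repetitions ε i := by exact_mod_cast repetitions_pos hε i
  have hle : (512000 : ℝ) ≤ repetitions ε i := by exact_mod_cast le_repetitions hε i
  refine (Prog.prob_level_eq_none_le G (by exact_mod_cast hi) (repetitions_pos hε i)).trans ?_
  rw [← ENNReal.ofReal_add (by norm_num) (by positivity)]
  refine ENNReal.ofReal_le_ofReal ?_
  have : 28 / (repetitions ε i : ℝ) ≤ 1 / 1000 := by
    rw [div_le_div_iff₀ hpos (by norm_num)]
    linarith
  linarith

theorem meanCost_searchLevels_le {G : InputGraph} {ε : ℝ} (hε : 0 < ε) {i : ℕ}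
    (hi : (2 : ℝ) ^ i ≤ 16000 * (G.n / √(2 * G.m))) :
    (searchLevels ε i).1.meanCost G + 1 ≤
      ENNReal.ofReal (1024000022 * (repetitions ε i * 2 ^ i)) := by
  have hN : (0 : ℝ) < G.n := by exact_mod_cast G.n_pos
  have hsq : ((2 ^ i : ℕ) : ℝ) ^ 2 * (G.n : ℝ)⁻¹ ≤ (256000000 : ℕ) := by
    rw [← div_eq_mul_inv, div_le_iff₀ hN]
    push_cast
    calc ((2 : ℝ) ^ i) ^ 2 ≤ (16000 * (G.n / √(2 * G.m))) ^ 2 :=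
          pow_le_pow_left₀ (by positivity) hi 2
      _ ≤ 256000000 * G.n := by linarith [G.n_div_sqrt_sq_le, mul_pow 16000 (G.n / √(2 * G.m)) 2]
  have hsq' : ((2 ^ i : ℕ) : ℝ≥0∞) ^ 2 * (G.n : ℝ≥0∞)⁻¹ ≤ (256000000 : ℕ) := by
    simpa only [ENNReal.ofReal_mul (sq_nonneg _), ENNReal.ofReal_pow (Nat.cast_nonneg _),
      ENNReal.ofReal_inv_of_pos hN, ENNReal.ofReal_natCast] using ENNReal.ofReal_le_ofReal hsq
  have hq := repetitions_pos hε i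
  calc _ ≤ (repetitions ε i : ℝ≥0∞) * (2 ^ i : ℕ) * (21 + 4 * (256000000 : ℕ)) +
        (repetitions ε i : ℝ≥0∞) * (2 ^ i : ℕ) := by
        refine add_le_add ((Prog.meanCost_level_le G (by positivity) hq).trans ?_) ?_
        · gcongr
        · exact_mod_cast Nat.mul_pos hq (by positivity)
    _ = ((1024000022 * (repetitions ε i * 2 ^ i) : ℕ) : ℝ≥0∞) := by
        push_cast
        ring
    _ = _ := by
        rw [← ENNReal.ofReal_natCast]
        push_cast
        rfl

theorem sum_meanCost_searchLevels_le {G : InputGraph} {ε : ℝ} (hε : 0 < ε) (hε' : ε < 1) {i : ℕ}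
    (hi : (2 : ℝ) ^ i ≤ 16000 * (G.n / √(2 * G.m))) :
    ∑ j ∈ Finset.range (i + 1), ((searchLevels ε j).1.meanCost G + 1) ≤
      ENNReal.ofReal (2 ^ 75 * (ε⁻¹ ^ 2 * (G.n / √(2 * G.m)) * Real.log G.n ^ 2)) := by
  have hlog := add_two_le_log G.two_le_n (hi.trans (by gcongr; exact G.n_div_sqrt_le))
  have hlogsq : ((i : ℝ) + 1) * (i + 2) ≤ 625 * Real.log G.n ^ 2 := by nlinarith
  set R := G.n / √(2 * G.m)
  have hlast : (repetitions ε i : ℝ) * 2 ^ i ≤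
      1024000 * ε⁻¹ ^ 2 * (625 * Real.log G.n ^ 2) * (16000 * R) := by
    refine mul_le_mul ((repetitions_le hε hε' i).trans ?_) hi (by positivity) (by positivity)
    gcongr
  calc _ ≤ ∑ j ∈ Finset.range (i + 1),
        ENNReal.ofReal (1024000022 * (repetitions ε j * 2 ^ j)) := by
        refine Finset.sum_le_sum fun j hj => meanCost_searchLevels_le hε (le_trans ?_ hi)
        exact pow_le_pow_right₀ one_le_two (Finset.mem_range_succ_iff.1 hj)
    _ = ENNReal.ofReal (1024000022 *
          ∑ j ∈ Finset.range (i + 1), (repetitions ε j : ℝ) * 2 ^ j) := by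
        rw [← ENNReal.ofReal_sum_of_nonneg fun _ _ => by positivity, Finset.mul_sum]
    _ ≤ _ := by
        refine ENNReal.ofReal_le_ofReal ?_
        have hR : 0 ≤ ε⁻¹ ^ 2 * R * Real.log G.n ^ 2 := by positivity
        linarith [sum_repetitions_mul_two_pow_le ε i]

/-- A number of queries that the search exceeds with probability at most `1 / 1000`. -/
noncomputable def searchBudget (G : InputGraph) (ε : ℝ) : ℝ :=
  1000 * 2 ^ 75 * (ε⁻¹ ^ 2 * √(G.n / G.avgDeg)) * Real.log G.n ^ 2

theorem searchBudget_eq (G : InputGraph) (ε : ℝ) : searchBudget G ε =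
    1000 * (2 ^ 75 * (ε⁻¹ ^ 2 * (G.n / √(2 * G.m)) * Real.log G.n ^ 2)) := by
  rw [searchBudget, G.sqrt_n_div_avgDeg, mul_assoc, mul_assoc]

theorem searchBudget_pos (G : InputGraph) {ε : ℝ} (hε : 0 < ε) : 0 < searchBudget G ε := by
  have hR := zero_lt_one.trans_le G.one_le_n_div_sqrt
  have hlog : 0 < Real.log G.n := Real.log_pos (by exact_mod_cast G.two_le_n)
  rw [searchBudget_eq]
  positivity

theorem sum_meanCost_div_searchBudget_le {G : InputGraph} {ε : ℝ} (hε : 0 < ε) (hε' : ε < 1)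
    {i : ℕ} (hi : (2 : ℝ) ^ i ≤ 16000 * (G.n / √(2 * G.m))) :
    ∑ j ∈ Finset.range (i + 1),
      ((searchLevels ε j).1.meanCost G + 1) / ENNReal.ofReal (searchBudget G ε) ≤
        ENNReal.ofReal (1 / 1000) := by
  have hpos := searchBudget_pos G hε
  have hle := sum_meanCost_searchLevels_le hε hε' hi
  rw [searchBudget_eq] at hpos ⊢
  set b := 2 ^ 75 * (ε⁻¹ ^ 2 * (G.n / √(2 * G.m)) * Real.log G.n ^ 2)
  simp only [div_eq_mul_inv _ (ENNReal.ofReal _), ← Finset.sum_mul]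
  rw [← div_eq_mul_inv]
  refine (ENNReal.div_le_div_right hle _).trans_eq ?_
  rw [← ENNReal.ofReal_div_of_pos hpos,
    div_mul_cancel_right₀ (pos_of_mul_pos_right hpos (by norm_num)).ne', one_div]

theorem lt_of_one_le_add_add {x y z w : ℝ≥0∞} (h : 1 ≤ x + (y + z) + w)
    (hy : y ≤ ENNReal.ofReal (1 / 1000)) (hz : z ≤ ENNReal.ofReal (1 / 1000))
    (hw : w ≤ ENNReal.ofReal (2 / 1000)) : 99 / 100 < x := by
  by_contra! hx
  have h99 : (99 / 100 : ℝ≥0∞) = ENNReal.ofReal (99 / 100) := by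
    rw [ENNReal.ofReal_div_of_pos (by norm_num)]
    norm_num
  have hsum := h.trans (add_le_add (add_le_add (hx.trans_eq h99) (add_le_add hy hz)) hw)
  rw [← ENNReal.ofReal_add (by norm_num) (by norm_num),
    ← ENNReal.ofReal_add (by norm_num) (by norm_num),
    ← ENNReal.ofReal_add (by norm_num) (by norm_num), ← ENNReal.ofReal_one,
    ENNReal.ofReal_le_ofReal_iff (by norm_num)] at hsum
  norm_num at hsum

theorem lt_probHalt_searchAlgorithm (G : InputGraph) {ε : ℝ} (hε : 0 < ε) (hε' : ε < 1) :
    99 / 100 < (searchAlgorithm (searchLevels ε)).probHalt G fun nhat cost =>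
      |nhat - G.n| ≤ ε * G.n ∧ (cost : ℝ) ≤ searchBudget G ε := by
  have hpos := searchBudget_pos G hε
  obtain ⟨i, hle, hge⟩ := exists_two_pow_le_two_mul
    (x := 8000 * (G.n / √(2 * G.m))) (by linarith [G.one_le_n_div_sqrt])
  have hsuccess := searchAlgorithm.one_le_successProb (searchLevels ε) G
    (good := fun v => |v - G.n| ≤ ε * G.n)
    (P := fun v c => |v - G.n| ≤ ε * G.n ∧ (c : ℝ) ≤ searchBudget G ε)
    (ENNReal.ofReal_pos.2 hpos).ne' ENNReal.ofReal_ne_top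
    (fun v c hv hc => ⟨hv, by
      rwa [← ENNReal.ofReal_natCast, ENNReal.ofReal_le_ofReal_iff hpos.le] at hc⟩) i 0 0
  rw [← searchAlgorithm.probHalt_eq] at hsuccess
  simp only [zero_add, Nat.cast_zero, ENNReal.zero_div, add_zero,
    Finset.sum_add_distrib (M := ℝ≥0∞) (f := fun _ => prob _ _)] at hsuccess
  exact lt_of_one_le_add_add hsuccess (sum_prob_wrong_searchLevels_le G hε hε' (i + 1))
    (sum_meanCost_div_searchBudget_le hε hε' (by linarith)) (prob_searchLevels_eq_none_le hε hle)

theorem exists_approximation_algorithm : ∃ (C : ℝ) (j : ℕ), ∀ ε : ℝ, 0 < ε → ε < 1 →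
    ∃ A : Algorithm, A.IsAdvanced ∧ ∀ G : InputGraph,
      99 / 100 < A.probHalt G (fun nhat cost =>
        |nhat - G.n| ≤ ε * G.n ∧
        (cost : ℝ) ≤ C * (ε⁻¹ ^ 2 * √(G.n / G.avgDeg)) * Real.log G.n ^ j) :=
  ⟨1000 * 2 ^ 75, 2, fun _ hε hε' => ⟨searchAlgorithm (searchLevels _),
    searchAlgorithm.isAdvanced _, fun G => lt_probHalt_searchAlgorithm G hε hε'⟩⟩

/-! ### Hard instances: a hidden core and a random matching -/

/-- The labels of the pairs of adjacent vertices with indices in `I`. The residue of a label modulo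
`3` tells whether it is the first or the second vertex of a pair or a vertex of the core. -/
def pairLabels (I : Finset ℕ) : Finset ℕ := I.biUnion fun i => {3 * i, 3 * i + 1}

theorem mem_pairLabels {I : Finset ℕ} {x : ℕ} : x ∈ pairLabels I ↔ x / 3 ∈ I ∧ x % 3 < 2 := by
  simp only [pairLabels, Finset.mem_biUnion, Finset.mem_insert, Finset.mem_singleton]
  constructor
  · rintro ⟨i, hi, hx⟩
    rw [show x / 3 = i by lia]
    exact ⟨hi, by lia⟩
  · rintro ⟨h, hx⟩
    exact ⟨_, h, by lia⟩

theorem sum_pairLabels {M : Type*} [AddCommMonoid M] (I : Finset ℕ) (g : ℕ → M) :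
    ∑ x ∈ pairLabels I, g x = ∑ i ∈ I, (g (3 * i) + g (3 * i + 1)) := by
  rw [pairLabels, Finset.sum_biUnion]
  · exact Finset.sum_congr rfl fun i _ => Finset.sum_pair (by lia)
  · intro i _ j _ hij
    rw [Function.onFun, Finset.disjoint_left]
    intro x hx hx'
    simp only [Finset.mem_insert, Finset.mem_singleton] at hx hx'
    lia

/-- The other vertex of the pair that the vertex `x` of a pair belongs to. -/
def partner (x : ℕ) : ℕ := if x % 3 = 0 then x + 1 else x - 1

theorem partner_mem_pairLabels {I : Finset ℕ} {x : ℕ} (hx : x ∈ pairLabels I) :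
    partner x ∈ pairLabels I ∧ x / 3 = partner x / 3 ∧ x ≠ partner x := by
  rw [mem_pairLabels] at hx ⊢
  have hdiv : x / 3 = partner x / 3 := by
    unfold partner
    split_ifs <;> lia
  refine ⟨⟨hdiv ▸ hx.1, ?_⟩, hdiv, ?_⟩ <;>
    · unfold partner
      split_ifs <;> lia

namespace InputGraph

/-- The label of the vertex `j` of the core when the core is put at position `s`. -/
def coreLabel (H : InputGraph) (s j : ℕ) : ℕ := 3 * (H.n * s + j) + 2

theorem coreLabel_injective (H : InputGraph) (s : ℕ) : Function.Injective (H.coreLabel s) := by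
  intro i j h
  unfold coreLabel at h
  lia

/-- The disjoint union of a copy of the core `H` and of pairs of adjacent vertices. -/
def planted (H : InputGraph) (σ : Finset ℕ × ℕ) : InputGraph where
  V := pairLabels σ.1 ∪ H.V.image (H.coreLabel σ.2)
  graph :=
    { Adj := fun x y => (x ∈ pairLabels σ.1 ∧ y ∈ pairLabels σ.1 ∧ x / 3 = y / 3 ∧ x ≠ y) ∨
        ∃ i j, H.graph.Adj i j ∧ x = H.coreLabel σ.2 i ∧ y = H.coreLabel σ.2 j
      symm := ⟨by
        rintro x y (⟨hx, hy, h, hne⟩ | ⟨i, j, hij, rfl, rfl⟩)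
        · exact .inl ⟨hy, hx, h.symm, hne.symm⟩
        · exact .inr ⟨j, i, hij.symm, rfl, rfl⟩⟩
      loopless := ⟨by
        rintro x (⟨-, -, -, hne⟩ | ⟨i, j, hij, hx, hx'⟩)
        · exact hne rfl
        · exact hij.ne (H.coreLabel_injective _ (hx.symm.trans hx'))⟩ }
  nonempty := (H.nonempty.image _).inr
  mem_of_adj := by
    rintro x y (⟨hx, -⟩ | ⟨i, j, hij, rfl, rfl⟩)
    · exact Finset.mem_union_left _ hx
    · exact Finset.mem_union_right _ (Finset.mem_image_of_mem _ (H.mem_of_adj i j hij))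
  no_isolated := by
    intro x hx
    rcases Finset.mem_union.1 hx with hx | hx
    · exact ⟨partner x, .inl ⟨hx, partner_mem_pairLabels hx⟩⟩
    · obtain ⟨i, hi, rfl⟩ := Finset.mem_image.1 hx
      obtain ⟨j, hij⟩ := H.no_isolated i hi
      exact ⟨_, .inr ⟨i, j, hij, rfl, rfl⟩⟩

variable (H : InputGraph) (σ : Finset ℕ × ℕ)

theorem planted_V : (H.planted σ).V = pairLabels σ.1 ∪ H.V.image (H.coreLabel σ.2) := rfl

theorem planted_adj {x y : ℕ} : (H.planted σ).graph.Adj x y ↔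
    (x ∈ pairLabels σ.1 ∧ y ∈ pairLabels σ.1 ∧ x / 3 = y / 3 ∧ x ≠ y) ∨
      ∃ i j, H.graph.Adj i j ∧ x = H.coreLabel σ.2 i ∧ y = H.coreLabel σ.2 j := Iff.rfl

theorem coreLabel_notMem_pairLabels (s j : ℕ) (I : Finset ℕ) : H.coreLabel s j ∉ pairLabels I := by
  rw [mem_pairLabels, coreLabel]
  lia

theorem sum_planted_V {M : Type*} [AddCommMonoid M] (g : ℕ → M) :
    ∑ x ∈ (H.planted σ).V, g x =
      ∑ i ∈ σ.1, (g (3 * i) + g (3 * i + 1)) + ∑ j ∈ H.V, g (H.coreLabel σ.2 j) := by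
  rw [planted_V, Finset.sum_union, sum_pairLabels, Finset.sum_image]
  · exact fun i _ j _ h => H.coreLabel_injective _ h
  · rw [Finset.disjoint_left]
    intro x hx hx'
    obtain ⟨j, -, rfl⟩ := Finset.mem_image.1 hx'
    exact H.coreLabel_notMem_pairLabels _ _ _ hx

theorem planted_n : (H.planted σ).n = 2 * σ.1.card + H.n := by
  rw [n, Finset.card_eq_sum_ones, sum_planted_V, n, Finset.card_eq_sum_ones H.V, Finset.sum_const,
    smul_eq_mul, mul_comm]

theorem planted_nbrs_of_mem_pairLabels {x : ℕ} (hx : x ∈ pairLabels σ.1) :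
    (H.planted σ).nbrs x = {partner x} := by
  ext y
  rw [mem_nbrs, planted_adj, Finset.mem_singleton]
  constructor
  · rintro (⟨-, hy, h, hne⟩ | ⟨i, j, -, rfl, -⟩)
    · rw [mem_pairLabels] at hx hy
      unfold partner
      split_ifs <;> lia
    · exact absurd hx (H.coreLabel_notMem_pairLabels _ _ _)
  · rintro rfl
    exact .inl ⟨hx, partner_mem_pairLabels hx⟩

theorem planted_deg_coreLabel (j : ℕ) : (H.planted σ).deg (H.coreLabel σ.2 j) = H.deg j := by
  rw [deg, deg, ← Finset.card_image_of_injective (H.nbrs j) (H.coreLabel_injective σ.2)]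
  congr 1
  ext y
  rw [mem_nbrs, planted_adj, Finset.mem_image]
  constructor
  · rintro (⟨h, -⟩ | ⟨i, i', hij, h, rfl⟩)
    · exact absurd h (H.coreLabel_notMem_pairLabels _ _ _)
    · rw [H.coreLabel_injective _ h]
      exact ⟨i', H.mem_nbrs.2 hij, rfl⟩
  · rintro ⟨i, hi, rfl⟩
    exact .inr ⟨j, i, H.mem_nbrs.1 hi, rfl, rfl⟩

theorem planted_deg_of_mem_pairLabels {x : ℕ} (hx : x ∈ pairLabels σ.1) :
    (H.planted σ).deg x = 1 := by
  rw [deg, planted_nbrs_of_mem_pairLabels H σ hx, Finset.card_singleton]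

theorem planted_m : (H.planted σ).m = σ.1.card + H.m := by
  have hpair : ∀ i ∈ σ.1, (H.planted σ).deg (3 * i) + (H.planted σ).deg (3 * i + 1) = 2 := by
    intro i hi
    rw [planted_deg_of_mem_pairLabels, planted_deg_of_mem_pairLabels]
    · rw [mem_pairLabels, show (3 * i + 1) / 3 = i by lia]
      exact ⟨hi, by lia⟩
    · rw [mem_pairLabels, show 3 * i / 3 = i by lia]
      exact ⟨hi, by lia⟩
  have hdeg := (H.planted σ).two_mul_m_eq_sum_deg
  rw [sum_planted_V, Finset.sum_congr rfl hpair] at hdeg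
  simp only [planted_deg_coreLabel, ← H.two_mul_m_eq_sum_deg, Finset.sum_const,
    smul_eq_mul] at hdeg
  lia

end InputGraph

/-- The set of vertices that a query mentions: the reply depends on the graph only through them,
unless the query is `randVert`. -/
def Query.mentioned : Query → Finset ℕ
  | .randVert => ∅
  | .randNbr x => {x}
  | .degree x => {x}
  | .pair x y => {x, y}
  | .additive S => S
  | .fullNbrHood x => {x}

theorem Query.card_mentioned_le (q : Query) : q.mentioned.card ≤ 2 * q.cost := by
  cases q with
  | pair x y => exact Finset.card_le_two
  | additive S => exact Nat.le_mul_of_pos_left _ two_pos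
  | _ => simp [mentioned, cost]

namespace InputGraph

variable {G G' : InputGraph}

theorem adj_congr {x : ℕ} (h : G.nbrs x = G'.nbrs x) (y : ℕ) :
    G.graph.Adj x y ↔ G'.graph.Adj x y := by
  rw [← G.mem_nbrs, h, G'.mem_nbrs]

theorem card_edgesIn_congr {S : Finset ℕ} (h : ∀ x ∈ S, G.nbrs x = G'.nbrs x) :
    (G.edgesIn S).card = (G'.edgesIn S).card := by
  classical
  have hcross : G.crossCount S S = G'.crossCount S S :=
    Finset.sum_congr rfl fun x hx => Finset.sum_congr rfl fun y _ =>
      if_congr (adj_congr (h x hx) y) rfl rfl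
  rw [crossCount_self, crossCount_self] at hcross
  exact Nat.eq_of_mul_eq_mul_left two_pos hcross

theorem reply_congr {q : Query} (hq : q ≠ .randVert)
    (hmem : ∀ x ∈ q.mentioned, x ∈ G.V ↔ x ∈ G'.V)
    (hnbrs : ∀ x ∈ q.mentioned, x ∈ G.V → G.nbrs x = G'.nbrs x) : G.reply q = G'.reply q := by
  cases q with
  | randVert => exact absurd rfl hq
  | randNbr x | degree x | fullNbrHood x =>
    have hx := hmem x (Finset.mem_singleton_self x)
    by_cases hG : x ∈ G.V
    · have hn := hnbrs x (Finset.mem_singleton_self x) hG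
      simp only [reply, hG, hx.1 hG, hn, ↓reduceDIte, ↓reduceIte]
    · simp only [reply, hG, mt hx.2 hG, ↓reduceDIte, ↓reduceIte]
  | pair x y =>
    have hpair : x ∈ G.V ∧ y ∈ G.V ↔ x ∈ G'.V ∧ y ∈ G'.V :=
      and_congr (hmem x (Finset.mem_insert_self _ _))
        (hmem y (Finset.mem_insert_of_mem (Finset.mem_singleton_self y)))
    by_cases hG : x ∈ G.V ∧ y ∈ G.V
    · have hadj := adj_congr (hnbrs x (Finset.mem_insert_self _ _) hG.1) y
      simp only [reply, if_pos hG, if_pos (hpair.1 hG)]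
      exact congrArg (fun b => PMF.pure (Reply.adjacent b)) (decide_eq_decide.2 hadj)
    · simp only [reply, if_neg hG, if_neg (mt hpair.2 hG)]
  | additive S =>
    have hS : S ⊆ G.V ↔ S ⊆ G'.V := forall₂_congr hmem
    by_cases hG : S ⊆ G.V
    · have hcard : (G.edgesIn S).card = (G'.edgesIn S).card :=
        card_edgesIn_congr fun x hx => hnbrs x hx (hG hx)
      simp only [reply, hG, hS.1 hG, hcard, ↓reduceIte]
    · simp only [reply, hG, mt hS.2 hG, ↓reduceIte]

end InputGraph

/-! ### Averages over the placements of a core and of pairs -/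

/-- `|a - b| ≤ ε`, without truncated subtractions. -/
def Approx (ε a b : ℝ≥0∞) : Prop := a ≤ b + ε ∧ b ≤ a + ε

namespace Approx

variable {ε δ a b c : ℝ≥0∞}

theorem refl (ε a : ℝ≥0∞) : Approx ε a a := ⟨le_self_add, le_self_add⟩

theorem symm (h : Approx ε a b) : Approx ε b a := ⟨h.2, h.1⟩

theorem trans (hab : Approx ε a b) (hbc : Approx δ b c) : Approx (ε + δ) a c := by
  refine ⟨(hab.1.trans (add_le_add_left hbc.1 ε)).trans_eq ?_,
    (hbc.2.trans (add_le_add_left hab.2 δ)).trans_eq (add_assoc a ε δ)⟩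
  rw [add_assoc, add_comm δ]

theorem mono (h : Approx ε a b) (hεδ : ε ≤ δ) : Approx δ a b :=
  ⟨h.1.trans (by gcongr), h.2.trans (by gcongr)⟩

theorem add {a' b' : ℝ≥0∞} (h : Approx ε a b) (h' : Approx δ a' b') :
    Approx (ε + δ) (a + a') (b + b') :=
  ⟨(add_le_add h.1 h'.1).trans_eq (add_add_add_comm _ _ _ _),
    (add_le_add h.2 h'.2).trans_eq (add_add_add_comm _ _ _ _)⟩

theorem mul_left (c : ℝ≥0∞) (h : Approx ε a b) : Approx (c * ε) (c * a) (c * b) := by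
  rw [Approx, ← mul_add, ← mul_add]
  exact ⟨mul_le_mul_right h.1 c, mul_le_mul_right h.2 c⟩

theorem expect {α : Type*} {p : PMF α} {f g : α → ℝ≥0∞} (h : ∀ a, Approx ε (f a) (g a)) :
    Approx ε (expect p f) (expect p g) := by
  have hε := expect_const p ε
  constructor <;> rw [← hε, ← expect_add]
  · exact expect_mono fun a => (h a).1
  · exact expect_mono fun a => (h a).2

end Approx

/-- The average of a function over a finite set; it is `0` if the set is empty. -/
noncomputable def avgOn {ι : Type*} (S : Finset ι) (f : ι → ℝ≥0∞) : ℝ≥0∞ :=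
  (S.card : ℝ≥0∞)⁻¹ * ∑ i ∈ S, f i

namespace avgOn

variable {ι : Type*} {S : Finset ι} {f g : ι → ℝ≥0∞}

theorem mono (h : ∀ i ∈ S, f i ≤ g i) : avgOn S f ≤ avgOn S g :=
  mul_le_mul_right (Finset.sum_le_sum h) _

theorem congr (h : ∀ i ∈ S, f i = g i) : avgOn S f = avgOn S g := by
  rw [avgOn, Finset.sum_congr rfl h, avgOn]

theorem add : (avgOn S fun i => f i + g i) = avgOn S f + avgOn S g := by
  rw [avgOn, Finset.sum_add_distrib, mul_add, avgOn, avgOn]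

theorem mul_left (c : ℝ≥0∞) : (avgOn S fun i => c * f i) = c * avgOn S f := by
  rw [avgOn, ← Finset.mul_sum, mul_left_comm, avgOn]

theorem sum_comm {κ : Type*} (T : Finset κ) (f : κ → ι → ℝ≥0∞) :
    (avgOn S fun i => ∑ a ∈ T, f a i) = ∑ a ∈ T, avgOn S (f a) := by
  simp only [avgOn, Finset.mul_sum]
  exact Finset.sum_comm

theorem expect_comm {α : Type*} (p : PMF α) (f : ι → α → ℝ≥0∞) :
    (avgOn S fun i => expect p (f i)) = expect p fun a => avgOn S fun i => f i a := by
  simp only [avgOn, expect_mul_left, expect_sum]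

theorem const (hS : S.Nonempty) (c : ℝ≥0∞) : (avgOn S fun _ => c) = c := by
  rw [avgOn, Finset.sum_const, nsmul_eq_mul, ← mul_assoc, ENNReal.inv_mul_cancel, one_mul]
  · exact Nat.cast_ne_zero.2 hS.card_pos.ne'
  · exact ENNReal.natCast_ne_top _

theorem zero : (avgOn S fun _ => 0) = 0 := by
  rw [avgOn, Finset.sum_const_zero, mul_zero]

theorem le_of_le {c : ℝ≥0∞} (h : ∀ i ∈ S, f i ≤ c) : avgOn S f ≤ c := by
  rcases S.eq_empty_or_nonempty with rfl | hS
  · simp [avgOn]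
  · exact (mono h).trans_eq (const hS c)

theorem approx {ε : ℝ≥0∞} (h : ∀ i ∈ S, Approx ε (f i) (g i)) :
    Approx ε (avgOn S f) (avgOn S g) := by
  have hε : avgOn S (fun _ => ε) ≤ ε := le_of_le fun _ _ => le_rfl
  constructor <;> refine le_trans ?_ (add_le_add_right hε _) <;> rw [← add]
  · exact mono fun i hi => (h i hi).1
  · exact mono fun i hi => (h i hi).2

theorem approx_of_eq_or_one_le {w : ι → ℝ≥0∞} (hf : ∀ i, f i ≤ 1) (hg : ∀ i, g i ≤ 1)
    (h : ∀ i ∈ S, f i = g i ∨ 1 ≤ w i) : Approx (avgOn S w) (avgOn S f) (avgOn S g) := by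
  constructor <;> rw [← add] <;> refine mono fun i hi => ?_ <;> rcases h i hi with heq | hw
  · exact heq.trans_le le_self_add
  · exact ((hf i).trans hw).trans le_add_self
  · exact heq.symm.trans_le le_self_add
  · exact ((hg i).trans hw).trans le_add_self

end avgOn

/-- The positions of a core and of `p` pairs in a space of size `N`, where the pairs with indices
in `K` are known to be present. -/
def placements (N p : ℕ) (K : Finset ℕ) : Finset (Finset ℕ × ℕ) :=
  {I ∈ (Finset.range N).powersetCard p | K ⊆ I} ×ˢ Finset.range N

section placements

variable {N p i : ℕ} {K : Finset ℕ}

theorem mem_placements {σ : Finset ℕ × ℕ} :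
    σ ∈ placements N p K ↔ ((σ.1 ⊆ Finset.range N ∧ σ.1.card = p) ∧ K ⊆ σ.1) ∧ σ.2 < N := by
  rw [placements, Finset.mem_product, Finset.mem_filter, Finset.mem_powersetCard, Finset.mem_range]

theorem card_powersetCard_filter_superset {α : Type*} [DecidableEq α] {K S : Finset α} {p : ℕ}
    (hK : K ⊆ S) (hp : K.card ≤ p) :
    ({I ∈ S.powersetCard p | K ⊆ I} : Finset _).card =
      (S.card - K.card).choose (p - K.card) := by
  rw [← Finset.card_sdiff_of_subset hK, ← Finset.card_powersetCard]
  refine Finset.card_bij' (fun I _ => I \ K) (fun J _ => J ∪ K) ?_ ?_ ?_ ?_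
  · intro I hI
    rw [Finset.mem_filter, Finset.mem_powersetCard] at hI
    rw [Finset.mem_powersetCard, Finset.card_sdiff_of_subset hI.2, hI.1.2]
    exact ⟨Finset.sdiff_subset_sdiff hI.1.1 subset_rfl, rfl⟩
  · intro J hJ
    rw [Finset.mem_powersetCard, Finset.subset_sdiff] at hJ
    rw [Finset.mem_filter, Finset.mem_powersetCard, Finset.card_union_of_disjoint hJ.1.2, hJ.2]
    exact ⟨⟨Finset.union_subset hJ.1.1 hK, by lia⟩, Finset.subset_union_right⟩
  · intro I hI
    exact Finset.sdiff_union_of_subset (Finset.mem_filter.1 hI).2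
  · intro J hJ
    rw [Finset.mem_powersetCard] at hJ
    exact Finset.union_sdiff_cancel_right (Finset.subset_sdiff.1 hJ.1).2

theorem card_placements (hK : K ⊆ Finset.range N) (hp : K.card ≤ p) :
    (placements N p K).card = (N - K.card).choose (p - K.card) * N := by
  rw [placements, Finset.card_product, card_powersetCard_filter_superset hK hp, Finset.card_range]

theorem placements_nonempty (hK : K ⊆ Finset.range N) (hp : K.card ≤ p) (hpN : p < N) :
    (placements N p K).Nonempty := by
  rw [← Finset.card_pos, card_placements hK hp]
  exact Nat.mul_pos (Nat.choose_pos (by lia)) (by lia)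

theorem placements_insert : placements N p (insert i K) = {σ ∈ placements N p K | i ∈ σ.1} := by
  ext σ
  rw [Finset.mem_filter, mem_placements, mem_placements, Finset.insert_subset_iff]
  tauto

theorem placements_eq_empty (hp : p < K.card) : placements N p K = ∅ := by
  refine Finset.eq_empty_of_forall_notMem fun σ hσ => ?_
  rw [mem_placements] at hσ
  have hcard := Finset.card_le_card hσ.1.2
  lia

theorem card_placements_insert (hK : K ⊆ Finset.range N) (hp : K.card ≤ p) (hi : i ∉ K)
    (hiN : i < N) :
    (placements N p (insert i K)).card * (N - K.card) = (placements N p K).card * (p - K.card) := by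
  have hK' : insert i K ⊆ Finset.range N := Finset.insert_subset (Finset.mem_range.2 hiN) hK
  have hcard : (insert i K).card = K.card + 1 := Finset.card_insert_of_notMem hi
  have hKN : K.card + 1 ≤ N := by
    rw [← hcard, ← Finset.card_range N]
    exact Finset.card_le_card hK'
  rcases hp.eq_or_lt with rfl | hlt
  · rw [placements_eq_empty (by lia), Finset.card_empty, Nat.sub_self, zero_mul, mul_zero]
  · rw [card_placements hK hp, card_placements hK' (by lia), hcard]
    obtain ⟨a, ha⟩ := Nat.exists_eq_add_of_le hKN
    obtain ⟨b, hb⟩ := Nat.exists_eq_add_of_lt hlt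
    rw [show N - (K.card + 1) = a by lia, show p - (K.card + 1) = b by lia,
      show N - K.card = a + 1 by lia, show p - K.card = b + 1 by lia]
    linear_combination N * Nat.add_one_mul_choose_eq a b

open Classical in
theorem avgOn_placements_ite_mem (hK : K ⊆ Finset.range N) (hp : K.card ≤ p) (hpN : p < N)
    (hi : i ∉ K) (hiN : i < N) (f : Finset ℕ × ℕ → ℝ≥0∞) :
    (avgOn (placements N p K) fun σ => if i ∈ σ.1 then f σ else 0) =
      ((p - K.card : ℕ) : ℝ≥0∞) / ((N - K.card : ℕ) : ℝ≥0∞) *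
        avgOn (placements N p (insert i K)) f := by
  have hcard := card_placements_insert hK hp hi hiN
  rw [avgOn, avgOn, ← Finset.sum_filter, show Finset.filter _ _ = placements N p (insert i K) by
    rw [placements_insert]]
  rcases (placements N p (insert i K)).eq_empty_or_nonempty with hempty | hne
  · simp [hempty]
  rw [← mul_assoc]
  congr 1
  have hold := (placements_nonempty hK hp hpN).card_pos.ne'
  have hnew := hne.card_pos.ne'
  generalize (placements N p (insert i K)).card = a at *
  generalize (placements N p K).card = b at *
  have hN0 : ((N - K.card : ℕ) : ℝ≥0∞) ≠ 0 := Nat.cast_ne_zero.2 (by lia)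
  have hcard' : (a : ℝ≥0∞) * (N - K.card : ℕ) = b * (p - K.card : ℕ) := by exact_mod_cast hcard
  rw [← div_eq_mul_inv, ENNReal.eq_div_iff (Nat.cast_ne_zero.2 hnew) (ENNReal.natCast_ne_top _),
    ENNReal.eq_div_iff hN0 (ENNReal.natCast_ne_top _), ← mul_assoc,
    mul_comm ((N - K.card : ℕ) : ℝ≥0∞), hcard', mul_right_comm,
    ENNReal.mul_inv_cancel (Nat.cast_ne_zero.2 hold) (ENNReal.natCast_ne_top _), one_mul]

theorem avgOn_placements_sum (hK : K ⊆ Finset.range N) (hp : K.card ≤ p) (hpN : p < N)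
    (f : ℕ → Finset ℕ × ℕ → ℝ≥0∞) :
    (avgOn (placements N p K) fun σ => ∑ i ∈ σ.1, f i σ) =
      (p - K.card : ℕ) * avgOn (Finset.range N \ K)
          (fun i => avgOn (placements N p (insert i K)) (f i)) +
        avgOn (placements N p K) fun σ => ∑ i ∈ K, f i σ := by
  classical
  have hsplit : ∀ σ ∈ placements N p K, ∑ i ∈ σ.1, f i σ =
      (∑ i ∈ Finset.range N \ K, if i ∈ σ.1 then f i σ else 0) + ∑ i ∈ K, f i σ := by
    intro σ hσ
    rw [← Finset.sum_filter, ← Finset.sum_sdiff (mem_placements.1 hσ).1.2]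
    congr 2
    ext i
    have hN := @(mem_placements.1 hσ).1.1.1 i
    simp only [Finset.mem_sdiff, Finset.mem_filter]
    tauto
  have hterm : ∀ i ∈ Finset.range N \ K,
      (avgOn (placements N p K) fun σ => if i ∈ σ.1 then f i σ else 0) =
        ((p - K.card : ℕ) : ℝ≥0∞) / ((N - K.card : ℕ) : ℝ≥0∞) *
          avgOn (placements N p (insert i K)) (f i) := by
    intro i hi
    rw [Finset.mem_sdiff, Finset.mem_range] at hi
    exact avgOn_placements_ite_mem hK hp hpN hi.2 hi.1 _
  rw [avgOn.congr hsplit, avgOn.add, avgOn.sum_comm, Finset.sum_congr rfl hterm, ← Finset.mul_sum]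
  congr 1
  rw [avgOn, Finset.card_sdiff_of_subset hK, Finset.card_range, div_eq_mul_inv, mul_assoc]

end placements

/-! ### The replies for a random placement hardly depend on the core -/

theorem natCast_div_le_natCast_div {a b c d : ℕ} (hd : 0 < d) (h : a * d ≤ c * b) :
    (a : ℝ≥0∞) / b ≤ c / d := by
  refine ENNReal.div_le_of_le_mul ?_
  rw [← ENNReal.mul_div_right_comm, ENNReal.le_div_iff_mul_le
    (.inl (Nat.cast_ne_zero.2 hd.ne')) (.inl (ENNReal.natCast_ne_top _))]
  exact_mod_cast h

theorem pairLabels_mono {I J : Finset ℕ} (h : I ⊆ J) : pairLabels I ⊆ pairLabels J :=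
  Finset.biUnion_subset_biUnion_of_subset_left _ h

section mem_planted

variable {N p : ℕ} {K : Finset ℕ}

open Classical in
theorem avgOn_placements_mem_le (hK : K ⊆ Finset.range N) (hp : K.card ≤ p) (hpN : p < N) {i : ℕ}
    (hi : i ∉ K) :
    (avgOn (placements N p K) fun σ => if i ∈ σ.1 then 1 else 0) ≤ ((p + 1 : ℕ) : ℝ≥0∞) / N := by
  by_cases hiN : i < N
  · rw [avgOn_placements_ite_mem hK hp hpN hi hiN]
    refine (mul_le_of_le_one_right' (avgOn.le_of_le fun _ _ => le_rfl)).trans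
      (natCast_div_le_natCast_div (by lia) ?_)
    obtain ⟨a, rfl⟩ := Nat.exists_eq_add_of_le hp
    obtain ⟨b, rfl⟩ := Nat.exists_eq_add_of_lt hpN
    rw [show K.card + a - K.card = a by lia, show K.card + a + b + 1 - K.card = a + b + 1 by lia]
    nlinarith
  · refine avgOn.le_of_le fun σ hσ => ?_
    rw [if_neg fun h => hiN (Finset.mem_range.1 ((mem_placements.1 hσ).1.1.1 h))]
    exact zero_le

theorem avgOn_placements_snd_eq_le (hK : K ⊆ Finset.range N) (hp : K.card ≤ p) (hpN : p < N)
    (s : ℕ) :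
    (avgOn (placements N p K) fun σ => if σ.2 = s then 1 else 0) ≤ ((p + 1 : ℕ) : ℝ≥0∞) / N := by
  have hcard := card_powersetCard_filter_superset hK hp
  rw [Finset.card_range] at hcard
  rw [avgOn, card_placements hK hp, placements, Finset.sum_product]
  simp only [Finset.sum_ite_eq', Finset.sum_const, hcard, nsmul_eq_mul]
  rw [← ENNReal.div_eq_inv_mul]
  split_ifs
  · rw [mul_one]
    exact natCast_div_le_natCast_div (by lia) (Nat.le_mul_of_pos_left _ p.succ_pos)
  · simp

theorem mem_planted_imp {H : InputGraph} (hH : H.V = Finset.range H.n) {σ : Finset ℕ × ℕ} {x : ℕ}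
    (hx : x ∈ (H.planted σ).V) :
    x % 3 < 2 ∧ x / 3 ∈ σ.1 ∨ ¬ x % 3 < 2 ∧ σ.2 = x / 3 / H.n := by
  rw [H.planted_V, Finset.mem_union, mem_pairLabels] at hx
  rcases hx with hx | hx
  · exact .inl hx.symm
  · obtain ⟨j, hj, rfl⟩ := Finset.mem_image.1 hx
    rw [hH, Finset.mem_range] at hj
    refine .inr ⟨by unfold InputGraph.coreLabel; lia, ?_⟩
    rw [InputGraph.coreLabel, show (3 * (H.n * σ.2 + j) + 2) / 3 = H.n * σ.2 + j by lia,
      Nat.mul_add_div H.n_pos, Nat.div_eq_of_lt hj, add_zero]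

open Classical in
theorem avgOn_placements_mem_planted_le (hK : K ⊆ Finset.range N) (hp : K.card ≤ p) (hpN : p < N)
    {H : InputGraph} (hH : H.V = Finset.range H.n) {x : ℕ} (hx : x ∉ pairLabels K) :
    (avgOn (placements N p K) fun σ => if x ∈ (H.planted σ).V then 1 else 0) ≤
      ((p + 1 : ℕ) : ℝ≥0∞) / N := by
  by_cases hpair : x % 3 < 2
  · refine le_trans (avgOn.mono fun σ _ => ?_) (avgOn_placements_mem_le hK hp hpN
      fun h => hx (mem_pairLabels.2 ⟨h, hpair⟩))
    refine ite_one_zero_mono fun h => ?_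
    exact ((mem_planted_imp hH h).resolve_right fun h' => h'.1 hpair).2
  · refine le_trans (avgOn.mono fun σ _ => ?_)
      (avgOn_placements_snd_eq_le hK hp hpN (x / 3 / H.n))
    refine ite_one_zero_mono fun h => ?_
    exact ((mem_planted_imp hH h).resolve_left fun h' => hpair h'.1).2

end mem_planted

namespace InputGraph

variable (H : InputGraph)

/-- The reply to a query when only the pairs with indices in `K` are known: the core is put beyond
all labels that the query mentions. -/
noncomputable def knownReply (K : Finset ℕ) (q : Query) : PMF Reply :=
  (H.planted (K, q.mentioned.sup id)).reply q

theorem notMem_planted_sup {K S : Finset ℕ} {x : ℕ} (hx : x ∈ S) (hxK : x ∉ pairLabels K) :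
    x ∉ (H.planted (K, S.sup id)).V := by
  rw [planted_V, Finset.mem_union, not_or]
  refine ⟨hxK, fun hcore => ?_⟩
  obtain ⟨j, -, hj⟩ := Finset.mem_image.1 hcore
  have hxS : x ≤ S.sup id := Finset.le_sup (f := id) hx
  have hsup : S.sup id ≤ H.n * S.sup id := Nat.le_mul_of_pos_left _ H.n_pos
  simp only [coreLabel] at hj
  lia

theorem reply_planted_eq_knownReply {H' : InputGraph} {K : Finset ℕ} {σ : Finset ℕ × ℕ}
    (hσ : K ⊆ σ.1) {q : Query} (hq : q ≠ .randVert)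
    (h : ∀ x ∈ q.mentioned, x ∉ pairLabels K → x ∉ (H'.planted σ).V) :
    (H'.planted σ).reply q = H.knownReply K q := by
  refine reply_congr hq (fun x hx => ?_) (fun x hx hV => ?_)
  · by_cases hxK : x ∈ pairLabels K
    · exact iff_of_true (Finset.mem_union_left _ (pairLabels_mono hσ hxK))
        (Finset.mem_union_left _ hxK)
    · exact iff_of_false (h x hx hxK) (H.notMem_planted_sup hx hxK)
  · by_cases hxK : x ∈ pairLabels K
    · rw [planted_nbrs_of_mem_pairLabels _ _ (pairLabels_mono hσ hxK),
        planted_nbrs_of_mem_pairLabels H (K, _) hxK]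
    · exact absurd hV (h x hx hxK)

theorem approx_avgOn_reply_planted {H' : InputGraph} (hH' : H'.V = Finset.range H'.n) {N p : ℕ}
    {K : Finset ℕ} (hK : K ⊆ Finset.range N) (hp : K.card ≤ p) (hpN : p < N) {q : Query}
    (hq : q ≠ .randVert) {g : Finset ℕ × ℕ → Reply → ℝ≥0∞} (hg : ∀ σ r, g σ r ≤ 1) :
    Approx (q.cost * (2 * (((p + 1 : ℕ) : ℝ≥0∞) / N)))
      (avgOn (placements N p K) fun σ => expect ((H'.planted σ).reply q) (g σ))
      (expect (H.knownReply K q) fun r => avgOn (placements N p K) fun σ => g σ r) := by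
  classical
  set guessed : Finset ℕ × ℕ → ℝ≥0∞ := fun σ =>
    ∑ x ∈ q.mentioned with x ∉ pairLabels K, if x ∈ (H'.planted σ).V then 1 else 0
  have hguessed : avgOn (placements N p K) guessed ≤
      q.cost * (2 * (((p + 1 : ℕ) : ℝ≥0∞) / N)) := by
    rw [avgOn.sum_comm]
    refine (Finset.sum_le_card_nsmul _ _ _ fun x hx =>
      avgOn_placements_mem_planted_le hK hp hpN hH' (Finset.mem_filter.1 hx).2).trans ?_
    rw [nsmul_eq_mul, ← mul_assoc, mul_comm (q.cost : ℝ≥0∞)]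
    gcongr
    exact_mod_cast (Finset.card_filter_le _ _).trans q.card_mentioned_le
  rw [← avgOn.expect_comm]
  refine (avgOn.approx_of_eq_or_one_le (fun σ => expect_le_of_le (hg σ))
    (fun σ => expect_le_of_le (hg σ)) fun σ hσ => ?_).mono hguessed
  by_cases h : ∀ x ∈ q.mentioned, x ∉ pairLabels K → x ∉ (H'.planted σ).V
  · rw [H.reply_planted_eq_knownReply (mem_placements.1 hσ).1.2 hq h]
    exact .inl rfl
  · push Not at h
    obtain ⟨x, hx, hxK, hV⟩ := h
    refine .inr (le_trans (by rw [if_pos hV]) (Finset.single_le_sum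
      (f := fun x => if x ∈ (H'.planted σ).V then (1 : ℝ≥0∞) else 0) (fun _ _ => zero_le)
      (Finset.mem_filter.2 ⟨hx, hxK⟩)))

end InputGraph

/-- The average of `g` over a uniformly random pair with index outside of `K`, a random placement
that contains this pair, and a random vertex of the pair. -/
noncomputable def freshVertexMean (N p : ℕ) (K : Finset ℕ) (g : Finset ℕ × ℕ → Reply → ℝ≥0∞) :
    ℝ≥0∞ :=
  avgOn (Finset.range N \ K) fun i => avgOn (placements N p (insert i K)) fun σ =>
    2⁻¹ * (g σ (.vertex (3 * i)) + g σ (.vertex (3 * i + 1)))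

theorem inv_two_mul_add_le {a b c : ℝ≥0∞} (ha : a ≤ c) (hb : b ≤ c) : 2⁻¹ * (a + b) ≤ c := by
  refine (mul_le_mul_right (add_le_add ha hb) _).trans_eq ?_
  rw [← two_mul, ENNReal.inv_mul_cancel_left' (by simp) (by simp)]

theorem freshVertexMean_le_one {N p : ℕ} {K : Finset ℕ} {g : Finset ℕ × ℕ → Reply → ℝ≥0∞}
    (hg : ∀ σ r, g σ r ≤ 1) : freshVertexMean N p K g ≤ 1 :=
  avgOn.le_of_le fun _ _ => avgOn.le_of_le fun σ _ => inv_two_mul_add_le (hg σ _) (hg σ _)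

theorem approx_inv_mul_add {a b n : ℕ} (hn : 0 < n) (hab : a + b = n) {W R : ℝ≥0∞} (hW : W ≤ 1)
    (hR : R ≤ b) : Approx ((b : ℝ≥0∞) / n) ((n : ℝ≥0∞)⁻¹ * (a * W + R)) W := by
  have hone : (n : ℝ≥0∞)⁻¹ * a + (n : ℝ≥0∞)⁻¹ * b = 1 := by
    rw [← mul_add, ← Nat.cast_add, hab,
      ENNReal.inv_mul_cancel (Nat.cast_ne_zero.2 hn.ne') (ENNReal.natCast_ne_top _)]
  rw [Approx, ENNReal.div_eq_inv_mul, mul_add, ← mul_assoc]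
  constructor
  · gcongr
    exact mul_le_of_le_one_left' (le_self_add.trans_eq hone)
  · calc W = (n : ℝ≥0∞)⁻¹ * a * W + (n : ℝ≥0∞)⁻¹ * b * W := by rw [← add_mul, hone, one_mul]
      _ ≤ (n : ℝ≥0∞)⁻¹ * a * W + (n : ℝ≥0∞)⁻¹ * R + (n : ℝ≥0∞)⁻¹ * b :=
        add_le_add le_self_add (mul_le_of_le_one_right' hW)

namespace InputGraph

variable (H : InputGraph) {N p : ℕ} {K : Finset ℕ} {g : Finset ℕ × ℕ → Reply → ℝ≥0∞}

theorem expect_reply_randVert_planted (σ : Finset ℕ × ℕ) (f : Reply → ℝ≥0∞) :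
    expect ((H.planted σ).reply .randVert) f =
      ((H.n + 2 * σ.1.card : ℕ) : ℝ≥0∞)⁻¹ *
        (∑ i ∈ σ.1, (f (.vertex (3 * i)) + f (.vertex (3 * i + 1))) +
          ∑ j ∈ H.V, f (.vertex (H.coreLabel σ.2 j))) := by
  rw [reply, expect_map, expect_uniformOfFinset, add_comm H.n, ← H.planted_n σ,
    ← H.sum_planted_V σ fun x => f (.vertex x)]
  rfl

theorem avgOn_randVert_planted_eq (hK : K ⊆ Finset.range N) (hp : K.card ≤ p) (hpN : p < N)
    (hg : ∀ σ r, g σ r ≤ 1) : ∃ R : ℝ≥0∞, R ≤ (H.n + 2 * K.card : ℕ) ∧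
      (avgOn (placements N p K) fun σ => expect ((H.planted σ).reply .randVert) (g σ)) =
        ((H.n + 2 * p : ℕ) : ℝ≥0∞)⁻¹ * ((2 * (p - K.card) : ℕ) * freshVertexMean N p K g + R) := by
  set ends : ℕ → Finset ℕ × ℕ → ℝ≥0∞ := fun i σ =>
    g σ (.vertex (3 * i)) + g σ (.vertex (3 * i + 1))
  refine ⟨(avgOn (placements N p K) fun σ => ∑ i ∈ K, ends i σ) +
    avgOn (placements N p K) fun σ => ∑ j ∈ H.V, g σ (.vertex (H.coreLabel σ.2 j)), ?_, ?_⟩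
  · rw [add_comm, Nat.cast_add]
    refine add_le_add (avgOn.le_of_le fun σ _ => ?_) (avgOn.le_of_le fun σ _ => ?_)
    · refine (Finset.sum_le_card_nsmul _ _ 1 fun j _ => hg σ _).trans_eq ?_
      rw [nsmul_one, n]
    · refine (Finset.sum_le_card_nsmul _ _ 2 fun i _ =>
        (add_le_add (hg σ _) (hg σ _)).trans_eq one_add_one_eq_two).trans_eq ?_
      rw [nsmul_eq_mul, mul_comm, Nat.cast_mul, Nat.cast_two]
  · have hfresh : ((2 * (p - K.card) : ℕ) : ℝ≥0∞) * freshVertexMean N p K g =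
        (p - K.card : ℕ) * avgOn (Finset.range N \ K)
          (fun i => avgOn (placements N p (insert i K)) (ends i)) := by
      simp only [freshVertexMean, avgOn.mul_left]
      rw [mul_comm 2, Nat.cast_mul, Nat.cast_two, mul_assoc,
        ENNReal.mul_inv_cancel_left' (by simp) (by simp)]
    rw [hfresh, ← add_assoc, ← avgOn_placements_sum hK hp hpN, ← avgOn.add, ← avgOn.mul_left]
    refine avgOn.congr fun σ hσ => ?_
    rw [expect_reply_randVert_planted, (mem_placements.1 hσ).1.1.2]

theorem approx_avgOn_randVert_planted {Q : ℕ} (hK : K ⊆ Finset.range N) (hp : K.card ≤ p)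
    (hpN : p < N) (hQ : K.card ≤ Q) (hg : ∀ σ r, g σ r ≤ 1) :
    Approx (((H.n + 2 * Q : ℕ) : ℝ≥0∞) / (H.n + 2 * p : ℕ))
      (avgOn (placements N p K) fun σ => expect ((H.planted σ).reply .randVert) (g σ))
      (freshVertexMean N p K g) := by
  obtain ⟨R, hR, heq⟩ := H.avgOn_randVert_planted_eq hK hp hpN hg
  have hn : 0 < H.n + 2 * p := by
    have := H.n_pos
    lia
  rw [heq]
  refine (approx_inv_mul_add hn (by lia) (freshVertexMean_le_one hg) hR).mono ?_
  gcongr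

end InputGraph

/-! ### Different cores are hard to distinguish -/

/-- What can be learned by one query about a core with `r` vertices that is hidden among `p` pairs
in a space of size `N` when at most `Q` pairs are known: the first term is the probability that
`RandVert` returns a vertex of the core or of a known pair, and the second one bounds the
probability that a given label outside of the known pairs is a vertex. -/
noncomputable def queryLoss (Q N r p : ℕ) : ℝ≥0∞ :=
  ((r + 2 * Q : ℕ) : ℝ≥0∞) / (r + 2 * p : ℕ) + 2 * (((p + 1 : ℕ) : ℝ≥0∞) / N)

section distinguish

variable {H H' : InputGraph} {N p p' Q : ℕ} {δ : ℝ≥0∞}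

theorem Approx.freshVertexMean {K : Finset ℕ} {g g' : Finset ℕ × ℕ → Reply → ℝ≥0∞}
    (h : ∀ i ∈ Finset.range N \ K, ∀ r, Approx δ
      (avgOn (placements N p (insert i K)) fun σ => g σ r)
      (avgOn (placements N p' (insert i K)) fun σ => g' σ r)) :
    Approx δ (freshVertexMean N p K g) (freshVertexMean N p' K g') := by
  refine avgOn.approx fun i hi => ?_
  rw [avgOn.mul_left, avgOn.mul_left, avgOn.add, avgOn.add]
  exact (((h i hi _).add (h i hi _)).mul_left 2⁻¹).mono (inv_two_mul_add_le le_rfl le_rfl)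

theorem approx_avgOn_reply_planted_planted (hH : H.V = Finset.range H.n)
    (hH' : H'.V = Finset.range H'.n) (hpN : p < N) (hpN' : p' < N) {K : Finset ℕ}
    (hK : K ⊆ Finset.range N) (hp : K.card ≤ p) (hp' : K.card ≤ p') (hQ : K.card ≤ Q) {q : Query}
    {g g' : Finset ℕ × ℕ → Reply → ℝ≥0∞} (hg : ∀ σ r, g σ r ≤ 1) (hg' : ∀ σ r, g' σ r ≤ 1)
    (h : ∀ K' ⊆ Finset.range N, K'.card ≤ K.card + q.cost → ∀ r, Approx δ
      (avgOn (placements N p K') fun σ => g σ r) (avgOn (placements N p' K') fun σ => g' σ r)) :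
    Approx (δ + q.cost * (queryLoss Q N H.n p + queryLoss Q N H'.n p'))
      (avgOn (placements N p K) fun σ => expect ((H.planted σ).reply q) (g σ))
      (avgOn (placements N p' K) fun σ => expect ((H'.planted σ).reply q) (g' σ)) := by
  have hcost : δ + q.cost * (queryLoss Q N H.n p + queryLoss Q N H'.n p') =
      q.cost * queryLoss Q N H.n p + δ + q.cost * queryLoss Q N H'.n p' := by ring
  rw [hcost]
  by_cases hq : q = .randVert
  · subst hq
    have hfresh : Approx δ (freshVertexMean N p K g) (freshVertexMean N p' K g') := by
      refine .freshVertexMean fun i hi => ?_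
      rw [Finset.mem_sdiff] at hi
      exact h _ (Finset.insert_subset hi.1 hK) (Finset.card_insert_le _ _)
    have hcost1 : ((Query.randVert.cost : ℕ) : ℝ≥0∞) = 1 := Nat.cast_one
    rw [hcost1, one_mul, one_mul]
    exact (((H.approx_avgOn_randVert_planted hK hp hpN hQ hg).mono le_self_add).trans hfresh).trans
      ((H'.approx_avgOn_randVert_planted hK hp' hpN' hQ hg').mono le_self_add).symm
  · have hknown : Approx δ
        (expect (H.knownReply K q) fun r => avgOn (placements N p K) fun σ => g σ r)
        (expect (H.knownReply K q) fun r => avgOn (placements N p' K) fun σ => g' σ r) :=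
      .expect (h K hK (Nat.le_add_right _ _))
    have hleft := H.approx_avgOn_reply_planted hH hK hp hpN hq hg
    have hright := H.approx_avgOn_reply_planted hH' hK hp' hpN' hq hg'
    exact ((hleft.mono (mul_le_mul_right le_add_self _)).trans hknown).trans
      (hright.mono (mul_le_mul_right le_add_self _)).symm

end distinguish

namespace Algorithm

variable (A : Algorithm)

theorem value_le_one (G : InputGraph) {φ : A.Config → ℝ≥0∞} (hφ : ∀ c, φ c ≤ 1) (t : ℕ)
    (c : A.Config) : A.value G φ t c ≤ 1 := by
  induction t generalizing c with
  | zero => exact hφ c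
  | succ t ih => exact expect_le_of_le ih

theorem value_eq_zero (G : InputGraph) {φ : A.Config → ℝ≥0∞} {Q : ℕ}
    (hφ : ∀ c, Q ≤ c.2 → φ c = 0) (t : ℕ) (x : A.State ⊕ ℝ) {k : ℕ} (hk : Q ≤ k) :
    A.value G φ t (x, k) = 0 := by
  induction t generalizing x k with
  | zero => exact hφ _ hk
  | succ t ih =>
    rcases x with s | v
    · rw [value_succ_inl, ← expect_const (A.step s) 0]
      congr 1
      funext a
      rcases a with v | ⟨q, f⟩
      · exact ih _ hk
      · simp only [ih _ (hk.trans (Nat.le_add_right k q.cost)), expect_const]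
    · rw [value_inr]
      exact hφ _ hk

theorem approx_avgOn_value_const {φ : A.Config → ℝ≥0∞} {Q : ℕ} (hφQ : ∀ c, Q ≤ c.2 → φ c = 0)
    {N p p' : ℕ} (hp : Q ≤ p + 1) (hp' : Q ≤ p' + 1) (hpN : p < N) (hpN' : p' < N)
    {K : Finset ℕ} {k : ℕ} (hK : K ⊆ Finset.range N) (hk : K.card ≤ k) (x : A.State ⊕ ℝ)
    (ε : ℝ≥0∞) :
    Approx ε (avgOn (placements N p K) fun _ => φ (x, k))
      (avgOn (placements N p' K) fun _ => φ (x, k)) := by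
  by_cases hkQ : Q ≤ k
  · rw [hφQ (x, k) hkQ, avgOn.zero, avgOn.zero]
    exact .refl _ _
  · rw [avgOn.const (placements_nonempty hK (by lia) hpN),
      avgOn.const (placements_nonempty hK (by lia) hpN')]
    exact .refl _ _

theorem approx_avgOn_value {φ : A.Config → ℝ≥0∞} (hφ : ∀ c, φ c ≤ 1) {Q : ℕ}
    (hφQ : ∀ c, Q ≤ c.2 → φ c = 0) {H H' : InputGraph} (hH : H.V = Finset.range H.n)
    (hH' : H'.V = Finset.range H'.n) {N p p' : ℕ} (hp : Q ≤ p + 1) (hp' : Q ≤ p' + 1)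
    (hpN : p < N) (hpN' : p' < N) (t : ℕ) (x : A.State ⊕ ℝ) {K : Finset ℕ} {k : ℕ}
    (hK : K ⊆ Finset.range N) (hk : K.card ≤ k) :
    Approx ((Q - 1 - k : ℕ) * (queryLoss Q N H.n p + queryLoss Q N H'.n p'))
      (avgOn (placements N p K) fun σ => A.value (H.planted σ) φ t (x, k))
      (avgOn (placements N p' K) fun σ => A.value (H'.planted σ) φ t (x, k)) := by
  induction t generalizing x K k with
  | zero => exact A.approx_avgOn_value_const hφQ hp hp' hpN hpN' hK hk x _
  | succ t ih =>
    rcases x with s | v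
    swap
    · simp only [value_inr]
      exact A.approx_avgOn_value_const hφQ hp hp' hpN hpN' hK hk (.inr v) _
    simp only [value_succ_inl]
    rw [avgOn.expect_comm, avgOn.expect_comm]
    refine .expect fun a => ?_
    rcases a with v | ⟨q, f⟩
    · exact ih (.inr v) hK hk
    by_cases hkq : Q ≤ k + q.cost
    · simp only [A.value_eq_zero _ hφQ _ _ hkq, expect_const, avgOn.zero]
      exact .refl _ _
    · rw [show Q - 1 - k = Q - 1 - (k + q.cost) + q.cost by lia, Nat.cast_add, add_mul]
      exact approx_avgOn_reply_planted_planted hH hH' hpN hpN' hK (by lia) (by lia) (by lia)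
        (fun σ r => A.value_le_one _ hφ _ _) (fun σ r => A.value_le_one _ hφ _ _)
        fun K' hK' hcard r => ih (.inl (f r)) hK' (hcard.trans (Nat.add_le_add_right hk _))

end Algorithm

/-! ### The lower bound -/

theorem mk_mem_image_offDiag {α : Type*} [DecidableEq α] {S : Finset α} {x y : α} :
    s(x, y) ∈ S.offDiag.image Sym2.mk.uncurry ↔ x ∈ S ∧ y ∈ S ∧ x ≠ y := by
  rw [Finset.mem_image]
  constructor
  · rintro ⟨⟨a, b⟩, hab, h⟩
    rw [Finset.mem_offDiag] at hab
    rcases Sym2.eq_iff.1 h with ⟨rfl, rfl⟩ | ⟨rfl, rfl⟩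
    · exact hab
    · exact ⟨hab.2.1, hab.1, hab.2.2.symm⟩
  · exact fun h => ⟨(x, y), Finset.mem_offDiag.2 h, rfl⟩

theorem InputGraph.exists_of_edges {S : Finset ℕ} (hS : S.Nonempty) {D : Finset (Sym2 ℕ)}
    (hD : D ⊆ S.offDiag.image Sym2.mk.uncurry) (hcover : ∀ x ∈ S, ∃ y, s(x, y) ∈ D) :
    ∃ H : InputGraph, H.V = S ∧ H.m = D.card := by
  classical
  have hadj : ∀ {x y}, (SimpleGraph.fromEdgeSet (D : Set (Sym2 ℕ))).Adj x y ↔ s(x, y) ∈ D := by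
    intro x y
    rw [SimpleGraph.fromEdgeSet_adj]
    exact and_iff_left_of_imp fun h => (mk_mem_image_offDiag.1 (hD h)).2.2
  let H : InputGraph :=
    { V := S
      graph := SimpleGraph.fromEdgeSet (D : Set (Sym2 ℕ))
      nonempty := hS
      mem_of_adj := fun x y h => (mk_mem_image_offDiag.1 (hD (hadj.1 h))).1
      no_isolated := fun x hx => (hcover x hx).imp fun y h => hadj.2 h }
  refine ⟨H, rfl, ?_⟩
  rw [InputGraph.m]
  congr 1
  ext z
  induction z using Sym2.ind with
  | _ x y =>
  simp only [InputGraph.edgesIn, Finset.mem_filter, SimpleGraph.mem_edgeSet,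
    Finset.mk_mem_sym2_iff]
  refine ⟨fun h => hadj.1 h.2, fun h => ⟨?_, hadj.2 h⟩⟩
  have hxy := mk_mem_image_offDiag.1 (hD h)
  exact ⟨hxy.1, hxy.2.1⟩

theorem exists_edge_cover_range {r : ℕ} (hr : 2 ≤ r) :
    ∃ F ⊆ (Finset.range r).offDiag.image Sym2.mk.uncurry, 2 * F.card ≤ r + 1 ∧
      ∀ x ∈ Finset.range r, ∃ y, s(x, y) ∈ F := by
  -- The last vertex is matched to `0` if `r` is odd.
  let w : ℕ → ℕ := fun i => if 2 * i + 1 < r then 2 * i + 1 else 0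
  refine ⟨(Finset.range ((r + 1) / 2)).image fun i => s(2 * i, w i), ?_, ?_, fun x hx => ?_⟩
  · intro z hz
    obtain ⟨i, hi, rfl⟩ := Finset.mem_image.1 hz
    rw [Finset.mem_range] at hi
    rw [mk_mem_image_offDiag, Finset.mem_range, Finset.mem_range]
    grind
  · have hcard := (Finset.card_image_le (s := Finset.range ((r + 1) / 2))
      (f := fun i => s(2 * i, w i)))
    rw [Finset.card_range] at hcard
    lia
  · rw [Finset.mem_range] at hx
    have hmem : s(2 * (x / 2), w (x / 2)) ∈
        (Finset.range ((r + 1) / 2)).image fun i => s(2 * i, w i) :=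
      Finset.mem_image_of_mem _ (Finset.mem_range.2 (by lia))
    rcases Nat.mod_two_eq_zero_or_one x with hx2 | hx2
    · rw [show 2 * (x / 2) = x by lia] at hmem
      exact ⟨_, hmem⟩
    · rw [show w (x / 2) = x by grind, Sym2.eq_swap] at hmem
      exact ⟨_, hmem⟩

theorem InputGraph.exists_core {r e : ℕ} (hr : 2 ≤ r) (he : r ≤ 2 * e) (he' : e ≤ r.choose 2) :
    ∃ H : InputGraph, H.V = Finset.range H.n ∧ H.n = r ∧ H.m = e := by
  obtain ⟨F, hF, hFcard, hcover⟩ := exists_edge_cover_range hr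
  obtain ⟨D, hFD, hD, rfl⟩ := Finset.exists_subsuperset_card_eq hF (show F.card ≤ e by lia)
    (by rwa [Sym2.card_image_offDiag, Finset.card_range])
  obtain ⟨H, hV, hm⟩ := exists_of_edges (Finset.nonempty_range_iff.2 (by lia)) hD
    fun x hx => (hcover x hx).imp fun y h => hFD h
  have hn : H.n = r := by rw [InputGraph.n, hV, Finset.card_range]
  exact ⟨H, by rw [hn, hV], hn, hm⟩

theorem add_eq_of_toReal_add_eq {a b c : ℝ≥0∞} (ha : a ≠ ⊤) (hb : b ≠ ⊤) (hc : c ≠ ⊤)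
    (h : a.toReal + b.toReal = c.toReal) : a + b = c := by
  rwa [← ENNReal.toReal_eq_toReal_iff' (ENNReal.add_ne_top.2 ⟨ha, hb⟩) hc, ENNReal.toReal_add ha hb]

namespace Algorithm

variable (A : Algorithm) (G : InputGraph) {H H' : InputGraph}

theorem haltedInd_le_one (P : ℝ → ℕ → Prop) (c : A.Config) : A.haltedInd P c ≤ 1 := by
  rcases c with ⟨_ | v, k⟩
  · exact zero_le_one
  · rw [haltedInd]
    split_ifs
    · exact le_rfl
    · exact zero_le_one

theorem haltedInd_eq_zero {P : ℝ → ℕ → Prop} {c : A.Config} (h : ∀ v, ¬ P v c.2) :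
    A.haltedInd P c = 0 := by
  rcases c with ⟨s | v, k⟩
  · rfl
  · exact if_neg (h v)

theorem value_add (φ ψ : A.Config → ℝ≥0∞) (t : ℕ) (c : A.Config) :
    A.value G (fun c => φ c + ψ c) t c = A.value G φ t c + A.value G ψ t c := by
  induction t generalizing c with
  | zero => rfl
  | succ t ih => exact (congrArg (expect _) (funext ih)).trans (expect_add _ _ _)

theorem value_haltedInd_le (P : ℝ → ℕ → Prop) (q : ℝ) (t : ℕ) :
    A.value G (A.haltedInd P) t (.inl A.start, 0) ≤
      A.value G (A.haltedInd fun v k => P v k ∧ k < ⌈q⌉₊) t (.inl A.start, 0) +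
        A.probCostGe G q := by
  classical
  have hcost : (A.config G t).toOuterMeasure {c | q ≤ (c.2 : ℝ)} ≤ A.probCostGe G q :=
    le_iSup (fun t => (A.config G t).toOuterMeasure {c | q ≤ (c.2 : ℝ)}) t
  refine le_trans ?_ (add_le_add_right hcost _)
  rw [toOuterMeasure_eq_prob, prob, expect_config, ← value_add]
  refine A.value_mono G (fun c => ?_) t _
  rcases c with ⟨s | v, k⟩
  · exact zero_le
  by_cases hk : k < ⌈q⌉₊
  · exact le_add_right (@ite_one_zero_mono _ _ (_) (_) fun hP => ⟨hP, hk⟩)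
  · have hq : q ≤ (k : ℝ) := Nat.ceil_le.1 (not_lt.1 hk)
    exact le_add_left (ite_one_zero_mono fun _ => hq)

theorem value_haltedInd_le_of_disjoint {P P' : ℝ → ℕ → Prop} (hPP' : ∀ v k, P v k → ¬ P' v k)
    (h : 2 / 3 < A.probHalt G P') (t : ℕ) :
    A.value G (A.haltedInd P) t (.inl A.start, 0) ≤ 1 / 3 := by
  rw [probHalt_eq_eventually, eventually, lt_iSup_iff] at h
  obtain ⟨s, hs⟩ := h
  have hmono := A.value_monotone G (A.haltedInd_le_expect G P) (le_max_left t s) (.inl A.start, 0)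
  have hmono' :=
    A.value_monotone G (A.haltedInd_le_expect G P') (le_max_right t s) (.inl A.start, 0)
  have hsum : ∀ c, A.haltedInd P c + A.haltedInd P' c ≤ 1 := by
    rintro ⟨s | v, k⟩
    · simp only [haltedInd, add_zero, zero_le_one]
    · by_cases hP : P v k
      · simp only [haltedInd, if_pos hP, if_neg (hPP' v k hP), add_zero, le_refl]
      · simpa only [haltedInd, if_neg hP, zero_add] using A.haltedInd_le_one P' (.inr v, k)
  have htotal := A.value_le_one G hsum (max t s) (.inl A.start, 0)
  rw [value_add] at htotal
  have hthird : (1 / 3 : ℝ≥0∞) + 2 / 3 = 1 :=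
    add_eq_of_toReal_add_eq (by finiteness) (by finiteness) (by finiteness)
      (by norm_num [ENNReal.toReal_div])
  exact (ENNReal.add_le_add_iff_right (by finiteness)).1
    (((add_le_add hmono (hs.le.trans hmono')).trans htotal).trans_eq hthird.symm)

theorem exists_le_value_of_probCostGe_lt {P : ℝ → ℕ → Prop} {q : ℝ}
    (hP : 2 / 3 < A.probHalt G P) (hq : A.probCostGe G q < 1 / 4) :
    ∃ t, 5 / 12 ≤ A.value G (A.haltedInd fun v k => P v k ∧ k < ⌈q⌉₊) t (.inl A.start, 0) := by
  rw [probHalt_eq_eventually, eventually, lt_iSup_iff] at hP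
  obtain ⟨t, ht⟩ := hP
  have hsum : (5 / 12 : ℝ≥0∞) + 1 / 4 = 2 / 3 :=
    add_eq_of_toReal_add_eq (by finiteness) (by finiteness) (by finiteness)
      (by norm_num [ENNReal.toReal_div])
  refine ⟨t, (ENNReal.add_le_add_iff_right (by finiteness : (1 / 4 : ℝ≥0∞) ≠ ⊤)).1 ?_⟩
  exact hsum.trans_le
    (ht.le.trans ((A.value_haltedInd_le G P q t).trans (add_le_add_right hq.le _)))

theorem le_avgOn_placements_value {P : ℝ → ℕ → Prop} {a : ℝ≥0∞} {N p : ℕ} (hpN : p < N)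
    (h : ∀ σ ∈ placements N p ∅, ∃ t,
      a ≤ A.value (H.planted σ) (A.haltedInd P) t (.inl A.start, 0)) :
    ∃ t, a ≤ avgOn (placements N p ∅) fun σ =>
      A.value (H.planted σ) (A.haltedInd P) t (.inl A.start, 0) := by
  choose! τ hτ using h
  refine ⟨(placements N p ∅).sup τ, ?_⟩
  rw [← avgOn.const (placements_nonempty (Finset.empty_subset _) (Nat.zero_le _) hpN) a]
  exact avgOn.mono fun σ hσ => (hτ σ hσ).trans
    (A.value_monotone _ (A.haltedInd_le_expect _ _) (Finset.le_sup hσ) _)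

theorem exists_planted_quarter_le_probCostGe {c : ℝ} (hc : 1 ≤ c)
    (hA : ∀ G : InputGraph,
      2 / 3 < A.probHalt G (fun nhat _ => (G.n : ℝ) / c ≤ nhat ∧ nhat ≤ c * G.n))
    (hH : H.V = Finset.range H.n) (hH' : H'.V = Finset.range H'.n)
    {N p p' : ℕ} {q : ℝ} (hp : ⌈q⌉₊ ≤ p + 1) (hp' : ⌈q⌉₊ ≤ p' + 1) (hpN : p < N) (hpN' : p' < N)
    (hcn : c ^ 2 * (H.n + 2 * p : ℕ) < (H'.n + 2 * p' : ℕ))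
    (hloss : (⌈q⌉₊ - 1 : ℕ) * (queryLoss ⌈q⌉₊ N H.n p + queryLoss ⌈q⌉₊ N H'.n p') < 1 / 12) :
    ∃ σ : Finset ℕ × ℕ, σ.1.card = p ∧ 1 / 4 ≤ A.probCostGe (H.planted σ) q := by
  by_contra! hcheap
  let P : ℝ → ℕ → Prop := fun v _ =>
    ((H.n + 2 * p : ℕ) : ℝ) / c ≤ v ∧ v ≤ c * (H.n + 2 * p : ℕ)
  have hn : ∀ (H : InputGraph) (p : ℕ), ∀ σ ∈ placements N p ∅, (H.planted σ).n = H.n + 2 * p := by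
    intro H p σ hσ
    rw [H.planted_n, (mem_placements.1 hσ).1.1.2, add_comm]
  obtain ⟨t, ht⟩ := A.le_avgOn_placements_value (H := H) hpN fun σ hσ =>
    A.exists_le_value_of_probCostGe_lt (H.planted σ) (hn H p σ hσ ▸ hA (H.planted σ))
      (hcheap σ (mem_placements.1 hσ).1.1.2)
  have ht' : (avgOn (placements N p' ∅) fun σ => A.value (H'.planted σ)
      (A.haltedInd fun v k => P v k ∧ k < ⌈q⌉₊) t (.inl A.start, 0)) ≤ 1 / 3 := by
    refine avgOn.le_of_le fun σ hσ => ?_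
    refine A.value_haltedInd_le_of_disjoint _ (fun v k h h' => ?_) (hA (H'.planted σ)) t
    rw [hn H' p' σ hσ] at h'
    have hc0 : 0 < c := by linarith
    have hlarge := (div_le_iff₀ hc0).1 h'.1
    have hsmall := mul_le_mul_of_nonneg_right h.1.2 hc0.le
    nlinarith
  have happrox := A.approx_avgOn_value (A.haltedInd_le_one fun v k => P v k ∧ k < ⌈q⌉₊)
    (fun x hx => A.haltedInd_eq_zero fun v h => absurd h.2 (not_lt.2 hx)) hH hH' hp hp' hpN hpN'
    t (.inl A.start) (Finset.empty_subset (Finset.range N)) Finset.card_empty.le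
  have hlt : (5 / 12 : ℝ≥0∞) < 1 / 3 + 1 / 12 :=
    (ht.trans (happrox.1.trans (add_le_add_left ht' _))).trans_lt
      (ENNReal.add_lt_add_left (by finiteness) hloss)
  refine hlt.ne' (add_eq_of_toReal_add_eq (by finiteness) (by finiteness) (by finiteness) ?_)
  norm_num [ENNReal.toReal_div]

end Algorithm

theorem mul_queryLoss_le {Q N r p : ℕ}
    (hr : 60 * ((Q - 1) * (r + 2 * Q)) ≤ r + 2 * p) (hN : 60 * ((Q - 1) * (2 * (p + 1))) ≤ N) :
    ((Q - 1 : ℕ) : ℝ≥0∞) * queryLoss Q N r p ≤ 1 / 30 := by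
  have hcore : (((Q - 1) * (r + 2 * Q) : ℕ) : ℝ≥0∞) / (r + 2 * p : ℕ) ≤ (1 : ℕ) / (60 : ℕ) :=
    natCast_div_le_natCast_div (by lia) (by lia)
  have hlabel : (((Q - 1) * (2 * (p + 1)) : ℕ) : ℝ≥0∞) / N ≤ (1 : ℕ) / (60 : ℕ) :=
    natCast_div_le_natCast_div (by lia) (by lia)
  refine le_trans (le_of_eq ?_) ((add_le_add hcore hlabel).trans_eq (add_eq_of_toReal_add_eq
    (by finiteness) (by finiteness) (by finiteness) (by norm_num [ENNReal.toReal_div])))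
  rw [queryLoss, Nat.cast_mul, Nat.cast_mul (Q - 1), Nat.cast_mul 2 (p + 1), Nat.cast_two,
    mul_add, mul_div_assoc, mul_div_assoc, mul_div_assoc]

theorem exists_mod_two_eq (a n : ℕ) : ∃ r, a ≤ r ∧ r ≤ a + 1 ∧ r % 2 = n % 2 := by
  by_cases h : a % 2 = n % 2
  · exact ⟨a, le_rfl, by lia, h⟩
  · exact ⟨a + 1, by lia, le_rfl, by lia⟩

theorem exists_core_size_of_lt {n m Q : ℕ} {S : ℝ} (hS : S ^ 2 = 2 * m) (hnm : n ≤ 2 * m)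
    (hS0 : 0 < S) (hnS : 100 * S < n) (hQ : Q = ⌈1 / 100 * (n / S)⌉₊) :
    ∃ r p e, 2 ≤ r ∧ r ≤ 2 * e ∧ e ≤ r.choose 2 ∧ r + 2 * p = n ∧ p + e = m ∧ Q ≤ p + 1 ∧
      60 * ((Q - 1) * (r + 2 * Q)) ≤ n := by
  have hnm' : (n : ℝ) ≤ 2 * m := by exact_mod_cast hnm
  have hS10 : 10 < S := by nlinarith
  obtain ⟨r, hr1, hr2, hrn⟩ := exists_mod_two_eq (⌈S⌉₊ + 1) n
  have hSr : S + 1 ≤ r := by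
    have : (⌈S⌉₊ : ℝ) + 1 ≤ r := by exact_mod_cast hr1
    linarith [Nat.le_ceil S]
  have hrS : (r : ℝ) < S + 3 := by
    have : (r : ℝ) ≤ ⌈S⌉₊ + 1 + 1 := by exact_mod_cast hr2
    linarith [Nat.ceil_lt_add_one hS0.le]
  have hrn' : r ≤ n := by exact_mod_cast (by linarith : (r : ℝ) ≤ n)
  have hr2 : 2 ≤ r := by exact_mod_cast (by linarith : (2 : ℝ) ≤ r)
  obtain ⟨p, hp⟩ : ∃ p, r + 2 * p = n := ⟨(n - r) / 2, by lia⟩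
  have hp' : (r : ℝ) + 2 * p = n := by exact_mod_cast hp
  obtain ⟨e, he⟩ : ∃ e, p + e = m := ⟨m - p, by lia⟩
  have hratio : n / S * S = n := div_mul_cancel₀ _ hS0.ne'
  have hratio100 : 100 < n / S := (lt_div_iff₀ hS0).2 hnS
  have hratioS : n / S ≤ S := by
    rw [div_le_iff₀ hS0]
    nlinarith
  have hQlt : (Q : ℝ) < 1 / 100 * (n / S) + 1 := hQ ▸ Nat.ceil_lt_add_one (by positivity)
  have hQ1 : 1 ≤ Q := by
    rw [hQ, Nat.one_le_ceil_iff]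
    linarith
  refine ⟨r, p, e, hr2, by lia, ?_, hp, he, ?_, ?_⟩
  · have hchoose : (m : ℝ) ≤ r.choose 2 := by
      rw [Nat.cast_choose_two]
      nlinarith
    exact (Nat.le_of_add_left_le he.le).trans (by exact_mod_cast hchoose)
  · exact_mod_cast (by linarith : (Q : ℝ) ≤ p + 1)
  · have hprod := mul_le_mul (by linarith : (Q : ℝ) - 1 ≤ 1 / 100 * (n / S))
      (by linarith : (r : ℝ) + 2 * Q ≤ 8 / 5 * S) (by positivity) (by positivity)
    have hle : ((60 * ((Q - 1) * (r + 2 * Q)) : ℕ) : ℝ) ≤ n := by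
      push_cast [Nat.cast_sub hQ1]
      linarith
    exact_mod_cast hle

/-- About `√(2 * m)` vertices suffice for a core with all the edges that the pairs leave over; if
`n ≤ 100 * √(2 * m)`, then the bound to be shown is at most one query, and the core is the whole
graph. -/
theorem exists_core_size {n m Q : ℕ} (hn : 2 ≤ n) (hnm : n ≤ 2 * m) (hm : m ≤ n.choose 2)
    (hQ : Q = ⌈1 / 100 * (n / √(2 * m))⌉₊) :
    ∃ r p e, 2 ≤ r ∧ r ≤ 2 * e ∧ e ≤ r.choose 2 ∧ r + 2 * p = n ∧ p + e = m ∧ Q ≤ p + 1 ∧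
      60 * ((Q - 1) * (r + 2 * Q)) ≤ n := by
  have hm0 : (0 : ℝ) < 2 * m := by exact_mod_cast (by lia : 0 < 2 * m)
  have hS0 : 0 < √(2 * m : ℝ) := Real.sqrt_pos.2 hm0
  rcases le_or_gt (n : ℝ) (100 * √(2 * m)) with hle | hlt
  · have hQ1 : Q ≤ 1 := by
      rw [hQ, Nat.ceil_le, Nat.cast_one, one_div_mul_eq_div, div_le_one (by norm_num),
        div_le_iff₀ hS0]
      exact hle
    refine ⟨n, 0, m, hn, hnm, hm, rfl, Nat.zero_add m, hQ1, ?_⟩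
    rw [Nat.sub_eq_zero_of_le hQ1, zero_mul, mul_zero]
    exact Nat.zero_le n
  · exact exists_core_size_of_lt (Real.sq_sqrt hm0.le) hnm hS0 hlt hQ

theorem exists_quarter_le_probCostGe {c : ℝ} (hc : 1 ≤ c) {A : Algorithm}
    (hA : ∀ G : InputGraph,
      2 / 3 < A.probHalt G (fun nhat _ => (G.n : ℝ) / c ≤ nhat ∧ nhat ≤ c * G.n))
    {n m : ℕ} (hn : 2 ≤ n) (hnm : n ≤ 2 * m) (hm : m ≤ n.choose 2) :
    ∃ G : InputGraph, G.n = n ∧ G.m = m ∧ 1 / 4 ≤ A.probCostGe G (1 / 100 * √(G.n / G.avgDeg)) := by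
  obtain ⟨Q, hQ⟩ : ∃ Q, Q = ⌈1 / 100 * (n / √(2 * m))⌉₊ := ⟨_, rfl⟩
  obtain ⟨r, p, e, hr, hre, he, hrp, hpe, hQp, hQr⟩ := exists_core_size hn hnm hm hQ
  obtain ⟨H, hH, hHn, hHm⟩ := InputGraph.exists_core hr hre he
  obtain ⟨H', hH', hHn', -⟩ := InputGraph.exists_core (r := 2) (e := 1) le_rfl le_rfl (by decide)
  obtain ⟨p', hp'⟩ : ∃ p', p' = ⌈c ^ 2 * n⌉₊ + Q + 60 * ((Q - 1) * (2 + 2 * Q)) := ⟨_, rfl⟩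
  obtain ⟨N, hN⟩ : ∃ N, N = p + p' + 1 + 60 * ((Q - 1) * (2 * (p + 1))) +
    60 * ((Q - 1) * (2 * (p' + 1))) := ⟨_, rfl⟩
  have hcn : c ^ 2 * (H.n + 2 * p : ℕ) < (H'.n + 2 * p' : ℕ) := by
    rw [hHn, hrp]
    refine (Nat.le_ceil _).trans_lt ?_
    exact_mod_cast (by lia : ⌈c ^ 2 * n⌉₊ < H'.n + 2 * p')
  have hloss : (Q - 1 : ℕ) * (queryLoss Q N H.n p + queryLoss Q N H'.n p') < 1 / 12 := by
    rw [hHn, hHn', mul_add]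
    refine (add_le_add (mul_queryLoss_le (by lia) (by lia))
      (mul_queryLoss_le (by lia) (by lia))).trans_lt ?_
    rw [add_eq_of_toReal_add_eq (c := 1 / 15) (by finiteness) (by finiteness) (by finiteness)
      (by norm_num [ENNReal.toReal_div]),
      ← ENNReal.toReal_lt_toReal (by finiteness) (by finiteness)]
    norm_num [ENNReal.toReal_div]
  obtain ⟨σ, hσ, hcost⟩ := A.exists_planted_quarter_le_probCostGe hc hA hH hH' (N := N)
    (q := 1 / 100 * (n / √(2 * m))) (by rwa [← hQ]) (by rw [← hQ]; lia) (by lia) (by lia) hcn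
    (by rwa [← hQ])
  have hGn : (H.planted σ).n = n := by
    rw [H.planted_n, hσ, hHn, ← hrp, add_comm]
  have hGm : (H.planted σ).m = m := by
    rw [H.planted_m, hσ, hHm, hpe]
  refine ⟨H.planted σ, hGn, hGm, ?_⟩
  rwa [InputGraph.sqrt_n_div_avgDeg, hGn, hGm]

theorem theorem1p5 :
    -- (a) upper bound in the advanced model
    (∃ (C : ℝ) (j : ℕ), ∀ ε : ℝ, 0 < ε → ε < 1 →
      ∃ A : Algorithm, A.IsAdvanced ∧ ∀ G : InputGraph,
        99 / 100 < A.probHalt G (fun nhat cost =>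
          |nhat - G.n| ≤ ε * G.n ∧
          (cost : ℝ) ≤ C * (ε⁻¹ ^ 2 * √(G.n / G.avgDeg)) * Real.log G.n ^ j)) ∧
    -- (b) lower bound in the full adjacency model
    (∀ c : ℝ, 1 ≤ c → ∃ κ : ℝ, 0 < κ ∧ ∀ A : Algorithm,
      (∀ G : InputGraph,
        2 / 3 < A.probHalt G (fun nhat _ => (G.n : ℝ) / c ≤ nhat ∧ nhat ≤ c * G.n)) →
      ∀ n m : ℕ, 2 ≤ n → n ≤ 2 * m → m ≤ n.choose 2 →
        ∃ G : InputGraph, G.n = n ∧ G.m = m ∧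
          1 / 4 ≤ A.probCostGe G (κ * √(G.n / G.avgDeg))) :=
  ⟨exists_approximation_algorithm, fun _ hc => ⟨1 / 100, by norm_num, fun _ hA _ _ hn hnm hm =>
    exists_quarter_le_probCostGe hc hA hn hnm hm⟩⟩
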